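/- **Setting.** Let $G:[0,1]\to\mathbb{R}$ be convex and differentiable on $(0,1)$. For $x,y\in[0,1]$ let $D_G(y\,\|\,x)=G(y)-G(x)-(y-x)G'(x)$ be the Bregman divergence (one-sided, possibly infinite, derivatives at the endpoints; $D_G(x\,\|\,x)=0$), and let $\mathrm{JB}_G(a,b)=\frac{G(a)+G(b)}{2}-G\left(\frac{a+b}{2}\right)$. For $c>0$, $\mathrm{JB}_G$ satisfies the *$c$-approximate triangle inequality* if $\mathrm{JB}_G(a,x)+\mathrm{JB}_G(x,b)\ge c\,\mathrm{JB}_G(a,b)$ for all $a,b,x\in[0,1]$. An *information structure* $\mathcal{I}=(\Omega,\mathbb{P},\mathcal{S},\mathcal{T},Y)$ consists of a probability space, Alice's signal $\sigma:\Omega\to\mathcal{S}$, Bob's signal $\tau:\Omega\to\mathcal{T}$ and a random variable $Y:\Omega\to[0,1]$. For $S\subseteq\mathcal{S}$, $T\subseteq\mathcal{T}$ measurable write $\mu_{\sigma\tau}=\mathbb{E}[Y\mid\sigma,\tau]$, $\mu_{S\tau}=\mathbb{E}[Y\mid\sigma\in S,\tau]$, $\mu_{\sigma T}=\mathbb{E}[Y\mid\sigma,\tau\in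 T]$, $\mu_{ST}=\mathbb{E}[Y\mid\sigma\in S,\tau\in T]$. $\mathcal{I}$ satisfies *rectangle substitutes* with respect to $G$ if for all $S,T$ with $\mathbb{P}[\sigma\in S,\tau\in T]>0$, with all expectations conditional on $\sigma\in S,\tau\in T$, $$\mathbb{E}[D_G(Y\|\mu_{S\tau})]-\mathbb{E}[D_G(Y\|\mu_{\sigma\tau})]\le \mathbb{E}[D_G(Y\|\mu_{ST})]-\mathbb{E}[D_G(Y\|\mu_{\sigma T})].$$ In a deterministic communication protocol Alice and Bob take turns sending messages; each message is a function of the sender's signal and of all previous messages. The protocol terminates almost surely, at a time determined by the transcript so far. Let $a=\mathbb{E}[Y\mid\sigma,\text{final transcript}]$ and $b=\mathbb{E}[Y\mid\tau,\text{final transcript}]$ be Alice's and Bob's expectations at the end. The protocol *causes Alice and Bob to $\epsilon$-agree* on $\mathcal{I}$ with respect to $G$ if $\mathbb{E}[\mathrm{JB}_G(a,b)]\le\epsilon$. Alice is *$\delta$-accurate* if $\mathbb{E}[D_G(\mu_{\sigma\tau}\|a)]\le\delta$, and Bob is if $\mathbb{E}[D_G(\mu_{\sigma\tau}\|b)]\le\delta$.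 **Corollary 4.5.** Let $G$ be as above and let $r>0$ be such that $G(0)-G(x)\le O(x^r)$ and $G(1)-G(1-x)\le O(x^r)$ as $x\to0^+$. Then there is a constant $C$, depending only on $G$ and $r$, such that the following holds for every $c>0$ for which $\mathrm{JB}_G$ satisfies the $c$-approximate triangle inequality, every $\epsilon\ge0$, every information structure $\mathcal{I}$ that satisfies rectangle substitutes with respect to $G$, and every communication protocol that causes Alice and Bob to $\epsilon$-agree on $\mathcal{I}$ with respect to $G$: after the protocol terminates, Alice and Bob are both $C\,\epsilon^{\,r/(r+1-\log_2 c)}$-accurate. In particular, for squared error, $G(x)=x^2$, there is an absolute constant $C$ such that for every information structure that satisfies rectangle substitutes and every protocol that causes Alice and Bob to $\epsilon$-agree on it, Alice and Bob are both $C\,\epsilon^{1/3}$-accurate. -/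

import Mathlib

open MeasureTheory ProbabilityTheory Set Filter Topology

noncomputable section

/-! ### Bregman and Jensen-Bregman divergences -/

/-- The Bregman divergence `D_G(y ‖ x) = G y - G x - (y - x) G'(x)` of a convex function `G` on
`[0, 1]`, differentiable on `(0, 1)`.  At an endpoint `x` the derivative is the one-sided one; it may
be infinite (as for `G x = x log x + (1 - x) log (1 - x)`), and then the divergence from `x` to
`y ≠ x` is `∞`.  The real expression is nonnegative, because `G` is convex. -/
def bregmanDiv (G : ℝ → ℝ) (y x : ℝ) : ENNReal :=
  open Classical in
  if y = x then 0
  else if DifferentiableWithinAt ℝ G (Icc 0 1) x then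
    ENNReal.ofReal (G y - G x - (y - x) * derivWithin G (Icc 0 1) x)
  else ⊤

/-- The Jensen-Bregman divergence `JB_G(a, b)`. -/
def jensenBregman (G : ℝ → ℝ) (a b : ℝ) : ℝ :=
  (G a + G b) / 2 - G ((a + b) / 2)

/-- `JB_G` satisfies the `c`-approximate triangle inequality on `[0, 1]`. -/
def ApproxTriangle (G : ℝ → ℝ) (c : ℝ) : Prop :=
  ∀ a ∈ Icc (0 : ℝ) 1, ∀ b ∈ Icc (0 : ℝ) 1, ∀ x ∈ Icc (0 : ℝ) 1,
    c * jensenBregman G a b ≤ jensenBregman G a x + jensenBregman G x b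

/-! ### Information structures -/

/-- A probability space of states of the world, Alice's signal `σ`, Bob's signal `τ`, and the
quantity of interest `Y` with values in `[0, 1]`. -/
structure InfoStructure (Ω S T : Type*)
    [MeasurableSpace Ω] [MeasurableSpace S] [MeasurableSpace T] where
  P : Measure Ω
  isProbabilityMeasure : IsProbabilityMeasure P
  σ : Ω → S
  measurable_σ : Measurable σ
  τ : Ω → T
  measurable_τ : Measurable τ
  Y : Ω → ℝ
  measurable_Y : Measurable Y
  Y_mem : ∀ ω, Y ω ∈ Icc (0 : ℝ) 1

/-! ### Deterministic communication protocols -/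

/-- A deterministic communication protocol.  The message number `n` (counted from `0`) is sent by
Alice if `aliceTurn n` is true and by Bob otherwise; it is a function of the sender's signal and of
the `n` earlier messages.  The protocol ends as soon as the transcript of the first `n` messages
lies in `halt n`. -/
structure Protocol (S T M : Type*)
    [MeasurableSpace S] [MeasurableSpace T] [MeasurableSpace M] where
  aliceTurn : ℕ → Bool
  alice : (n : ℕ) → S × (Fin n → M) → M
  measurable_alice : ∀ n, Measurable (alice n)
  bob : (n : ℕ) → T × (Fin n → M) → M
  measurable_bob : ∀ n, Measurable (bob n)
  halt : (n : ℕ) → Set (Fin n → M)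
  measurableSet_halt : ∀ n, MeasurableSet (halt n)

namespace Protocol

variable {S T M : Type*} [MeasurableSpace S] [MeasurableSpace T] [MeasurableSpace M]

/-- The first `n` messages on the signal pair `(s, t)`, if the halting rule is ignored. -/
def transcript (π : Protocol S T M) (s : S) (t : T) : (n : ℕ) → (Fin n → M)
  | 0 => Fin.elim0
  | n + 1 => Fin.snoc (π.transcript s t n)
      (if π.aliceTurn n then π.alice n (s, π.transcript s t n)
        else π.bob n (t, π.transcript s t n))

/-- On the signal pair `(s, t)` the protocol has ended after at most `n` messages. -/
def EndedBy (π : Protocol S T M) (s : S) (t : T) (n : ℕ) : Prop :=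
  ∃ k ≤ n, π.transcript s t k ∈ π.halt k

/-- The final transcript: the messages that are sent before the protocol ends, followed by the
constant symbol `Sum.inr ()`, which is no message. -/
def finalTranscript (π : Protocol S T M) (s : S) (t : T) : ℕ → M ⊕ Unit :=
  open Classical in
  fun n => if π.EndedBy s t n then Sum.inr () else Sum.inl (π.transcript s t (n + 1) (Fin.last n))

end Protocol

namespace InfoStructure

variable {Ω S T M : Type*}
  [MeasurableSpace Ω] [MeasurableSpace S] [MeasurableSpace T] [MeasurableSpace M]

/-- The truth `μ_{στ} = E[Y | σ, τ]`. -/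
def truth (I : InfoStructure Ω S T) : Ω → ℝ :=
  I.P[I.Y | MeasurableSpace.comap (fun ω => (I.σ ω, I.τ ω)) inferInstance]

/-- The event `σ ∈ A, τ ∈ B`. -/
def rect (I : InfoStructure Ω S T) (A : Set S) (B : Set T) : Set Ω :=
  I.σ ⁻¹' A ∩ I.τ ⁻¹' B

/-- `μ_{σB} = E[Y | τ ∈ B, σ]`. -/
def condAlice (I : InfoStructure Ω S T) (B : Set T) : Ω → ℝ :=
  (cond I.P (I.τ ⁻¹' B))[I.Y | MeasurableSpace.comap I.σ inferInstance]

/-- `μ_{Aτ} = E[Y | σ ∈ A, τ]`. -/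
def condBob (I : InfoStructure Ω S T) (A : Set S) : Ω → ℝ :=
  (cond I.P (I.σ ⁻¹' A))[I.Y | MeasurableSpace.comap I.τ inferInstance]

/-- `μ_{AB} = E[Y | σ ∈ A, τ ∈ B]`. -/
def condRect (I : InfoStructure Ω S T) (A : Set S) (B : Set T) : ℝ :=
  ∫ ω, I.Y ω ∂(cond I.P (I.rect A B))

/-- The expected error `E[D_G(Y ‖ X) | σ ∈ A, τ ∈ B]` of an estimate `X`. -/
def expectedError (I : InfoStructure Ω S T) (G : ℝ → ℝ) (A : Set S) (B : Set T) (X : Ω → ℝ) :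
    ENNReal :=
  ∫⁻ ω, bregmanDiv G (I.Y ω) (X ω) ∂(cond I.P (I.rect A B))

/-- Rectangle substitutes with respect to `G`: for all rectangles `A × B` of positive probability,
`E[D(Y ‖ μ_{Aτ})] - E[D(Y ‖ μ_{στ})] ≤ E[D(Y ‖ μ_{AB})] - E[D(Y ‖ μ_{σB})]`, expectations given
`σ ∈ A, τ ∈ B`.  The values are in `[0, ∞]`, so the subtracted terms (which are finite) are written
on the other side. -/
def RectangleSubstitutes (I : InfoStructure Ω S T) (G : ℝ → ℝ) : Prop :=
  ∀ (A : Set S) (B : Set T), MeasurableSet A → MeasurableSet B → I.P (I.rect A B) ≠ 0 →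
    I.expectedError G A B (I.condBob A) + I.expectedError G A B (I.condAlice B) ≤
      I.expectedError G A B (fun _ => I.condRect A B) + I.expectedError G A B I.truth

/-- The final transcript as a random variable. -/
def finalTranscript (I : InfoStructure Ω S T) (π : Protocol S T M) (ω : Ω) : ℕ → M ⊕ Unit :=
  π.finalTranscript (I.σ ω) (I.τ ω)

/-- The protocol terminates almost surely. -/
def Terminates (I : InfoStructure Ω S T) (π : Protocol S T M) : Prop :=
  ∀ᵐ ω ∂I.P, ∃ n, π.EndedBy (I.σ ω) (I.τ ω) n

/-- Alice's expectation at the end of the protocol, `E[Y | σ, final transcript]`.  On a transcript of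
positive probability, which occurs exactly if `(σ, τ) ∈ A × B`, this is `μ_{σB}`. -/
def aliceExpectation (I : InfoStructure Ω S T) (π : Protocol S T M) : Ω → ℝ :=
  I.P[I.Y | MeasurableSpace.comap (fun ω => (I.σ ω, I.finalTranscript π ω)) inferInstance]

/-- Bob's expectation at the end of the protocol, `E[Y | τ, final transcript]`.  On a transcript of
positive probability, which occurs exactly if `(σ, τ) ∈ A × B`, this is `μ_{Aτ}`. -/
def bobExpectation (I : InfoStructure Ω S T) (π : Protocol S T M) : Ω → ℝ :=
  I.P[I.Y | MeasurableSpace.comap (fun ω => (I.τ ω, I.finalTranscript π ω)) inferInstance]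

/-- The protocol causes Alice and Bob to `ε`-agree on `I` with respect to `G`: it terminates, and
then `E[JB_G(a, b)] ≤ ε` (the integrand is bounded for convex `G`). -/
def CausesAgreement (I : InfoStructure Ω S T) (G : ℝ → ℝ) (π : Protocol S T M) (ε : ℝ) : Prop :=
  I.Terminates π ∧
    ∫ ω, jensenBregman G (I.aliceExpectation π ω) (I.bobExpectation π ω) ∂I.P ≤ ε

/-- The estimate `a` is `δ`-accurate with respect to `G`: `E[D_G(μ_{στ} ‖ a)] ≤ δ`. -/
def Accurate (I : InfoStructure Ω S T) (G : ℝ → ℝ) (a : Ω → ℝ) (δ : ℝ) : Prop :=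
  ∫⁻ ω, bregmanDiv G (I.truth ω) (a ω) ∂I.P ≤ ENNReal.ofReal δ

end InfoStructure

end

/-! ### Convex functions on the unit interval -/

section ConvexUnit

variable {G : ℝ → ℝ}

/-! Every loss is a difference of expected values of `G`. If `X = E[Y | m]`, the linear term of the
Bregman divergence integrates to zero, so `E[D_G(Y ‖ X)] = E[G(Y)] - E[G(X)]`
(`lintegral_bregmanDiv_condExp`). Hence Bob's inaccuracy is `E[G(truth)] - E[G(b)]`, and rectangle
substitutes become an inequality between four expectations of `G`.

Let Alice announce, after the protocol, a block of values that contains her expectation `a`. Over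
each block `G` stays within `2D` of a chord, so the extended transcript `T'` satisfies `E[G(a)] ≤
E[G(E[Y | T'])] + 2D` (`integral_comp_sub_le_of_blocks`). Substitutes on `T'` then bound by `2D` the
loss of a Bob who hears the announcement. The actual Bob guesses it from `b`. A block consists of
three buckets of Jensen-Bregman width about `δ` (`exists_buckets`). If `b` lies in the middle
bucket, a wrong guess puts `a` and `b` at divergence at least `δ`, which has probability `p ≤ ε/δ`
by Markov. Hearing a message that could be guessed with error probability `p` moves the expectation
by at most `p` in `L¹` where the guess is right (`setIntegral_abs_condExp_sub_le`); as `G` is Hölder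
of exponent `r`, this costs `K p^r` (`setIntegral_loss_le`). Three shifts of the blocks put every
bucket in the middle once. Since `D` is a multiple of `δ`, the choice `δ = ε^(r/(r+1))` balances the
terms (`integral_loss_le`).

For `c ≤ 1` and `ε ≤ 1` this is at least as good as the claimed power. Only the constant involves
the triangle inequality, so one admissible `c₀` serves for every `c`. The trivial bound `2 JB_G(0,
1)` covers `ε ≥ 1` and the degenerate cases `c > 1` and `r > 1`, where `JB_G(0, 1) = 0`.

Messages are arbitrary, so each single transcript may have probability zero, while substitutes speak
of rectangles of positive probability. `RectApprox` says that countable statistics of the transcript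
are, off a small event, partitions into rectangles. It survives each message and the limit, and `L²`
estimates carry the inequality over (`RectSubstitutes.of_rectApprox`). -/

theorem ConvexOn.apply_le_combo {s : Set ℝ} (hG : ConvexOn ℝ s G) {u v a b : ℝ} (hu : u ∈ s)
    (hv : v ∈ s) (ha : 0 ≤ a) (hb : 0 ≤ b) (hab : a + b = 1) :
    G (a * u + b * v) ≤ a * G u + b * G v := by
  simpa only [smul_eq_mul] using hG.2 hu hv ha hb hab

/-- Spreading two points apart, with their sum fixed, increases the sum of the values. -/
theorem ConvexOn.add_le_add_of_spread {s : Set ℝ} (hG : ConvexOn ℝ s G) {u v p q : ℝ}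
    (hu : u ∈ s) (hv : v ∈ s) (hup : u ≤ p) (hpv : p ≤ v) (hsum : p + q = u + v) :
    G p + G q ≤ G u + G v := by
  rcases eq_or_lt_of_le (hup.trans hpv) with h | h
  · have hp : p = u := le_antisymm (h ▸ hpv) hup
    have hq : q = v := by linarith
    rw [hp, hq]
  · have hd : 0 < v - u := sub_pos.2 h
    have h1 := hG.apply_le_combo hu hv (a := (v - p) / (v - u)) (b := (p - u) / (v - u))
      (div_nonneg (by linarith) hd.le) (div_nonneg (by linarith) hd.le)
      (by field_simp; ring)
    have h2 := hG.apply_le_combo hu hv (a := (p - u) / (v - u)) (b := (v - p) / (v - u))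
      (div_nonneg (by linarith) hd.le) (div_nonneg (by linarith) hd.le)
      (by field_simp; ring)
    have e1 : (v - p) / (v - u) * u + (p - u) / (v - u) * v = p := by field_simp; ring
    have e2 : (p - u) / (v - u) * u + (v - p) / (v - u) * v = q := by
      have : q = u + v - p := by linarith
      rw [this]; field_simp; ring
    simp only [e1, e2] at h1 h2
    have e3 : (v - p) / (v - u) = 1 - (p - u) / (v - u) := by field_simp; ring
    rw [e3] at h1 h2
    nlinarith

theorem jensenBregman_comm (a b : ℝ) : jensenBregman G a b = jensenBregman G b a := by
  simp only [jensenBregman, add_comm]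

theorem jensenBregman_self (a : ℝ) : jensenBregman G a a = 0 := by
  simp [jensenBregman]

theorem midpoint_mem_Icc {a b : ℝ} (ha : a ∈ Icc (0 : ℝ) 1) (hb : b ∈ Icc (0 : ℝ) 1) :
    (a + b) / 2 ∈ Icc (0 : ℝ) 1 :=
  ⟨by linarith [ha.1, hb.1], by linarith [ha.2, hb.2]⟩

theorem jensenBregman_nonneg (hG : ConvexOn ℝ (Icc 0 1) G) {a b : ℝ} (ha : a ∈ Icc (0 : ℝ) 1)
    (hb : b ∈ Icc (0 : ℝ) 1) : 0 ≤ jensenBregman G a b := by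
  have h := hG.apply_le_combo ha hb (a := 1 / 2) (b := 1 / 2) (by norm_num) (by norm_num) (by norm_num)
  have e : (1 / 2 : ℝ) * a + 1 / 2 * b = (a + b) / 2 := by ring
  simp only [e] at h
  unfold jensenBregman
  linarith

/-- The Jensen-Bregman divergence is superadditive on adjacent intervals. -/
theorem jensenBregman_add_le (hG : ConvexOn ℝ (Icc 0 1) G) {a x b : ℝ} (ha : a ∈ Icc (0 : ℝ) 1)
    (hb : b ∈ Icc (0 : ℝ) 1) (hax : a ≤ x) (hxb : x ≤ b) :
    jensenBregman G a x + jensenBregman G x b ≤ jensenBregman G a b := by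
  have hx : x ∈ Icc (0 : ℝ) 1 := ⟨ha.1.trans hax, hxb.trans hb.2⟩
  -- The midpoints of the two halves have the sum `x + (a + b) / 2` and enclose `x`.
  have h := hG.add_le_add_of_spread (midpoint_mem_Icc ha hx) (midpoint_mem_Icc hx hb)
    (p := x) (q := (a + b) / 2) (by linarith) (by linarith) (by ring)
  unfold jensenBregman
  linarith

theorem jensenBregman_mono (hG : ConvexOn ℝ (Icc 0 1) G) {a x y b : ℝ} (ha : a ∈ Icc (0 : ℝ) 1)
    (hb : b ∈ Icc (0 : ℝ) 1) (hax : a ≤ x) (hxy : x ≤ y) (hyb : y ≤ b) :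
    jensenBregman G x y ≤ jensenBregman G a b := by
  have hx : x ∈ Icc (0 : ℝ) 1 := ⟨ha.1.trans hax, by linarith [hb.2]⟩
  have hy : y ∈ Icc (0 : ℝ) 1 := ⟨hx.1.trans hxy, hyb.trans hb.2⟩
  linarith [jensenBregman_add_le hG ha hb hax (hxy.trans hyb), jensenBregman_nonneg hG ha hx,
    jensenBregman_add_le hG hx hb hxy hyb, jensenBregman_nonneg hG hy hb]

/-- Under the chord over an interval, a convex function sags by at most twice its Jensen-Bregman
divergence. -/
theorem exists_chord (hG : ConvexOn ℝ (Icc 0 1) G) {u v : ℝ} (hu : u ∈ Icc (0 : ℝ) 1)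
    (hv : v ∈ Icc (0 : ℝ) 1) :
    ∃ α β : ℝ, ∀ x ∈ Icc u v, G x ≤ α + β * x ∧ α + β * x ≤ G x + 2 * jensenBregman G u v := by
  rcases lt_or_ge u v with h | h
  · have hd : 0 < v - u := sub_pos.2 h
    refine ⟨G u - (G v - G u) / (v - u) * u, (G v - G u) / (v - u), fun x hx => ?_⟩
    have key : ∀ y ∈ Icc u v, G y ≤ G u - (G v - G u) / (v - u) * u + (G v - G u) / (v - u) * y := by
      intro y hy
      have h1 := hG.apply_le_combo hu hv (a := (v - y) / (v - u)) (b := (y - u) / (v - u))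
        (div_nonneg (by linarith [hy.2]) hd.le) (div_nonneg (by linarith [hy.1]) hd.le)
        (by field_simp; ring)
      have e1 : (v - y) / (v - u) * u + (y - u) / (v - u) * v = y := by field_simp; ring
      simp only [e1] at h1
      refine h1.trans (le_of_eq ?_)
      field_simp
      ring
    refine ⟨key x hx, ?_⟩
    have hx01 : x ∈ Icc (0 : ℝ) 1 := ⟨hu.1.trans hx.1, hx.2.trans hv.2⟩
    -- For the lower bound, reflect `x` in the midpoint: the midpoint value is at most the mean of
    -- the values at `x` and at its reflection, and the latter is below the chord.
    have hx' : u + v - x ∈ Icc (0 : ℝ) 1 :=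
      ⟨by linarith [hx.2, hu.1], by linarith [hx.1, hv.2]⟩
    have h2 := key (u + v - x) ⟨by linarith [hx.2], by linarith [hx.1]⟩
    have h3 := jensenBregman_nonneg hG hx01 hx'
    unfold jensenBregman at h3 ⊢
    have e2 : (x + (u + v - x)) / 2 = (u + v) / 2 := by ring
    rw [e2] at h3
    have e3 : (G v - G u) / (v - u) * v = (G v - G u) + (G v - G u) / (v - u) * u := by
      field_simp
      ring
    have e4 : (G v - G u) / (v - u) * (u + v - x) = (G v - G u) / (v - u) * u +
      ((G v - G u) + (G v - G u) / (v - u) * u) - (G v - G u) / (v - u) * x := by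
      rw [← e3]; ring
    linarith
  · refine ⟨G u, 0, fun x hx => ?_⟩
    have hxu : x = u := le_antisymm (hx.2.trans h) hx.1
    have hvu : v = u := le_antisymm h (hx.1.trans hx.2)
    simp [hxu, hvu, jensenBregman_self]

/-- A convex function on `[0, 1]` is bounded there. -/
theorem ConvexOn.exists_abs_le (hG : ConvexOn ℝ (Icc 0 1) G) :
    ∃ M : ℝ, ∀ x ∈ Icc (0 : ℝ) 1, |G x| ≤ M := by
  obtain ⟨α, β, h⟩ := exists_chord hG (u := 0) (v := 1) (by simp) (by simp)
  refine ⟨|α| + |β| + 2 * jensenBregman G 0 1, fun x hx => ?_⟩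
  have h0 := jensenBregman_nonneg hG (a := 0) (b := 1) (by simp) (by simp)
  have h1 : |β * x| ≤ |β| := by
    rw [abs_mul, abs_of_nonneg hx.1]
    exact mul_le_of_le_one_right (abs_nonneg _) hx.2
  obtain ⟨h2, h3⟩ := h x hx
  rw [abs_le] at h1 ⊢
  constructor <;> linarith [neg_abs_le α, le_abs_self α]

/-- The endpoint growth condition, made global. -/
theorem exists_growth_bound {f : ℝ → ℝ} {r M : ℝ} (hr : 0 < r)
    (hM : ∀ x ∈ Icc (0 : ℝ) 1, f x ≤ M) (h0 : f 0 ≤ 0)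
    (h : ∃ K : ℝ, ∀ᶠ x in 𝓝[>] (0 : ℝ), f x ≤ K * x ^ r) :
    ∃ K : ℝ, 0 ≤ K ∧ ∀ x ∈ Icc (0 : ℝ) 1, f x ≤ K * x ^ r := by
  obtain ⟨K, hK⟩ := h
  obtain ⟨t, ht, hKt⟩ := mem_nhdsGT_iff_exists_Ioo_subset.1 hK
  have ht : (0 : ℝ) < t := ht
  -- The second summand serves for `x ≥ t`, where only boundedness is available.
  refine ⟨|K| + |M| / t ^ r, by positivity, fun x hx => ?_⟩
  have hxr : 0 ≤ x ^ r := Real.rpow_nonneg hx.1 r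
  rcases hx.1.eq_or_lt with rfl | hx0
  · rw [Real.zero_rpow hr.ne', mul_zero]
    exact h0
  rcases lt_or_ge x t with h | h
  · have h2 : f x ≤ K * x ^ r := hKt ⟨hx0, h⟩
    have h3 : K * x ^ r ≤ |K| * x ^ r := mul_le_mul_of_nonneg_right (le_abs_self K) hxr
    have h4 : 0 ≤ |M| / t ^ r * x ^ r := by positivity
    linarith
  · have h2 : |M| ≤ |M| / t ^ r * x ^ r := by
      rw [div_mul_eq_mul_div, le_div_iff₀ (Real.rpow_pos_of_pos ht r)]
      exact mul_le_mul_of_nonneg_left (Real.rpow_le_rpow ht.le h hr.le) (abs_nonneg M)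
    have h3 : 0 ≤ |K| * x ^ r := by positivity
    linarith [hM x hx, le_abs_self M]

/-- A convex function whose drop at the endpoints is `O(x ^ r)` is Hölder continuous. -/
theorem ConvexOn.exists_abs_sub_le_rpow (hG : ConvexOn ℝ (Icc 0 1) G) {r : ℝ} (hr : 0 < r)
    (h0 : ∃ K : ℝ, ∀ᶠ x in 𝓝[>] (0 : ℝ), G 0 - G x ≤ K * x ^ r)
    (h1 : ∃ K : ℝ, ∀ᶠ x in 𝓝[>] (0 : ℝ), G 1 - G (1 - x) ≤ K * x ^ r) :
    ∃ K : ℝ, 0 ≤ K ∧ ∀ x ∈ Icc (0 : ℝ) 1, ∀ y ∈ Icc (0 : ℝ) 1, |G x - G y| ≤ K * |x - y| ^ r := by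
  obtain ⟨M, hM⟩ := hG.exists_abs_le
  have z01 : (0 : ℝ) ∈ Icc (0 : ℝ) 1 := by simp
  have o01 : (1 : ℝ) ∈ Icc (0 : ℝ) 1 := by simp
  obtain ⟨K₀, hK₀, h0⟩ := exists_growth_bound (f := fun x => G 0 - G x) (M := 2 * M) hr
    (fun x hx => by linarith [abs_le.1 (hM 0 z01), abs_le.1 (hM x hx)]) (by simp) h0
  obtain ⟨K₁, hK₁, h1⟩ := exists_growth_bound (f := fun x => G 1 - G (1 - x)) (M := 2 * M) hr
    (fun x hx => by
      have hx' : 1 - x ∈ Icc (0 : ℝ) 1 := ⟨by linarith [hx.2], by linarith [hx.1]⟩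
      linarith [abs_le.1 (hM 1 o01), abs_le.1 (hM (1 - x) hx')]) (by simp) h1
  refine ⟨max K₀ K₁, le_max_of_le_left hK₀, ?_⟩
  have key : ∀ x ∈ Icc (0 : ℝ) 1, ∀ y ∈ Icc (0 : ℝ) 1, x ≤ y →
      |G x - G y| ≤ max K₀ K₁ * |x - y| ^ r := by
    intro x hx y hy hxy
    have hd : y - x ∈ Icc (0 : ℝ) 1 := ⟨by linarith, by linarith [hx.1, hy.2]⟩
    have e : |x - y| = y - x := by rw [abs_sub_comm, abs_of_nonneg hd.1]
    have hp : 0 ≤ (y - x) ^ r := Real.rpow_nonneg hd.1 r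
    have l0 := h0 (y - x) hd
    have l1 := h1 (y - x) hd
    -- Increments of a convex function grow with position: sliding `[x, y]` to the left end bounds
    -- the drop `G x - G y`, sliding it to the right end bounds the rise.
    have s0 := hG.add_le_add_of_spread z01 hy (p := x) (q := y - x) hx.1 hxy (by ring)
    have s1 := hG.add_le_add_of_spread hx o01 (p := y) (q := 1 - (y - x)) hxy hy.2 (by ring)
    have m0 := mul_le_mul_of_nonneg_right (le_max_left K₀ K₁) hp
    have m1 := mul_le_mul_of_nonneg_right (le_max_right K₀ K₁) hp
    rw [e, abs_le]
    constructor <;> linarith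
  intro x hx y hy
  rcases le_total x y with h | h
  · exact key x hx y hy h
  · rw [abs_sub_comm, abs_sub_comm x y]
    exact key y hy x hx h

theorem ConvexOn.continuousOn_of_rpow {r : ℝ} (hr : 0 < r) {K : ℝ}
    (h : ∀ x ∈ Icc (0 : ℝ) 1, ∀ y ∈ Icc (0 : ℝ) 1, |G x - G y| ≤ K * |x - y| ^ r) :
    ContinuousOn G (Icc 0 1) := by
  intro x hx
  have h1 : Tendsto (fun y => K * |y - x| ^ r) (𝓝[Icc 0 1] x) (𝓝 0) := by
    have : Continuous fun y : ℝ => K * |y - x| ^ r := by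
      have := hr.le
      fun_prop (disch := assumption)
    have h2 := (this.tendsto x).mono_left (nhdsWithin_le_nhds (s := Icc 0 1))
    simpa [Real.zero_rpow hr.ne'] using h2
  rw [ContinuousWithinAt, tendsto_iff_dist_tendsto_zero]
  refine squeeze_zero' (Eventually.of_forall fun _ => dist_nonneg) ?_ h1
  filter_upwards [self_mem_nhdsWithin] with y hy
  exact h y hy x hx

/-- A Hölder exponent above `1` makes a convex function flat. -/
theorem jensenBregman_zero_one_nonpos (hG : ConvexOn ℝ (Icc 0 1) G) {r K : ℝ} (hr : 1 < r)
    (h : ∀ x ∈ Icc (0 : ℝ) 1, ∀ y ∈ Icc (0 : ℝ) 1, |G x - G y| ≤ K * |x - y| ^ r) :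
    jensenBregman G 0 1 ≤ 0 := by
  have z01 : (0 : ℝ) ∈ Icc (0 : ℝ) 1 := by simp
  have o01 : (1 : ℝ) ∈ Icc (0 : ℝ) 1 := by simp
  -- By convexity the drops from the two ends over length `t` sum to at least `4 t JB_G(0, 1)`,
  -- while Hölder continuity allows only `2 K t ^ r`. Since `r > 1`, dividing by `t` and letting `t
  -- → 0` finishes.
  have key : ∀ t ∈ Ioc (0 : ℝ) (1 / 2), jensenBregman G 0 1 ≤ K * t ^ (r - 1) := by
    intro t ht
    have ht01 : t ∈ Icc (0 : ℝ) 1 := ⟨ht.1.le, by linarith [ht.2]⟩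
    have ht01' : 1 - t ∈ Icc (0 : ℝ) 1 := ⟨by linarith [ht01.2], by linarith [ht.1]⟩
    have hh : (1 / 2 : ℝ) ∈ Icc (0 : ℝ) 1 := by norm_num
    have c0 := hG.apply_le_combo z01 hh (a := 1 - 2 * t) (b := 2 * t) (by linarith [ht.2]) (by linarith [ht.1])
      (by ring)
    have c1 := hG.apply_le_combo o01 hh (a := 1 - 2 * t) (b := 2 * t) (by linarith [ht.2]) (by linarith [ht.1])
      (by ring)
    have e0 : (1 - 2 * t) * 0 + 2 * t * (1 / 2) = t := by ring
    have e1 : (1 - 2 * t) * 1 + 2 * t * (1 / 2) = 1 - t := by ring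
    simp only [e0, e1] at c0 c1
    have d0 := (abs_le.1 (h 0 z01 t ht01)).2
    have d1 := (abs_le.1 (h 1 o01 (1 - t) ht01')).2
    have a0 : |0 - t| = t := by rw [zero_sub, abs_neg, abs_of_pos ht.1]
    have a1 : |1 - (1 - t)| = t := by rw [sub_sub_cancel, abs_of_pos ht.1]
    rw [a0] at d0
    rw [a1] at d1
    have e2 : t ^ r = t * t ^ (r - 1) := by
      rw [← Real.rpow_one_add' ht.1.le (by linarith)]; congr 1; ring
    have d2 : 0 ≤ K * (t * t ^ (r - 1)) := by
      have := (abs_nonneg _).trans (h 0 z01 t ht01)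
      rwa [a0, e2] at this
    rw [e2] at d0 d1
    have e3 : t * jensenBregman G 0 1 ≤ t * (K * t ^ (r - 1)) := by
      unfold jensenBregman
      rw [zero_add]
      nlinarith
    exact le_of_mul_le_mul_left e3 ht.1
  have h1 : Tendsto (fun t : ℝ => K * t ^ (r - 1)) (𝓝[>] 0) (𝓝 0) := by
    have hr' : 0 ≤ r - 1 := by linarith
    have : Continuous fun t : ℝ => K * t ^ (r - 1) := by fun_prop (disch := assumption)
    have h2 := (this.tendsto 0).mono_left (nhdsWithin_le_nhds (s := Ioi 0))
    simpa [Real.zero_rpow (by linarith : r - 1 ≠ 0)] using h2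
  refine ge_of_tendsto h1 ?_
  filter_upwards [Ioc_mem_nhdsGT (by norm_num : (0 : ℝ) < 1 / 2)] with t ht using key t ht

end ConvexUnit

/-! ### Buckets of equal Jensen-Bregman width -/

section Buckets

variable {G : ℝ → ℝ}

/-- The width of `[x, y]` grows continuously from `0`, so it takes the value `δ` exactly unless the
whole rest `[x, 1]` is no wider than `δ`. -/
theorem exists_bucket_step (hc : ContinuousOn G (Icc 0 1)) {δ x : ℝ} (hδ : 0 < δ)
    (hx : x ∈ Icc (0 : ℝ) 1) :
    ∃ y ∈ Icc x 1, jensenBregman G x y ≤ δ ∧ (y ≠ 1 → jensenBregman G x y = δ) := by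
  rcases le_or_gt (jensenBregman G x 1) δ with h | h
  · exact ⟨1, ⟨hx.2, le_rfl⟩, h, fun h' => absurd rfl h'⟩
  · have hcont : ContinuousOn (fun y => jensenBregman G x y) (Icc x 1) := by
      have hsub : Icc x 1 ⊆ Icc 0 1 := Icc_subset_Icc_left hx.1
      have h1 : ContinuousOn (fun y : ℝ => G ((x + y) / 2)) (Icc x 1) :=
        hc.comp (by fun_prop) fun y hy => midpoint_mem_Icc hx (hsub hy)
      exact ((continuousOn_const.add (hc.mono hsub)).div_const 2).sub h1
    have h2 := intermediate_value_Icc hx.2 hcont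
    obtain ⟨y, hy, hyδ⟩ := h2 ⟨by simpa only [jensenBregman_self] using hδ.le, h.le⟩
    exact ⟨y, hy, le_of_eq hyδ, fun _ => hyδ⟩

/-- For every `δ > 0` the unit interval splits into consecutive buckets such that points in
non-adjacent buckets are at divergence at least `δ`, and three consecutive buckets span a divergence
of at most a constant times `δ`. -/
theorem exists_buckets (hG : ConvexOn ℝ (Icc 0 1) G) (hc : ContinuousOn G (Icc 0 1)) {c : ℝ}
    (hcpos : 0 < c) (htri : ApproxTriangle G c) {δ : ℝ} (hδ : 0 < δ) :
    ∃ (κ : ℝ → ℕ) (x : ℕ → ℝ), Measurable κ ∧ (∀ n, x n ∈ Icc (0 : ℝ) 1) ∧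
      (∀ a ∈ Icc (0 : ℝ) 1, a ∈ Icc (x (κ a)) (x (κ a + 1))) ∧ Monotone x ∧
      (∀ a ∈ Icc (0 : ℝ) 1, ∀ b ∈ Icc (0 : ℝ) 1, κ a + 2 ≤ κ b → δ ≤ jensenBregman G a b) ∧
      ∀ n, jensenBregman G (x n) (x (n + 3)) ≤ (δ + 2 * δ / c) / c := by
  have z01 : (0 : ℝ) ∈ Icc (0 : ℝ) 1 := by simp
  have o01 : (1 : ℝ) ∈ Icc (0 : ℝ) 1 := by simp
  choose! next hnext hle heq using fun x hx => exists_bucket_step (x := x) hc hδ hx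
  let x : ℕ → ℝ := fun n => next^[n] 0
  have xs : ∀ n, x (n + 1) = next (x n) := fun n => Function.iterate_succ_apply' next n 0
  have x01 : ∀ n, x n ∈ Icc (0 : ℝ) 1 := by
    intro n
    induction n with
    | zero => exact z01
    | succ n ih => rw [xs]; exact ⟨ih.1.trans (hnext _ ih).1, (hnext _ ih).2⟩
  have hmono : Monotone x := monotone_nat_of_le_succ fun n => by
    rw [xs]; exact (hnext _ (x01 n)).1
  have hstep : ∀ n, jensenBregman G (x n) (x (n + 1)) ≤ δ := fun n => by
    rw [xs]; exact hle _ (x01 n)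
  have hstep' : ∀ n, x (n + 1) ≠ 1 → jensenBregman G (x n) (x (n + 1)) = δ := fun n h => by
    rw [xs] at h ⊢; exact heq _ (x01 n) h
  -- Superadditivity: each full bucket uses up `δ` of the finite total `JB_G(0, 1)`, so the
  -- breakpoints reach `1`.
  have hgrow : ∀ n, x n ≠ 1 → n * δ ≤ jensenBregman G 0 (x n) := by
    intro n
    induction n with
    | zero => intro _; simpa using jensenBregman_nonneg hG z01 (x01 0)
    | succ n ih =>
      intro h
      have h' : x n ≠ 1 := fun h1 => h (le_antisymm (x01 _).2 (h1 ▸ hmono n.le_succ))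
      have := jensenBregman_add_le hG z01 (x01 (n + 1)) (x01 n).1 (hmono n.le_succ)
      rw [hstep' n h] at this
      push_cast
      linarith [ih h']
  have hend : ∃ n, x (n + 1) = 1 := by
    by_contra! h
    obtain ⟨n, hn⟩ := exists_nat_gt (jensenBregman G 0 1 / δ)
    rw [div_lt_iff₀ hδ] at hn
    have h1 := hgrow (n + 1) (h n)
    have h2 := jensenBregman_mono hG z01 o01 le_rfl (x01 (n + 1)).1 (x01 (n + 1)).2
    push_cast at h1
    linarith
  classical
  -- The second alternative takes care of `a ≥ 1`, which no breakpoint exceeds.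
  have hex : ∀ a : ℝ, ∃ n, a < x (n + 1) ∨ x (n + 1) = 1 := fun a => hend.imp fun n h => Or.inr h
  refine ⟨fun a => Nat.find (hex a), x, ?_, x01, ?_, hmono, ?_, ?_⟩
  · refine Monotone.measurable fun a b hab => Nat.find_mono fun n hn => ?_
    exact hn.imp_left hab.trans_lt
  · intro a ha
    constructor
    · beta_reduce
      rcases h : Nat.find (hex a) with _ | k
      · exact ha.1
      · have := Nat.find_min (hex a) (m := k) (by omega)
        push Not at this
        exact this.1
    · rcases Nat.find_spec (hex a) with h | h
      · exact h.le
      · exact ha.2.trans_eq h.symm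
  · intro a ha b hb hab
    have h1 : a ≤ x (Nat.find (hex a) + 1) := by
      rcases Nat.find_spec (hex a) with h | h
      · exact h.le
      · exact ha.2.trans_eq h.symm
    -- Minimality shows that the bucket right after that of `a` lies below `b` and does not end at
    -- `1`, so its width is exactly `δ`.
    have h2 := Nat.find_min (hex b) (m := Nat.find (hex a) + 1) (Nat.lt_of_succ_le hab)
    push Not at h2
    rw [← hstep' _ h2.2]
    exact jensenBregman_mono hG ha hb h1 (hmono (Nat.le_succ _)) h2.1
  · intro n
    -- The triangle inequality merges the last two buckets at cost `2 * δ / c`, then adds the first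
    -- one.
    have t1 := htri _ (x01 (n + 1)) _ (x01 (n + 3)) _ (x01 (n + 2))
    have t2 := htri _ (x01 n) _ (x01 (n + 3)) _ (x01 (n + 1))
    have s1 := hstep n
    have s2 := hstep (n + 1)
    have s3 := hstep (n + 2)
    rw [le_div_iff₀ hcpos, mul_comm]
    have t3 : jensenBregman G (x (n + 1)) (x (n + 3)) ≤ 2 * δ / c := by
      rw [le_div_iff₀ hcpos, mul_comm]
      linarith
    linarith

end Buckets

/-! ### Conditional expectations -/

section CondExp

variable {Ω : Type*} {m m' m0 : MeasurableSpace Ω} {P : Measure Ω} {G : ℝ → ℝ} {Y X : Ω → ℝ}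

theorem integrable_of_ae_mem_Icc [IsFiniteMeasure P] (hYm : AEStronglyMeasurable Y P)
    (hY : ∀ᵐ ω ∂P, Y ω ∈ Icc (0 : ℝ) 1) : Integrable Y P :=
  Integrable.of_bound hYm 1 <| by
    filter_upwards [hY] with ω h
    rw [Real.norm_eq_abs, abs_of_nonneg h.1]
    exact h.2

theorem aestronglyMeasurable_comp_of_continuousOn (hc : ContinuousOn G (Icc 0 1))
    (hYm : AEStronglyMeasurable Y P) (hY : ∀ᵐ ω ∂P, Y ω ∈ Icc (0 : ℝ) 1) :
    AEStronglyMeasurable (fun ω => G (Y ω)) P := by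
  have h1 : Continuous (IccExtend (zero_le_one' ℝ) ((Icc 0 1).domRestrict G)) :=
    hc.domRestrict.Icc_extend'
  refine (h1.comp_aestronglyMeasurable hYm).congr ?_
  filter_upwards [hY] with ω h
  rw [IccExtend_of_mem _ _ h]
  rfl

theorem integrable_comp_of_continuousOn [IsFiniteMeasure P] (hc : ContinuousOn G (Icc 0 1))
    (hYm : AEStronglyMeasurable Y P) (hY : ∀ᵐ ω ∂P, Y ω ∈ Icc (0 : ℝ) 1) :
    Integrable (fun ω => G (Y ω)) P := by
  obtain ⟨M, hM⟩ := isCompact_Icc.exists_bound_of_continuousOn hc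
  refine Integrable.of_bound (aestronglyMeasurable_comp_of_continuousOn hc hYm hY) M ?_
  filter_upwards [hY] with ω h using hM _ h

theorem condExp_mem_Icc [IsFiniteMeasure P] (hm : m ≤ m0) (hYm : AEStronglyMeasurable Y P)
    (hY : ∀ᵐ ω ∂P, Y ω ∈ Icc (0 : ℝ) 1) : ∀ᵐ ω ∂P, P[Y|m] ω ∈ Icc (0 : ℝ) 1 :=
  (convex_Icc 0 1).condExp_mem hm (integrable_of_ae_mem_Icc hYm hY) isClosed_Icc hY

theorem aestronglyMeasurable_condExp (hm : m ≤ m0) : AEStronglyMeasurable (P[Y|m]) P :=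
  (stronglyMeasurable_condExp.mono hm).aestronglyMeasurable

theorem integrable_comp_condExp [IsFiniteMeasure P] (hc : ContinuousOn G (Icc 0 1)) (hm : m ≤ m0)
    (hYm : AEStronglyMeasurable Y P) (hY : ∀ᵐ ω ∂P, Y ω ∈ Icc (0 : ℝ) 1) :
    Integrable (fun ω => G (P[Y|m] ω)) P :=
  integrable_comp_of_continuousOn hc (aestronglyMeasurable_condExp hm) (condExp_mem_Icc hm hYm hY)

/-- Jensen's inequality for conditional expectations, integrated over a set. -/
theorem setIntegral_comp_condExp_le [IsFiniteMeasure P] (hG : ConvexOn ℝ (Icc 0 1) G)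
    (hc : ContinuousOn G (Icc 0 1)) (hm : m ≤ m0) (hYm : AEStronglyMeasurable Y P)
    (hY : ∀ᵐ ω ∂P, Y ω ∈ Icc (0 : ℝ) 1) {F : Set Ω} (hF : MeasurableSet[m] F) :
    ∫ ω in F, G (P[Y|m] ω) ∂P ≤ ∫ ω in F, G (Y ω) ∂P := by
  have hi := integrable_comp_of_continuousOn hc hYm hY
  have h := hG.map_condExp_le hm hc.lowerSemicontinuousOn hY isClosed_Icc
    (integrable_of_ae_mem_Icc hYm hY) hi
  have h1 : ∫ ω in F, G (Y ω) ∂P = ∫ ω in F, P[G ∘ Y|m] ω ∂P :=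
    (setIntegral_condExp hm hi hF).symm
  rw [h1]
  exact setIntegral_mono_ae (integrable_comp_condExp hc hm hYm hY).integrableOn
    integrable_condExp.integrableOn h

theorem integral_mul_condExp [IsFiniteMeasure P] (hm : m ≤ m0) {s : Ω → ℝ}
    (hs : StronglyMeasurable[m] s) (hY : Integrable Y P) {c : ℝ} (hb : ∀ᵐ ω ∂P, ‖s ω‖ ≤ c) :
    ∫ ω, s ω * P[Y|m] ω ∂P = ∫ ω, s ω * Y ω ∂P := by
  have h := condExp_stronglyMeasurable_mul_of_bound hm hs hY c hb
  calc ∫ ω, s ω * P[Y|m] ω ∂P = ∫ ω, P[s * Y|m] ω ∂P := integral_congr_ae h.symm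
    _ = ∫ ω, (s * Y) ω ∂P := integral_condExp hm
    _ = _ := rfl

/-- Integrals can be compared fibre by fibre over a countable partition. -/
theorem integral_le_integral_of_fibre {ι : Type*} [Countable ι] [MeasurableSpace ι]
    [MeasurableSingletonClass ι] {R : Ω → ι} (hR : Measurable R) {f g : Ω → ℝ}
    (hf : Integrable f P) (hg : Integrable g P)
    (h : ∀ l, ∫ ω in R ⁻¹' {l}, f ω ∂P ≤ ∫ ω in R ⁻¹' {l}, g ω ∂P) :
    ∫ ω, f ω ∂P ≤ ∫ ω, g ω ∂P := by
  have hU : ⋃ l, R ⁻¹' {l} = univ := by ext; simp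
  have hd : Pairwise (Function.onFun Disjoint fun l => R ⁻¹' {l}) := fun i j hij =>
    Disjoint.preimage R (by simpa using hij)
  have hs : ∀ l, MeasurableSet (R ⁻¹' {l}) := fun l => hR (measurableSet_singleton l)
  have h1 := hasSum_integral_iUnion hs hd (f := f) (μ := P) hf.integrableOn
  have h2 := hasSum_integral_iUnion hs hd (f := g) (μ := P) hg.integrableOn
  rw [hU, setIntegral_univ] at h1 h2
  exact hasSum_le h h1 h2

/-! ### Conditioning on an event -/

theorem setIntegral_cond {A V : Set Ω} (hV : MeasurableSet V) (f : Ω → ℝ) :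
    ∫ ω in V, f ω ∂(cond P A) = (P.real A)⁻¹ * ∫ ω in V ∩ A, f ω ∂P := by
  rw [ProbabilityTheory.cond, Measure.restrict_smul, integral_smul_measure,
    Measure.restrict_restrict hV, ENNReal.toReal_inv, smul_eq_mul]
  rfl

theorem integral_cond {A : Set Ω} (f : Ω → ℝ) :
    ∫ ω, f ω ∂(cond P A) = (P.real A)⁻¹ * ∫ ω in A, f ω ∂P := by
  simpa using setIntegral_cond (A := A) (P := P) MeasurableSet.univ f

theorem ae_cond_iff [IsFiniteMeasure P] {A : Set Ω} (hA : MeasurableSet A) {p : Ω → Prop} :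
    (∀ᵐ ω ∂(cond P A), p ω) ↔ ∀ᵐ ω ∂P, ω ∈ A → p ω := by
  rw [ProbabilityTheory.cond, Measure.ae_ennreal_smul_measure_iff
    (ENNReal.inv_ne_zero.2 (measure_ne_top P A)), ae_restrict_iff' hA]

theorem integrableOn_of_integrable_cond [IsFiniteMeasure P] {A : Set Ω} (hA0 : P A ≠ 0)
    {f : Ω → ℝ} (hf : Integrable f (cond P A)) : IntegrableOn f A P := by
  rwa [ProbabilityTheory.cond, integrable_smul_measure
    (ENNReal.inv_ne_zero.2 (measure_ne_top P A)) (ENNReal.inv_ne_top.2 hA0)] at hf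

theorem Integrable.cond_of_ne_zero {A : Set Ω} (hA0 : P A ≠ 0) {f : Ω → ℝ}
    (hf : Integrable f P) : Integrable f (cond P A) :=
  hf.restrict.smul_measure (ENNReal.inv_ne_top.2 hA0)

/-- If `m ≤ m'` have the same trace on `A ∩ B`, where `B` is in `m`, then on `A ∩ B` conditioning on
`m'` is conditioning on `A` and `m`. -/
theorem condExp_ae_eq_condExp_cond [IsFiniteMeasure P] (hmm' : m ≤ m') (hm' : m' ≤ m0)
    {A B : Set Ω} (hB : MeasurableSet[m] B)
    (hF : MeasurableSet[m'] (A ∩ B))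
    (htrace : ∀ U, MeasurableSet[m'] U → ∃ V, MeasurableSet[m] V ∧ U ∩ (A ∩ B) = V ∩ (A ∩ B))
    (hY : Integrable Y P) :
    ∀ᵐ ω ∂P, ω ∈ A ∩ B → P[Y|m'] ω = (cond P A)[Y|m] ω := by
  rcases eq_or_ne (P A) 0 with hA0 | hA0
  · filter_upwards [measure_eq_zero_iff_ae_notMem.1 hA0] with ω h h' using absurd h'.1 h
  have hm : m ≤ m0 := hmm'.trans hm'
  have := cond_isProbabilityMeasure (μ := P) hA0
  set X := (cond P A)[Y|m] with hX
  have hXA : IntegrableOn X A P := integrableOn_of_integrable_cond hA0 integrable_condExp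
  have hF0 : MeasurableSet (A ∩ B) := hm' _ hF
  have hXF : Integrable ((A ∩ B).indicator X) P :=
    (hXA.mono_set inter_subset_left).integrable_indicator hF0
  have key : (A ∩ B).indicator X =ᵐ[P] P[(A ∩ B).indicator Y|m'] := by
    refine ae_eq_condExp_of_forall_setIntegral_eq hm' (hY.indicator hF0)
      (fun s _ _ => hXF.integrableOn) (fun U hU _ => ?_)
      ((stronglyMeasurable_condExp.mono hmm').indicator hF).aestronglyMeasurable
    -- On `A ∩ B` the test set `U` may be replaced by `V ∩ B`, which lies in `m`; there the defining
    -- property of `X` under `cond P A` applies, and the normalizing factor cancels.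
    obtain ⟨V, hV, hUV⟩ := htrace U hU
    have e : U ∩ (A ∩ B) = V ∩ B ∩ A := by rw [hUV]; ac_rfl
    rw [setIntegral_indicator hF0, setIntegral_indicator hF0, e]
    have hVB : MeasurableSet[m] (V ∩ B) := hV.inter hB
    have h1 := setIntegral_condExp (μ := cond P A) hm (Integrable.cond_of_ne_zero hA0 hY) hVB
    rw [setIntegral_cond (hm _ hVB), setIntegral_cond (hm _ hVB)] at h1
    have h2 : (P.real A)⁻¹ ≠ 0 :=
      inv_ne_zero ((measureReal_ne_zero_iff (measure_ne_top P A)).2 hA0)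
    exact mul_left_cancel₀ h2 h1
  filter_upwards [key, condExp_indicator hY hF] with ω h1 h2 hω
  rw [h2, indicator_of_mem hω, indicator_of_mem hω] at h1
  exact h1.symm

/-- Conditioning on an event of `m` commutes with conditioning on `m`. -/
theorem condExp_cond_inter [IsFiniteMeasure P] (hm : m ≤ m0) {A B : Set Ω} (hA : MeasurableSet A)
    (hB : MeasurableSet[m] B) (hY : Integrable Y P) :
    (cond P A)[Y|m] =ᵐ[cond P (A ∩ B)] (cond P (A ∩ B))[Y|m] := by
  rw [← cond_cond_eq_cond_inter hA (hm _ hB) P]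
  rcases eq_or_ne (P A) 0 with hA0 | hA0
  · rw [cond_eq_zero_of_meas_eq_zero hA0, cond_eq_zero_of_meas_eq_zero (by simp)]
  have := cond_isProbabilityMeasure (μ := P) hA0
  rw [Filter.EventuallyEq, ae_cond_iff (hm _ hB)]
  filter_upwards [condExp_ae_eq_condExp_cond le_rfl hm (P := cond P A) hB
    (by rwa [inter_self]) (fun U hU => ⟨U, hU, rfl⟩) (Integrable.cond_of_ne_zero hA0 hY)] with ω h h'
  exact h ⟨h', h'⟩

end CondExp

/-! ### The expected Bregman divergence from a conditional expectation -/

section Bregman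

variable {Ω : Type*} {m m0 : MeasurableSpace Ω} {P : Measure Ω} {G : ℝ → ℝ} {Y X : Ω → ℝ}

theorem tangent_le (hG : ConvexOn ℝ (Icc 0 1) G) (hd : DifferentiableOn ℝ G (Ioo 0 1)) {x y : ℝ}
    (hx : x ∈ Ioo (0 : ℝ) 1) (hy : y ∈ Icc (0 : ℝ) 1) : 0 ≤ G y - G x - (y - x) * deriv G x := by
  have hxd : DifferentiableAt ℝ G x := hd.differentiableAt (Ioo_mem_nhds hx.1 hx.2)
  have hx' := Ioo_subset_Icc_self hx
  rcases lt_trichotomy x y with h | h | h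
  · have := hG.deriv_le_slope hx' hy h hxd
    rw [slope_def_field, le_div_iff₀ (sub_pos.2 h)] at this
    linarith
  · simp [h]
  · have := hG.slope_le_deriv hy hx' h hxd
    rw [slope_def_field, div_le_iff₀ (sub_pos.2 h)] at this
    linarith

theorem bregmanDiv_of_mem_Ioo (hd : DifferentiableOn ℝ G (Ioo 0 1)) {x : ℝ}
    (hx : x ∈ Ioo (0 : ℝ) 1) (y : ℝ) :
    bregmanDiv G y x = ENNReal.ofReal (G y - G x - (y - x) * deriv G x) := by
  have hxd : DifferentiableAt ℝ G x := hd.differentiableAt (Ioo_mem_nhds hx.1 hx.2)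
  unfold bregmanDiv
  by_cases h : y = x
  · simp [h]
  · rw [if_neg h, if_pos hxd.differentiableWithinAt,
      derivWithin_of_mem_nhds (Icc_mem_nhds hx.1 hx.2)]

theorem ae_eq_zero_of_condExp_eq_zero [IsFiniteMeasure P] (hm : m ≤ m0) (hY : Integrable Y P)
    (hY0 : 0 ≤ᵐ[P] Y) : ∀ᵐ ω ∂P, P[Y|m] ω = 0 → Y ω = 0 := by
  have hS : MeasurableSet[m] (P[Y|m] ⁻¹' {0}) :=
    stronglyMeasurable_condExp.measurable (measurableSet_singleton 0)
  have h1 : ∫ ω in P[Y|m] ⁻¹' {0}, Y ω ∂P = 0 := by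
    rw [← setIntegral_condExp hm hY hS]
    exact setIntegral_eq_zero_of_forall_eq_zero fun ω hω => hω
  rw [setIntegral_eq_zero_iff_of_nonneg_ae (ae_restrict_of_ae hY0) hY.integrableOn] at h1
  exact (ae_restrict_iff' (hm _ hS)).1 h1

/-- A variable in `[0, 1]` with conditional mean `0` or `1` must equal it. So the infinite
divergence that an endpoint with infinite slope could cause has probability zero. -/
theorem ae_eq_of_condExp_notMem_Ioo [IsFiniteMeasure P] (hm : m ≤ m0)
    (hYm : AEStronglyMeasurable Y P) (hY : ∀ᵐ ω ∂P, Y ω ∈ Icc (0 : ℝ) 1) :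
    ∀ᵐ ω ∂P, P[Y|m] ω ∉ Ioo (0 : ℝ) 1 → Y ω = P[Y|m] ω := by
  have hi := integrable_of_ae_mem_Icc hYm hY
  have h1 : P[(fun _ => (1 : ℝ)) - Y|m] =ᵐ[P] (fun _ => (1 : ℝ)) - P[Y|m] := by
    refine (condExp_sub (integrable_const 1) hi m).trans ?_
    rw [condExp_const hm]
  filter_upwards [condExp_mem_Icc hm hYm hY, h1,
    ae_eq_zero_of_condExp_eq_zero hm hi (hY.mono fun ω h => h.1),
    ae_eq_zero_of_condExp_eq_zero hm ((integrable_const 1).sub hi)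
      (hY.mono fun ω h => sub_nonneg.2 h.2)] with ω hmem h1 h2 h3 hn
  rcases hmem.1.eq_or_lt with h | h
  · rw [← h, h2 h.symm]
  rcases hmem.2.eq_or_lt with h' | h'
  · have := h3 (by rw [h1]; simp [h'])
    simp only [Pi.sub_apply] at this
    linarith
  · exact absurd ⟨h, h'⟩ hn

/-- The expected Bregman divergence of `Y` from `E[Y | m]` is `E[G Y] - E[G (E[Y | m])]`. -/
theorem lintegral_bregmanDiv_condExp [IsFiniteMeasure P] (hG : ConvexOn ℝ (Icc 0 1) G)
    (hd : DifferentiableOn ℝ G (Ioo 0 1)) (hc : ContinuousOn G (Icc 0 1)) (hm : m ≤ m0)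
    (hYm : AEStronglyMeasurable Y P) (hY : ∀ᵐ ω ∂P, Y ω ∈ Icc (0 : ℝ) 1) :
    ∫⁻ ω, bregmanDiv G (Y ω) (P[Y|m] ω) ∂P =
      ENNReal.ofReal (∫ ω, G (Y ω) ∂P - ∫ ω, G (P[Y|m] ω) ∂P) := by
  have hYi := integrable_of_ae_mem_Icc hYm hY
  set X := P[Y|m] with hXdef
  have hXm : StronglyMeasurable[m] X := stronglyMeasurable_condExp
  have hXm0 : Measurable X := (hXm.mono hm).measurable
  have hX : ∀ᵐ ω ∂P, X ω ∈ Icc (0 : ℝ) 1 := condExp_mem_Icc hm hYm hY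
  have hGY := integrable_comp_of_continuousOn hc hYm hY
  have hGX : Integrable (fun ω => G (X ω)) P := integrable_comp_condExp hc hm hYm hY
  have hGYX : Integrable (fun ω => G (Y ω) - G (X ω)) P := hGY.sub hGX
  let D : Ω → ℝ := fun ω => G (Y ω) - G (X ω) - (Y ω - X ω) * deriv G (X ω)
  -- The slope of `G` may be unbounded near the endpoints. It is bounded on each of these intervals,
  -- which exhaust `(0, 1)`.
  let I : ℕ → Set ℝ := fun n => Icc (1 / ((n : ℝ) + 3)) (1 - 1 / ((n : ℝ) + 3))
  have hpos : ∀ n : ℕ, (0 : ℝ) < 1 / ((n : ℝ) + 3) := fun n => by positivity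
  have hIsub : ∀ n, I n ⊆ Ioo 0 1 := fun n x hx =>
    ⟨(hpos n).trans_le hx.1, hx.2.trans_lt (by linarith [hpos n])⟩
  have hImono : Monotone I := fun n k hnk => by
    have h : 1 / ((k : ℝ) + 3) ≤ 1 / ((n : ℝ) + 3) :=
      one_div_le_one_div_of_le (by positivity) (by simpa using hnk)
    exact Icc_subset_Icc h (by linarith)
  have hIU : ⋃ n, I n = Ioo 0 1 := by
    refine subset_antisymm (iUnion_subset hIsub) fun x hx => mem_iUnion.2 ?_
    have h0 : 0 < min x (1 - x) := lt_min hx.1 (sub_pos.2 hx.2)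
    obtain ⟨n, hn⟩ := exists_nat_one_div_lt h0
    have h1 : 1 / ((n : ℝ) + 3) ≤ 1 / ((n : ℝ) + 1) :=
      one_div_le_one_div_of_le (by positivity) (by linarith)
    have h2 := min_le_left x (1 - x)
    have h3 := min_le_right x (1 - x)
    exact ⟨n, by linarith, by linarith⟩
  let U : ℕ → Set Ω := fun n => X ⁻¹' I n
  have hUm : ∀ n, MeasurableSet[m] (U n) := fun n => hXm.measurable measurableSet_Icc
  have hUm0 : ∀ n, MeasurableSet (U n) := fun n => hm _ (hUm n)
  have hUmono : Monotone U := fun n k h => preimage_mono (hImono h)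
  have hUU : ⋃ n, U n = X ⁻¹' Ioo 0 1 := by rw [← preimage_iUnion, hIU]
  have hUU0 : MeasurableSet (⋃ n, U n) := MeasurableSet.iUnion hUm0
  have hout : ∀ᵐ ω ∂P, X ω ∉ Ioo (0 : ℝ) 1 → Y ω = X ω := ae_eq_of_condExp_notMem_Ioo hm hYm hY
  have hderiv : ∀ n, ∃ C, ∀ x ∈ I n, ‖deriv G x‖ ≤ C := fun n => by
    have hmon : MonotoneOn (deriv G) (Ioo 0 1) :=
      (hG.subset Ioo_subset_Icc_self (convex_Ioo 0 1)).monotoneOn_deriv fun x hx =>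
        hd.differentiableAt (Ioo_mem_nhds hx.1 hx.2)
    have hle : 1 / ((n : ℝ) + 3) ≤ 1 - 1 / ((n : ℝ) + 3) := by
      have : 1 / ((n : ℝ) + 3) ≤ 1 / 3 :=
        one_div_le_one_div_of_le (by norm_num) (by linarith [n.cast_nonneg (α := ℝ)])
      linarith
    refine ⟨max |deriv G (1 / ((n : ℝ) + 3))| |deriv G (1 - 1 / ((n : ℝ) + 3))|, fun x hx => ?_⟩
    exact abs_le_max_abs_abs (hmon (hIsub n ⟨le_rfl, hle⟩) (hIsub n hx) hx.1)
      (hmon (hIsub n hx) (hIsub n ⟨hle, le_rfl⟩) hx.2)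
  have hstep : ∀ n, ∫⁻ ω in U n, bregmanDiv G (Y ω) (X ω) ∂P =
      ENNReal.ofReal (∫ ω in U n, (G (Y ω) - G (X ω)) ∂P) := by
    intro n
    obtain ⟨C, hC⟩ := hderiv n
    -- The truncated slope is bounded and `m`-measurable, so its products with `Y` and with `E[Y |
    -- m]` have the same integral and the linear term vanishes.
    let s : Ω → ℝ := (U n).indicator fun ω => deriv G (X ω)
    have hs : StronglyMeasurable[m] s :=
      (((measurable_deriv G).comp hXm.measurable).stronglyMeasurable).indicator (hUm n)
    have hsb : ∀ ω, ‖s ω‖ ≤ max C 0 := fun ω => by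
      by_cases h : ω ∈ U n
      · simp only [s, indicator_of_mem h]
        exact (hC _ h).trans (le_max_left _ _)
      · simp only [s, indicator_of_notMem h, norm_zero]
        exact le_max_right _ _
    have hs0 : AEStronglyMeasurable s P := (hs.mono hm).aestronglyMeasurable
    have hsY : Integrable (fun ω => s ω * Y ω) P := hYi.bdd_mul hs0 (ae_of_all _ hsb)
    have hsX : Integrable (fun ω => s ω * X ω) P :=
      integrable_condExp.bdd_mul hs0 (ae_of_all _ hsb)
    have hsYX : Integrable (fun ω => s ω * Y ω - s ω * X ω) P := hsY.sub hsX
    have hDs : ∀ ω ∈ U n, D ω = (G (Y ω) - G (X ω)) - (s ω * Y ω - s ω * X ω) := fun ω hω => by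
      simp only [D, s, indicator_of_mem hω]
      ring
    have hDi : IntegrableOn D (U n) P :=
      (hGYX.sub hsYX).integrableOn.congr_fun
        (fun ω hω => (hDs ω hω).symm) (hUm0 n)
    have hD0 : 0 ≤ᵐ[P.restrict (U n)] D := by
      rw [Filter.EventuallyLE, ae_restrict_iff' (hUm0 n)]
      filter_upwards [hY] with ω h hω
      exact tangent_le hG hd (hIsub n hω) h
    calc ∫⁻ ω in U n, bregmanDiv G (Y ω) (X ω) ∂P
        = ∫⁻ ω in U n, ENNReal.ofReal (D ω) ∂P :=
          setLIntegral_congr_fun (hUm0 n) fun ω hω => bregmanDiv_of_mem_Ioo hd (hIsub n hω) _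
      _ = ENNReal.ofReal (∫ ω in U n, D ω ∂P) := (ofReal_integral_eq_lintegral_ofReal hDi hD0).symm
      _ = _ := by
        congr 1
        rw [setIntegral_congr_fun (hUm0 n) hDs, integral_sub hGYX.integrableOn
          hsYX.integrableOn, sub_eq_self]
        have e : ∀ f : Ω → ℝ, ∫ ω in U n, s ω * f ω ∂P = ∫ ω, s ω * f ω ∂P := fun f =>
          setIntegral_eq_integral_of_forall_compl_eq_zero fun ω hω => by
            simp [s, indicator_of_notMem hω]
        rw [integral_sub hsY.integrableOn hsX.integrableOn, e, e,
          integral_mul_condExp hm hs hYi (ae_of_all _ hsb), sub_self]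
  -- The left side converges because its integrand is nonnegative, the right side because `G(Y) -
  -- G(X)` is integrable; the linear term need not be integrable on the union.
  have hlim1 : Tendsto (fun n => ∫⁻ ω in U n, bregmanDiv G (Y ω) (X ω) ∂P) atTop
      (𝓝 (∫⁻ ω in ⋃ n, U n, bregmanDiv G (Y ω) (X ω) ∂P)) := by
    rw [setLIntegral_iUnion_of_directed _ hUmono.directed_le]
    exact tendsto_atTop_iSup fun n k h => lintegral_mono_set (hUmono h)
  have hlim2 := tendsto_setIntegral_of_monotone hUm0 hUmono hGYX.integrableOn (μ := P)
  have hlim := tendsto_nhds_unique hlim1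
    (((ENNReal.continuous_ofReal.tendsto _).comp hlim2).congr fun n => (hstep n).symm)
  have hzero : ∫⁻ ω in (⋃ n, U n)ᶜ, bregmanDiv G (Y ω) (X ω) ∂P = 0 := by
    rw [lintegral_eq_zero_of_ae_eq_zero]
    rw [Filter.EventuallyEq, ae_restrict_iff' hUU0.compl]
    filter_upwards [hout] with ω h hω
    rw [hUU] at hω
    simp [bregmanDiv, h hω]
  have hzero' : ∫ ω in (⋃ n, U n)ᶜ, (G (Y ω) - G (X ω)) ∂P = 0 := by
    refine setIntegral_eq_zero_of_ae_eq_zero ?_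
    filter_upwards [hout] with ω h hω
    rw [hUU] at hω
    simp [h hω]
  rw [← lintegral_add_compl _ hUU0, hzero, add_zero, hlim, ← integral_sub hGY hGX,
    ← integral_add_compl hUU0 hGYX]
  rw [hzero', add_zero]

end Bregman

/-! ### Approximation by rectangular partitions -/

section RectApprox

variable {Ω : Type*} {m m0 : MeasurableSpace Ω} {P : Measure Ω}

/-- The graph map turns the supremum into one pulled-back σ-algebra. Functions then factor through
it, and another statistic can be substituted for `c` in the factor. -/
theorem sup_comap_eq_comap_prodMk {ι : Type*} [mι : MeasurableSpace ι] (m : MeasurableSpace Ω)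
    (c : Ω → ι) : m ⊔ mι.comap c = (m.prod mι).comap fun ω => (ω, c ω) := by
  rw [MeasurableSpace.prod, MeasurableSpace.comap_sup, MeasurableSpace.comap_comp,
    MeasurableSpace.comap_comp]
  exact congrArg (· ⊔ mι.comap c) MeasurableSpace.comap_id.symm

/-- A function measurable with respect to `m` and `c` is a measurable function of the point and the
value of `c`. -/
theorem exists_eq_comp_prodMk {ι Z : Type*} [mι : MeasurableSpace ι] [MeasurableSpace Z]
    [StandardBorelSpace Z] [Nonempty Z] {c : Ω → ι} {X : Ω → Z}
    (hX : Measurable[m ⊔ mι.comap c] X) :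
    ∃ h : Ω × ι → Z, Measurable[m.prod mι] h ∧ ∀ ω, X ω = h (ω, c ω) := by
  rw [sup_comap_eq_comap_prodMk] at hX
  obtain ⟨h, hm, he⟩ := Measurable.exists_eq_measurable_comp (mY := m.prod mι) hX
  exact ⟨h, hm, fun ω => congrFun he ω⟩

theorem measurable_comp_prodMk {ι Z : Type*} [mι : MeasurableSpace ι] [MeasurableSpace Z]
    {h : Ω × ι → Z} (hh : Measurable[m.prod mι] h) (c : Ω → ι) :
    Measurable[m ⊔ mι.comap c] fun ω => h (ω, c ω) := by
  rw [sup_comap_eq_comap_prodMk]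
  exact hh.comp (comap_measurable (m := m.prod mι) fun ω => (ω, c ω))

/-! ### Approximation in directed families of σ-algebras -/

theorem exists_measure_iUnion_diff_le [IsFiniteMeasure P] {s : ℕ → Set Ω}
    (hs : ∀ n, MeasurableSet (s n)) {η : ENNReal} (hη : η ≠ 0) :
    ∃ N, P ((⋃ n, s n) \ ⋃ n ∈ Finset.range N, s n) ≤ η := by
  have hanti : Antitone fun N => (⋃ n, s n) \ ⋃ n ∈ Finset.range N, s n := fun N N' h =>
    sdiff_subset_sdiff_right (biUnion_subset_biUnion_left (Finset.range_subset_range.2 h))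
  have hempty : ⋂ N, (⋃ n, s n) \ ⋃ n ∈ Finset.range N, s n = ∅ := by
    refine eq_empty_of_forall_notMem fun ω hω => ?_
    obtain ⟨n, hn⟩ := mem_iUnion.1 (mem_iInter.1 hω 0).1
    exact (mem_iInter.1 hω (n + 1)).2 (mem_biUnion (Finset.self_mem_range_succ n) hn)
  have h := tendsto_measure_iInter_atTop (μ := P) (fun N => ((MeasurableSet.iUnion hs).diff
    (Finset.measurableSet_biUnion _ fun n _ => hs n)).nullMeasurableSet) hanti
    ⟨0, measure_ne_top P _⟩
  rw [hempty, measure_empty] at h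
  exact (h.eventually_le_const (pos_iff_ne_zero.2 hη)).exists

/-- A set in the supremum of a directed family of σ-algebras is almost in one of them. -/
theorem exists_measurableSet_symmDiff_le [IsFiniteMeasure P] {ι : Type*} [Nonempty ι]
    {F : ι → MeasurableSpace Ω} (hd : Directed (· ≤ ·) F) (hF : ∀ i, F i ≤ m0) {E : Set Ω}
    (hE : MeasurableSet[⨆ i, F i] E) :
    ∀ η : ENNReal, η ≠ 0 → ∃ i E', MeasurableSet[F i] E' ∧ P (symmDiff E E') ≤ η := by
  rw [MeasurableSpace.measurableSet_iSup] at hE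
  have hgen : MeasurableSpace.generateFrom {s | ∃ i, MeasurableSet[F i] s} ≤ m0 :=
    MeasurableSpace.generateFrom_le fun s ⟨i, hi⟩ => hF i s hi
  refine MeasurableSpace.generateFrom_induction {s | ∃ i, MeasurableSet[F i] s}
    (fun E _ => ∀ η : ENNReal, η ≠ 0 → ∃ i E', MeasurableSet[F i] E' ∧ P (symmDiff E E') ≤ η)
    ?_ ?_ ?_ ?_ E hE
  · rintro t ⟨i, hi⟩ - η -
    exact ⟨i, t, hi, by simp⟩
  · intro η _
    exact ⟨Classical.arbitrary ι, ∅, (F _).measurableSet_empty, by simp⟩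
  · intro t _ ih η hη
    obtain ⟨i, E', hE', h⟩ := ih η hη
    exact ⟨i, E'ᶜ, hE'.compl, by rwa [compl_symmDiff_compl]⟩
  · classical
    intro s hs ih η hη
    have hη2 : η / 2 ≠ 0 := by simpa using hη
    obtain ⟨ε, hε, hεsum⟩ := ENNReal.exists_pos_sum_of_countable' hη2 ℕ
    -- Half of `η` pays for approximating the sets `s n` with summable errors, the other half for
    -- cutting the union off at `N`; directedness puts the finitely many approximants into one
    -- σ-algebra.
    choose i E' hE' hsE' using fun n => ih n (ε n) (hε n).ne'
    obtain ⟨N, hN⟩ := exists_measure_iUnion_diff_le (P := P) (fun n => hgen _ (hs n)) hη2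
    obtain ⟨j, hj⟩ := hd.finset_le ((Finset.range N).image i)
    refine ⟨j, ⋃ n ∈ Finset.range N, E' n, Finset.measurableSet_biUnion _ fun n hn =>
      hj _ (Finset.mem_image_of_mem i hn) _ (hE' n), ?_⟩
    have hsub : symmDiff (⋃ n, s n) (⋃ n ∈ Finset.range N, E' n) ⊆
        ((⋃ n, s n) \ ⋃ n ∈ Finset.range N, s n) ∪
          ⋃ n ∈ Finset.range N, symmDiff (s n) (E' n) := by
      rintro ω (⟨h1, h2⟩ | ⟨h1, h2⟩)
      · by_cases h : ω ∈ ⋃ n ∈ Finset.range N, s n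
        · obtain ⟨n, hn, hωn⟩ := mem_iUnion₂.1 h
          exact Or.inr (mem_biUnion hn (Or.inl ⟨hωn, fun h' => h2 (mem_biUnion hn h')⟩))
        · exact Or.inl ⟨h1, h⟩
      · obtain ⟨n, hn, hωn⟩ := mem_iUnion₂.1 h1
        exact Or.inr (mem_biUnion hn (Or.inr ⟨hωn, fun h' => h2 (mem_iUnion_of_mem n h')⟩))
    calc P _ ≤ P _ := measure_mono hsub
      _ ≤ P _ + P _ := measure_union_le _ _
      _ ≤ η / 2 + ∑ n ∈ Finset.range N, P (symmDiff (s n) (E' n)) :=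
        add_le_add hN (measure_biUnion_finset_le _ _)
      _ ≤ η / 2 + ∑' n, ε n := by
        gcongr
        exact (Finset.sum_le_sum fun n _ => hsE' n).trans (ENNReal.sum_le_tsum _)
      _ ≤ η / 2 + η / 2 := by gcongr
      _ = η := ENNReal.add_halves η

/-- A countably valued function measurable with respect to the supremum of a directed family of
σ-algebras agrees with large probability with a function measurable with respect to one of them. -/
theorem exists_measurable_ne_le [IsFiniteMeasure P] {ι : Type*} [Nonempty ι]
    {F : ι → MeasurableSpace Ω} (hd : Directed (· ≤ ·) F) (hF : ∀ i, F i ≤ m0) {c : Ω → ℕ}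
    (hc : Measurable[⨆ i, F i] c) {η : ENNReal} (hη : η ≠ 0) :
    ∃ i c', Measurable[F i] c' ∧ P {ω | c ω ≠ c' ω} ≤ η := by
  classical
  have hη2 : η / 2 ≠ 0 := by simpa using hη
  have hcs : ∀ n, MeasurableSet[⨆ i, F i] (c ⁻¹' {n}) := fun n => hc (measurableSet_singleton n)
  obtain ⟨ε, hε, hεsum⟩ := ENNReal.exists_pos_sum_of_countable' hη2 ℕ
  choose i E' hE' hsE' using fun n =>
    exists_measurableSet_symmDiff_le (P := P) hd hF (hcs n) (ε n) (hε n).ne'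
  obtain ⟨N, hN⟩ := exists_measure_iUnion_diff_le (P := P) (s := fun n => c ⁻¹' {n})
    (fun n => iSup_le hF _ (hcs n)) hη2
  obtain ⟨j, hj⟩ := hd.finset_le ((Finset.range N).image i)
  -- Where `c < N` and all `E' n` with `n < N` agree with the fibres of `c`, only the term `n = c ω`
  -- can survive in the sum.
  refine ⟨j, fun ω => ∑ n ∈ Finset.range N, (E' n).indicator (fun _ => n) ω, ?_, ?_⟩
  · refine Finset.measurable_sum _ fun n hn => ?_
    exact Measurable.indicator measurable_const (hj _ (Finset.mem_image_of_mem i hn) _ (hE' n))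
  have hsub : {ω | c ω ≠ ∑ n ∈ Finset.range N, (E' n).indicator (fun _ => n) ω} ⊆
      ((⋃ n, c ⁻¹' {n}) \ ⋃ n ∈ Finset.range N, c ⁻¹' {n}) ∪
        ⋃ n ∈ Finset.range N, symmDiff (c ⁻¹' {n}) (E' n) := by
    intro ω hω
    by_contra hcon
    rw [mem_union, not_or, Set.mem_sdiff, not_and_not_right] at hcon
    have hk : c ω ∈ Finset.range N := by
      obtain ⟨k, hk, hck⟩ := mem_iUnion₂.1 (hcon.1 (mem_iUnion_of_mem (c ω) rfl))
      exact (show c ω = k from hck) ▸ hk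
    have hiff : ∀ n ∈ Finset.range N, (c ω = n ↔ ω ∈ E' n) := fun n hn => by
      by_contra hne
      refine hcon.2 (mem_biUnion hn ?_)
      rw [mem_symmDiff, mem_preimage, mem_singleton_iff]
      tauto
    refine hω ?_
    rw [Finset.sum_eq_single (c ω)]
    · rw [indicator_of_mem ((hiff _ hk).1 rfl)]
    · exact fun n hn hnk => indicator_of_notMem (fun h => hnk ((hiff n hn).2 h).symm) _
    · exact fun h => absurd hk h
  calc P _ ≤ P _ := measure_mono hsub
    _ ≤ P _ + P _ := measure_union_le _ _
    _ ≤ η / 2 + ∑ n ∈ Finset.range N, P (symmDiff (c ⁻¹' {n}) (E' n)) :=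
      add_le_add hN (measure_biUnion_finset_le _ _)
    _ ≤ η / 2 + ∑' n, ε n := by
      gcongr
      exact (Finset.sum_le_sum fun n _ => hsE' n).trans (ENNReal.sum_le_tsum _)
    _ ≤ η / 2 + η / 2 := by gcongr
    _ = η := ENNReal.add_halves η

/-! ### Countable statistics of a σ-algebra -/

theorem comap_pair_left_le (c d : Ω → ℕ) :
    MeasurableSpace.comap c ⊤ ≤ MeasurableSpace.comap (fun ω => Nat.pair (c ω) (d ω)) ⊤ := by
  rintro _ ⟨s, -, rfl⟩
  exact ⟨{n | n.unpair.1 ∈ s}, trivial, by ext; simp⟩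

theorem comap_pair_right_le (c d : Ω → ℕ) :
    MeasurableSpace.comap d ⊤ ≤ MeasurableSpace.comap (fun ω => Nat.pair (c ω) (d ω)) ⊤ := by
  rintro _ ⟨s, -, rfl⟩
  exact ⟨{n | n.unpair.2 ∈ s}, trivial, by ext; simp⟩

/-- Countably valued statistics of `T`. -/
abbrev CountableStat (T : MeasurableSpace Ω) : Type _ := {c : Ω → ℕ // Measurable[T] c}

theorem measurable_natPair {T : MeasurableSpace Ω} {c d : Ω → ℕ} (hc : Measurable[T] c)
    (hd : Measurable[T] d) : Measurable[T] fun ω => Nat.pair (c ω) (d ω) :=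
  (Measurable.of_discrete (f := fun p : ℕ × ℕ => Nat.pair p.1 p.2)).comp (hc.prodMk hd)

theorem directed_sup_comap (A T : MeasurableSpace Ω) :
    Directed (· ≤ ·) fun c : CountableStat T => A ⊔ MeasurableSpace.comap c.1 ⊤ := fun c d =>
  ⟨⟨_, measurable_natPair c.2 d.2⟩, sup_le_sup_left (comap_pair_left_le _ _) _,
    sup_le_sup_left (comap_pair_right_le _ _) _⟩

instance (T : MeasurableSpace Ω) : Nonempty (CountableStat T) := ⟨⟨fun _ => 0, measurable_const⟩⟩

/-- Every event of `T` is a fibre of its own indicator. With directedness this reduces the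
information in `T` to one countable statistic at a time. -/
theorem sup_eq_iSup_comap (A T : MeasurableSpace Ω) :
    A ⊔ T = ⨆ c : CountableStat T, A ⊔ MeasurableSpace.comap c.1 ⊤ := by
  refine le_antisymm (sup_le ?_ ?_) (iSup_le fun c => sup_le_sup_left c.2.comap_le _)
  · exact le_sup_left.trans (le_iSup (fun c : CountableStat T => A ⊔ MeasurableSpace.comap c.1 ⊤)
      (Classical.arbitrary _))
  · intro E hE
    classical
    have hc : Measurable[T] fun ω => if ω ∈ E then 1 else 0 :=
      Measurable.ite hE measurable_const measurable_const
    refine le_iSup (fun c : CountableStat T => A ⊔ MeasurableSpace.comap c.1 ⊤) ⟨_, hc⟩ E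
      ((le_sup_right : _ ≤ A ⊔ _) E ⟨{1}, trivial, ?_⟩)
    ext ω
    by_cases h : ω ∈ E <;> simp [h]

/-- Every countably valued statistic of `T` is a function of another one that agrees, up to an
event of small probability, with a partition into rectangles of `A` and `B`. -/
def RectApprox (P : Measure Ω) (A B T : MeasurableSpace Ω) : Prop :=
  ∀ c : Ω → ℕ, Measurable[T] c → ∀ η : ENNReal, η ≠ 0 → ∃ c' R : Ω → ℕ, Measurable[T] c' ∧
    (∃ h : ℕ → ℕ, ∀ ω, c ω = h (c' ω)) ∧
    (∀ l, ∃ a b, MeasurableSet[A] a ∧ MeasurableSet[B] b ∧ R ⁻¹' {l} = a ∩ b) ∧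
    P {ω | c' ω ≠ R ω} ≤ η

theorem RectApprox.symm {A B T : MeasurableSpace Ω} (h : RectApprox P A B T) :
    RectApprox P B A T := fun c hc η hη => by
  obtain ⟨c', R, h1, h2, h3, h4⟩ := h c hc η hη
  refine ⟨c', R, h1, h2, fun l => ?_, h4⟩
  obtain ⟨a, b, ha, hb, e⟩ := h3 l
  exact ⟨b, a, hb, ha, e.trans (inter_comm _ _)⟩

theorem rectApprox_bot {A B : MeasurableSpace Ω} : RectApprox P A B ⊥ := by
  intro c hc η _
  refine ⟨c, c, hc, ⟨id, fun _ => rfl⟩, fun l => ⟨c ⁻¹' {l}, univ, ?_, MeasurableSet.univ, by simp⟩,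
    by simp⟩
  exact (bot_le : ⊥ ≤ A) _ (hc (measurableSet_singleton l))

/-- A message of the first party keeps a transcript approximable by rectangles. -/
theorem RectApprox.extend_left [IsFiniteMeasure P] {A B T T' : MeasurableSpace Ω} (hA : A ≤ m0)
    (hT : T ≤ m0) (h : RectApprox P A B T) (hTT' : T ≤ T') (hT' : T' ≤ A ⊔ T) :
    RectApprox P A B T' := by
  intro c hc η hη
  have hη2 : η / 2 ≠ 0 := by simpa using hη
  have hcA : Measurable[⨆ c : CountableStat T, A ⊔ MeasurableSpace.comap c.1 ⊤] c := by
    rw [← sup_eq_iSup_comap]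
    exact hc.mono hT' le_rfl
  -- Up to a small event `c` depends only on information in `A` and one countable statistic `c₁` of
  -- the old transcript.
  obtain ⟨⟨c₁, hc₁⟩, d, hd, hcd⟩ := exists_measurable_ne_le (P := P) (directed_sup_comap A T)
    (fun c => sup_le hA (c.2.comap_le.trans hT)) hcA hη2
  obtain ⟨c₂, R, hc₂, ⟨u, hu⟩, hR, hcR⟩ := h c₁ hc₁ (η / 2) hη2
  obtain ⟨g, hg, hdg⟩ := exists_eq_comp_prodMk (m := A) hd
  -- Once the value of `R` is fixed, so is the approximate value `u (R ω)` of `c₁`, and `g` depends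
  -- on `A` alone. Each new fibre is therefore an old rectangle cut by an event of `A`.
  refine ⟨fun ω => Nat.pair (c₂ ω) (c ω), fun ω => Nat.pair (R ω) (g (ω, u (R ω))),
    measurable_natPair (hc₂.mono hTT' le_rfl) hc, ⟨fun n => n.unpair.2, fun ω => by simp⟩,
    fun l => ?_, ?_⟩
  · obtain ⟨a, b, ha, hb, e⟩ := hR l.unpair.1
    have hgm : Measurable[A] fun ω => g (ω, u l.unpair.1) :=
      hg.comp (measurable_id.prodMk measurable_const)
    refine ⟨a ∩ (fun ω => g (ω, u l.unpair.1)) ⁻¹' {l.unpair.2}, b,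
      ha.inter (hgm (measurableSet_singleton _)), hb, ?_⟩
    rw [inter_right_comm, ← e]
    ext ω
    simp only [mem_preimage, mem_singleton_iff, mem_inter_iff]
    constructor
    · rintro rfl
      simp
    · rintro ⟨h1, h2⟩
      rw [h1, h2, Nat.pair_unpair]
  · have hsub : {ω | Nat.pair (c₂ ω) (c ω) ≠ Nat.pair (R ω) (g (ω, u (R ω)))} ⊆
        {ω | c ω ≠ d ω} ∪ {ω | c₂ ω ≠ R ω} := by
      intro ω hω
      by_contra hcon
      simp only [mem_union, mem_ofPred_eq, not_or, not_not] at hcon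
      refine hω ?_
      rw [← hcon.2, ← hu, hcon.1]
      exact congrArg _ (hdg ω)
    calc P _ ≤ P _ := measure_mono hsub
      _ ≤ P _ + P _ := measure_union_le _ _
      _ ≤ η / 2 + η / 2 := add_le_add hcd hcR
      _ = η := ENNReal.add_halves η

theorem RectApprox.extend_right [IsFiniteMeasure P] {A B T T' : MeasurableSpace Ω} (hB : B ≤ m0)
    (hT : T ≤ m0) (h : RectApprox P A B T) (hTT' : T ≤ T') (hT' : T' ≤ B ⊔ T) :
    RectApprox P A B T' :=
  (h.symm.extend_left hB hT hTT' hT').symm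

/-- Up to a small event, a countable statistic of the supremum is a statistic of one `T n`, that is,
of finitely many messages when `T n` is the transcript after `n` steps. -/
theorem RectApprox.iSup [IsFiniteMeasure P] {A B : MeasurableSpace Ω} {T : ℕ → MeasurableSpace Ω}
    (hmono : Monotone T) (hT : ∀ n, T n ≤ m0) (h : ∀ n, RectApprox P A B (T n)) :
    RectApprox P A B (⨆ n, T n) := by
  intro c hc η hη
  have hη2 : η / 2 ≠ 0 := by simpa using hη
  obtain ⟨n, d, hd, hcd⟩ := exists_measurable_ne_le (P := P) hmono.directed_le hT hc hη2
  obtain ⟨d', R, hd', ⟨u, hu⟩, hR, hdR⟩ := h n d hd (η / 2) hη2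
  refine ⟨fun ω => Nat.pair (d' ω) (c ω), fun ω => Nat.pair (R ω) (u (R ω)),
    measurable_natPair (hd'.mono (le_iSup T n) le_rfl) hc, ⟨fun n => n.unpair.2, fun ω => by simp⟩,
    fun l => ?_, ?_⟩
  -- A pair whose second entry is not `u` of the first is never attained; the empty rectangle is its
  -- fibre.
  · by_cases hl : u l.unpair.1 = l.unpair.2
    · obtain ⟨a, b, ha, hb, e⟩ := hR l.unpair.1
      refine ⟨a, b, ha, hb, e ▸ ?_⟩
      ext ω
      simp only [mem_preimage, mem_singleton_iff]
      constructor
      · rintro rfl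
        simp
      · intro h1
        rw [h1, hl, Nat.pair_unpair]
    · refine ⟨∅, ∅, A.measurableSet_empty, B.measurableSet_empty, ?_⟩
      rw [inter_self]
      refine eq_empty_of_forall_notMem fun ω hω => hl ?_
      simp only [mem_preimage, mem_singleton_iff] at hω
      simp [← hω]
  · have hsub : {ω | Nat.pair (d' ω) (c ω) ≠ Nat.pair (R ω) (u (R ω))} ⊆
        {ω | c ω ≠ d ω} ∪ {ω | d' ω ≠ R ω} := by
      intro ω hω
      by_contra hcon
      simp only [mem_union, mem_ofPred_eq, not_or, not_not] at hcon
      refine hω ?_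
      rw [← hcon.2, ← hu, hcon.1]
    calc P _ ≤ P _ := measure_mono hsub
      _ ≤ P _ + P _ := measure_union_le _ _
      _ ≤ η / 2 + η / 2 := add_le_add hcd hdR
      _ = η := ENNReal.add_halves η

end RectApprox

/-! ### Mean square errors of conditional expectations -/

section MeanSquare

variable {Ω : Type*} {m m' m0 : MeasurableSpace Ω} {P : Measure Ω} {G : ℝ → ℝ} {X Y Z : Ω → ℝ}

theorem sq_sub_le_one {x y : ℝ} (hx : x ∈ Icc (0 : ℝ) 1) (hy : y ∈ Icc (0 : ℝ) 1) :
    (x - y) ^ 2 ≤ 1 := by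
  have h1 : -1 ≤ x - y := by linarith [hx.1, hy.2]
  have h2 : x - y ≤ 1 := by linarith [hx.2, hy.1]
  nlinarith

theorem integrable_sq_sub [IsFiniteMeasure P] (hXm : AEStronglyMeasurable X P)
    (hX : ∀ᵐ ω ∂P, X ω ∈ Icc (0 : ℝ) 1) (hYm : AEStronglyMeasurable Y P)
    (hY : ∀ᵐ ω ∂P, Y ω ∈ Icc (0 : ℝ) 1) : Integrable (fun ω => (X ω - Y ω) ^ 2) P := by
  refine Integrable.of_bound ((hXm.sub hYm).pow 2) 1 ?_
  filter_upwards [hX, hY] with ω h1 h2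
  rw [Real.norm_eq_abs, abs_of_nonneg (sq_nonneg _)]
  exact sq_sub_le_one h1 h2

/-- The mean square error of the conditional expectation. -/
noncomputable def condMSE (P : Measure Ω) (Y : Ω → ℝ) (m : MeasurableSpace Ω) : ℝ :=
  ∫ ω, (Y ω - P[Y|m] ω) ^ 2 ∂P

/-- Pythagoras: `Y - E[Y | m]` is orthogonal to every bounded `m`-measurable function. -/
theorem integral_sq_sub_eq [IsFiniteMeasure P] (hm : m ≤ m0) (hXm : StronglyMeasurable[m] X)
    (hX : ∀ᵐ ω ∂P, X ω ∈ Icc (0 : ℝ) 1) (hYm : AEStronglyMeasurable Y P)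
    (hY : ∀ᵐ ω ∂P, Y ω ∈ Icc (0 : ℝ) 1) :
    ∫ ω, (Y ω - X ω) ^ 2 ∂P = condMSE P Y m + ∫ ω, (X ω - P[Y|m] ω) ^ 2 ∂P := by
  have hYi := integrable_of_ae_mem_Icc hYm hY
  have hE := condExp_mem_Icc hm hYm hY
  have hEm := aestronglyMeasurable_condExp (P := P) (Y := Y) hm
  have hXm0 : AEStronglyMeasurable X P := (hXm.mono hm).aestronglyMeasurable
  let s : Ω → ℝ := fun ω => P[Y|m] ω - X ω
  have hs : StronglyMeasurable[m] s := stronglyMeasurable_condExp.sub hXm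
  have hb : ∀ᵐ ω ∂P, ‖s ω‖ ≤ 1 := by
    filter_upwards [hE, hX] with ω h1 h2
    rw [Real.norm_eq_abs, abs_le]
    constructor <;> simp only [s] <;> linarith [h1.1, h1.2, h2.1, h2.2]
  have hs0 : AEStronglyMeasurable s P := (hs.mono hm).aestronglyMeasurable
  have hsY : Integrable (fun ω => s ω * Y ω) P := hYi.bdd_mul hs0 hb
  have hsE : Integrable (fun ω => s ω * P[Y|m] ω) P := integrable_condExp.bdd_mul hs0 hb
  have h1 := integrable_sq_sub hYm hY hEm hE
  have h2 := integrable_sq_sub hXm0 hX hEm hE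
  have e : ∀ ω, (Y ω - X ω) ^ 2 = (Y ω - P[Y|m] ω) ^ 2 + (X ω - P[Y|m] ω) ^ 2 +
      2 * (s ω * Y ω - s ω * P[Y|m] ω) := fun ω => by simp only [s]; ring
  have h3 : Integrable (fun ω => 2 * (s ω * Y ω - s ω * P[Y|m] ω)) P := (hsY.sub hsE).const_mul 2
  have h4 : Integrable (fun ω => (Y ω - P[Y|m] ω) ^ 2 + (X ω - P[Y|m] ω) ^ 2) P := h1.add h2
  simp_rw [e]
  rw [integral_add h4 h3, integral_add h1 h2,
    integral_const_mul, integral_sub hsY hsE, integral_mul_condExp hm hs hYi hb, sub_self,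
    mul_zero, add_zero, condMSE]

theorem condMSE_le_integral_sq_sub [IsFiniteMeasure P] (hm : m ≤ m0) (hXm : StronglyMeasurable[m] X)
    (hX : ∀ᵐ ω ∂P, X ω ∈ Icc (0 : ℝ) 1) (hYm : AEStronglyMeasurable Y P)
    (hY : ∀ᵐ ω ∂P, Y ω ∈ Icc (0 : ℝ) 1) : condMSE P Y m ≤ ∫ ω, (Y ω - X ω) ^ 2 ∂P := by
  rw [integral_sq_sub_eq hm hXm hX hYm hY]
  exact le_add_of_nonneg_right (integral_nonneg fun _ => sq_nonneg _)

theorem condMSE_eq_add [IsFiniteMeasure P] (hmm' : m ≤ m') (hm' : m' ≤ m0)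
    (hYm : AEStronglyMeasurable Y P) (hY : ∀ᵐ ω ∂P, Y ω ∈ Icc (0 : ℝ) 1) :
    condMSE P Y m = condMSE P Y m' + ∫ ω, (P[Y|m] ω - P[Y|m'] ω) ^ 2 ∂P :=
  integral_sq_sub_eq hm' (stronglyMeasurable_condExp.mono hmm')
    (condExp_mem_Icc (hmm'.trans hm') hYm hY) hYm hY

theorem condMSE_anti [IsFiniteMeasure P] (hmm' : m ≤ m') (hm' : m' ≤ m0)
    (hYm : AEStronglyMeasurable Y P) (hY : ∀ᵐ ω ∂P, Y ω ∈ Icc (0 : ℝ) 1) :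
    condMSE P Y m' ≤ condMSE P Y m := by
  rw [condMSE_eq_add hmm' hm' hYm hY]
  exact le_add_of_nonneg_right (integral_nonneg fun _ => sq_nonneg _)

/-- If `f ≤ g` except on an event of probability `η`, where `f ≤ g + 1`, then the integrals differ
by at most `η`. -/
theorem integral_le_add_measureReal [IsFiniteMeasure P] {f g : Ω → ℝ} (hf : Integrable f P)
    (hg : Integrable g P) {S : Set Ω} (hS : NullMeasurableSet S P)
    (h : ∀ᵐ ω ∂P, (ω ∉ S → f ω ≤ g ω) ∧ f ω ≤ g ω + 1) :
    ∫ ω, f ω ∂P ≤ ∫ ω, g ω ∂P + P.real S := by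
  have h1 : Integrable (S.indicator fun _ => (1 : ℝ)) P := (integrable_const 1).indicator₀ hS
  calc ∫ ω, f ω ∂P ≤ ∫ ω, (g ω + S.indicator (fun _ => (1 : ℝ)) ω) ∂P := by
        refine integral_mono_ae hf (hg.add h1) ?_
        filter_upwards [h] with ω hω
        by_cases hS : ω ∈ S
        · simpa [hS] using hω.2
        · simpa [hS] using hω.1 hS
    _ = _ := by
        rw [integral_add hg h1, integral_indicator₀ hS]
        simp

/-- Rounding `E[Y | A ⊔ T]` gives a countably valued estimate, which off a small event needs only
one countable statistic of `T`. The conditional expectation given that statistic and `A` is no worse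
an estimate. -/
theorem exists_condMSE_comap_le [IsProbabilityMeasure P] {A T : MeasurableSpace Ω} (hA : A ≤ m0)
    (hT : T ≤ m0) (hYm : AEStronglyMeasurable[m0] Y P) (hY : ∀ᵐ ω ∂P, Y ω ∈ Icc (0 : ℝ) 1) {ξ : ℝ}
    (hξ : 0 < ξ) :
    ∃ c : Ω → ℕ, Measurable[T] c ∧
      condMSE P Y (A ⊔ MeasurableSpace.comap c ⊤) ≤ condMSE P Y (A ⊔ T) + ξ := by
  have hAT : A ⊔ T ≤ m0 := sup_le hA hT
  set X := P[Y|A ⊔ T] with hXdef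
  have hXs : StronglyMeasurable[A ⊔ T] X := stronglyMeasurable_condExp
  have hX : ∀ᵐ ω ∂P, X ω ∈ Icc (0 : ℝ) 1 := condExp_mem_Icc hAT hYm hY
  -- Rounding to multiples of `1 / N` costs at most `ξ / 2`; the exceptional event takes the other
  -- half.
  obtain ⟨N, hN⟩ := exists_nat_gt (2 / ξ)
  have hN0 : (0 : ℝ) < N := (by positivity : (0 : ℝ) < 2 / ξ).trans hN
  have hk : Measurable[A ⊔ T] fun ω => ⌊X ω * N⌋₊ :=
    Nat.measurable_floor.comp (hXs.measurable.mul_const (N : ℝ))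
  have hη : ENNReal.ofReal (ξ / 2) ≠ 0 := by simpa using hξ
  rw [sup_eq_iSup_comap] at hk
  obtain ⟨⟨c, hc⟩, k, hkm, hk'⟩ := exists_measurable_ne_le (P := P) (directed_sup_comap A T)
    (fun c => sup_le hA (c.2.comap_le.trans hT)) hk hη
  rw [← sup_eq_iSup_comap] at hk
  refine ⟨c, hc, ?_⟩
  have hle : A ⊔ MeasurableSpace.comap c ⊤ ≤ A ⊔ T := sup_le_sup_left hc.comap_le _
  let X' : Ω → ℝ := fun ω => min ((k ω : ℝ) / N) 1
  have hX's : StronglyMeasurable[A ⊔ MeasurableSpace.comap c ⊤] X' :=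
    Measurable.stronglyMeasurable
      ((((measurable_from_top (f := fun n : ℕ => (n : ℝ))).comp hkm).div_const (N : ℝ)).min
        measurable_const)
  have hX' : ∀ᵐ ω ∂P, X' ω ∈ Icc (0 : ℝ) 1 := ae_of_all _ fun ω =>
    ⟨le_min (by positivity) zero_le_one, min_le_right _ _⟩
  refine (condMSE_le_integral_sq_sub (hle.trans hAT) hX's hX' hYm hY).trans ?_
  rw [integral_sq_sub_eq hAT (hX's.mono hle) hX' hYm hY]
  gcongr
  have hSm : MeasurableSet[m0] {ω | ⌊X ω * N⌋₊ ≠ k ω} :=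
    (measurableSet_eq_fun (hk.mono hAT le_rfl) (hkm.mono (hle.trans hAT) le_rfl)).compl
  have h1 := integral_le_add_measureReal (P := P) (g := fun _ => 1 / (N : ℝ))
    (S := {ω | ⌊X ω * N⌋₊ ≠ k ω})
    (integrable_sq_sub ((hX's.mono hle).mono hAT).aestronglyMeasurable hX'
      (hXs.mono hAT).aestronglyMeasurable hX) (integrable_const _) hSm.nullMeasurableSet (by
      filter_upwards [hX] with ω h
      refine ⟨fun hω => ?_, ?_⟩
      · have hω' : ⌊X ω * N⌋₊ = k ω := not_not.1 hω
        have hX0 : 0 ≤ X ω * N := mul_nonneg h.1 hN0.le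
        have l1 := Nat.floor_le hX0
        have l2 := Nat.lt_floor_add_one (X ω * N)
        have l3 : (k ω : ℝ) / N ≤ X ω := by
          rw [div_le_iff₀ hN0, ← hω']
          exact l1
        have l4 : X ω - (k ω : ℝ) / N ≤ 1 / N := by
          rw [sub_le_iff_le_add, ← add_div, le_div_iff₀ hN0, ← hω']
          linarith
        have l5 : X' ω = (k ω : ℝ) / N := min_eq_left (l3.trans h.2)
        have l6 : (0 : ℝ) ≤ k ω / N := by positivity
        rw [l5]
        nlinarith [h.2]
      · have := sq_sub_le_one (x := X' ω)
          ⟨le_min (by positivity) zero_le_one, min_le_right _ _⟩ h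
        have : (0 : ℝ) < 1 / N := by positivity
        linarith)
  have h2 : P.real {ω | ⌊X ω * N⌋₊ ≠ k ω} ≤ ξ / 2 :=
    ENNReal.toReal_le_of_le_ofReal (by positivity) hk'
  have h3 : 1 / (N : ℝ) ≤ ξ / 2 := by
    rw [div_le_iff₀ hN0]
    rw [div_lt_iff₀ hξ] at hN
    linarith
  have h4 : ∫ _, 1 / (N : ℝ) ∂P = 1 / N := by simp
  rw [h4] at h1
  linarith

/-- Conditioning on almost equal statistics gives almost equal conditional expectations. -/
theorem exists_sq_sub_le_of_ne_le [IsFiniteMeasure P] (hm : m ≤ m0) {c d : Ω → ℕ}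
    (hc : Measurable[m0] c) (hd : Measurable[m0] d)
    (hYm : AEStronglyMeasurable Y P) (hY : ∀ᵐ ω ∂P, Y ω ∈ Icc (0 : ℝ) 1) :
    ∃ X : Ω → ℝ, StronglyMeasurable[m ⊔ MeasurableSpace.comap d ⊤] X ∧
      (∀ᵐ ω ∂P, X ω ∈ Icc (0 : ℝ) 1) ∧
      ∫ ω, (Y ω - X ω) ^ 2 ∂P ≤
        condMSE P Y (m ⊔ MeasurableSpace.comap c ⊤) + P.real {ω | c ω ≠ d ω} ∧
      ∫ ω, (P[Y|m ⊔ MeasurableSpace.comap c ⊤] ω - X ω) ^ 2 ∂P ≤ P.real {ω | c ω ≠ d ω} := by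
  have hmc : m ⊔ MeasurableSpace.comap c ⊤ ≤ m0 := sup_le hm hc.comap_le
  have hmd : m ⊔ MeasurableSpace.comap d ⊤ ≤ m0 := sup_le hm hd.comap_le
  set Z := P[Y|m ⊔ MeasurableSpace.comap c ⊤] with hZ
  have hZs : StronglyMeasurable[m ⊔ MeasurableSpace.comap c ⊤] Z := stronglyMeasurable_condExp
  have hZ01 : ∀ᵐ ω ∂P, Z ω ∈ Icc (0 : ℝ) 1 := condExp_mem_Icc hmc hYm hY
  obtain ⟨h, hh, hZh⟩ := exists_eq_comp_prodMk hZs.measurable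
  -- The formula for `Z` with `d` in place of `c`, clipped because its values are uncontrolled where
  -- `c` and `d` differ.
  let X : Ω → ℝ := fun ω => max 0 (min (h (ω, d ω)) 1)
  have hX : StronglyMeasurable[m ⊔ MeasurableSpace.comap d ⊤] X :=
    Measurable.stronglyMeasurable
      (measurable_const.max ((measurable_comp_prodMk hh d).min measurable_const))
  have hX01' : ∀ ω, X ω ∈ Icc (0 : ℝ) 1 := fun ω =>
    ⟨le_max_left _ _, max_le zero_le_one (min_le_right _ _)⟩
  have hX01 : ∀ᵐ ω ∂P, X ω ∈ Icc (0 : ℝ) 1 := ae_of_all _ hX01'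
  have hS : MeasurableSet {ω | c ω ≠ d ω} := (measurableSet_eq_fun hc hd).compl
  have hXZ : ∀ᵐ ω ∂P, ω ∉ {ω | c ω ≠ d ω} → X ω = Z ω := by
    filter_upwards [hZ01] with ω hω hcd
    have hcd' : c ω = d ω := not_not.1 hcd
    simp only [X]
    rw [← hcd', ← hZh, min_eq_left hω.2, max_eq_right hω.1]
  have hXm0 : AEStronglyMeasurable X P := (hX.mono hmd).aestronglyMeasurable
  have hZm0 : AEStronglyMeasurable Z P := (hZs.mono hmc).aestronglyMeasurable
  refine ⟨X, hX, hX01, ?_, ?_⟩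
  · refine integral_le_add_measureReal (integrable_sq_sub hYm hY hXm0 hX01)
      (integrable_sq_sub hYm hY hZm0 hZ01) hS.nullMeasurableSet ?_
    filter_upwards [hXZ, hY] with ω h1 h2
    exact ⟨fun h3 => by rw [h1 h3], by linarith [sq_sub_le_one h2 (hX01' ω), sq_nonneg (Y ω - Z ω)]⟩
  · have := integral_le_add_measureReal (P := P) (integrable_sq_sub hZm0 hZ01 hXm0 hX01)
      (integrable_const (0 : ℝ)) hS.nullMeasurableSet (by
        filter_upwards [hXZ, hZ01] with ω h1 h2
        exact ⟨fun h3 => by simp [h1 h3], by linarith [sq_sub_le_one h2 (hX01' ω)]⟩)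
    simpa using this

theorem integral_sq_sub_triangle [IsFiniteMeasure P] (hXm : AEStronglyMeasurable X P)
    (hX : ∀ᵐ ω ∂P, X ω ∈ Icc (0 : ℝ) 1) (hYm : AEStronglyMeasurable Y P)
    (hY : ∀ᵐ ω ∂P, Y ω ∈ Icc (0 : ℝ) 1) (hZm : AEStronglyMeasurable Z P)
    (hZ : ∀ᵐ ω ∂P, Z ω ∈ Icc (0 : ℝ) 1) :
    ∫ ω, (X ω - Z ω) ^ 2 ∂P ≤ 2 * ∫ ω, (X ω - Y ω) ^ 2 ∂P + 2 * ∫ ω, (Y ω - Z ω) ^ 2 ∂P := by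
  have h1 := integrable_sq_sub hXm hX hYm hY
  have h2 := integrable_sq_sub hYm hY hZm hZ
  rw [← integral_const_mul, ← integral_const_mul, ← integral_add (h1.const_mul 2) (h2.const_mul 2)]
  refine integral_mono (integrable_sq_sub hXm hX hZm hZ) ((h1.const_mul 2).add (h2.const_mul 2))
    fun ω => ?_
  simp only
  nlinarith [sq_nonneg (X ω - Y ω - (Y ω - Z ω))]

/-- Let `p` be the probability of disagreement. Substituting `d` for `c` in the first expectation
gives `X` at squared distance at most `p` from it. The two mean square errors differ by at most `p`,
so by Pythagoras `X` is at squared distance at most `2p` from the second. The triangle inequality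
gives `2p + 4p`. -/
theorem integral_sq_condExp_sub_le [IsFiniteMeasure P] (hm : m ≤ m0) {c d : Ω → ℕ}
    (hc : Measurable[m0] c) (hd : Measurable[m0] d)
    (hYm : AEStronglyMeasurable Y P) (hY : ∀ᵐ ω ∂P, Y ω ∈ Icc (0 : ℝ) 1) :
    ∫ ω, (P[Y|m ⊔ MeasurableSpace.comap c ⊤] ω - P[Y|m ⊔ MeasurableSpace.comap d ⊤] ω) ^ 2 ∂P ≤
      6 * P.real {ω | c ω ≠ d ω} := by
  have hmc : m ⊔ MeasurableSpace.comap c ⊤ ≤ m0 := sup_le hm hc.comap_le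
  have hmd : m ⊔ MeasurableSpace.comap d ⊤ ≤ m0 := sup_le hm hd.comap_le
  obtain ⟨X, hX, hX01, h1, h2⟩ := exists_sq_sub_le_of_ne_le (m := m) hm hc hd hYm hY
  obtain ⟨X', hX', hX01', h1', -⟩ := exists_sq_sub_le_of_ne_le (m := m) hm hd hc hYm hY
  have h3 := condMSE_le_integral_sq_sub hmc hX' hX01' hYm hY
  have e : {ω | d ω ≠ c ω} = {ω | c ω ≠ d ω} := by ext; simp [ne_comm]
  rw [e] at h1'
  rw [integral_sq_sub_eq hmd hX hX01 hYm hY] at h1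
  have h4 := integral_sq_sub_triangle (P := P) (aestronglyMeasurable_condExp hmc)
    (condExp_mem_Icc hmc hYm hY) (hX.mono hmd).aestronglyMeasurable hX01
    (aestronglyMeasurable_condExp hmd) (condExp_mem_Icc hmd hYm hY)
  linarith

/-- Uniform continuity handles close points; for distant ones the quadratic term exceeds the
oscillation of `G`. This turns `L²` estimates into estimates of `E[G(X)]`. -/
theorem exists_modulus_sq (hc : ContinuousOn G (Icc 0 1)) {ξ : ℝ} (hξ : 0 < ξ) :
    ∃ L : ℝ, 0 < L ∧ ∀ x ∈ Icc (0 : ℝ) 1, ∀ y ∈ Icc (0 : ℝ) 1, |G x - G y| ≤ ξ + L * (x - y) ^ 2 := by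
  obtain ⟨M, hM⟩ := isCompact_Icc.exists_bound_of_continuousOn hc
  have hu := isCompact_Icc.uniformContinuousOn_of_continuous hc
  obtain ⟨d, hd, h⟩ := Metric.uniformContinuousOn_iff.1 hu ξ hξ
  have hM0 : 0 ≤ M := (norm_nonneg _).trans (hM 0 (by simp))
  refine ⟨(2 * M + 1) / d ^ 2, by positivity, fun x hx y hy => ?_⟩
  rcases lt_or_ge |x - y| d with hxy | hxy
  · have := h x hx y hy hxy
    rw [Real.dist_eq] at this
    have : 0 ≤ (2 * M + 1) / d ^ 2 * (x - y) ^ 2 := by positivity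
    linarith
  · have h1 : d ^ 2 ≤ (x - y) ^ 2 := by
      rw [← sq_abs (x - y)]
      gcongr
    have h2 : 2 * M + 1 ≤ (2 * M + 1) / d ^ 2 * (x - y) ^ 2 := by
      rw [div_mul_eq_mul_div, le_div_iff₀ (by positivity)]
      gcongr
    have h3 := abs_sub (G x) (G y)
    have h4 := hM x hx
    have h5 := hM y hy
    rw [Real.norm_eq_abs] at h4 h5
    linarith

theorem abs_integral_comp_sub_le [IsProbabilityMeasure P] (hc : ContinuousOn G (Icc 0 1)) {ξ L : ℝ}
    (hL : ∀ x ∈ Icc (0 : ℝ) 1, ∀ y ∈ Icc (0 : ℝ) 1, |G x - G y| ≤ ξ + L * (x - y) ^ 2)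
    (hXm : AEStronglyMeasurable X P)
    (hX : ∀ᵐ ω ∂P, X ω ∈ Icc (0 : ℝ) 1) (hYm : AEStronglyMeasurable Y P)
    (hY : ∀ᵐ ω ∂P, Y ω ∈ Icc (0 : ℝ) 1) :
    |∫ ω, G (X ω) ∂P - ∫ ω, G (Y ω) ∂P| ≤ ξ + L * ∫ ω, (X ω - Y ω) ^ 2 ∂P := by
  have h1 := integrable_comp_of_continuousOn hc hXm hX
  have h2 := integrable_comp_of_continuousOn hc hYm hY
  have h3 := integrable_sq_sub hXm hX hYm hY
  rw [← integral_sub h1 h2]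
  calc |∫ ω, (G (X ω) - G (Y ω)) ∂P| ≤ ∫ ω, |G (X ω) - G (Y ω)| ∂P := abs_integral_le_integral_abs
    _ ≤ ∫ ω, (ξ + L * (X ω - Y ω) ^ 2) ∂P := by
      refine integral_mono_ae (h1.sub h2).abs ((integrable_const ξ).add (h3.const_mul L)) ?_
      filter_upwards [hX, hY] with ω a b using hL _ a _ b
    _ = _ := by
      rw [integral_add (integrable_const ξ) (h3.const_mul L), integral_const_mul]
      simp

end MeanSquare

/-! ### Rectangle substitutes at the end of a protocol -/

section Substitutes

variable {Ω : Type*} {m m' m0 : MeasurableSpace Ω} {P : Measure Ω} {G : ℝ → ℝ} {X Y Z : Ω → ℝ}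

/-- On an event where the statistic `c` is a function of `m`, the σ-algebra generated by `m` and `c`
has the same trace as `m`. -/
theorem exists_inter_eq_of_sup_comap {ι : Type*} [mι : MeasurableSpace ι] {c γ : Ω → ι}
    (hγ : Measurable[m] γ) {F U : Set Ω} (hF : ∀ ω ∈ F, c ω = γ ω)
    (hU : MeasurableSet[m ⊔ mι.comap c] U) : ∃ V, MeasurableSet[m] V ∧ U ∩ F = V ∩ F := by
  rw [sup_comap_eq_comap_prodMk] at hU
  obtain ⟨W, hW, rfl⟩ := hU
  refine ⟨(fun ω => (ω, γ ω)) ⁻¹' W, ?_, ?_⟩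
  · exact (Measurable.prodMk (m := m) measurable_id hγ) hW
  · ext ω
    simp only [mem_inter_iff, mem_preimage]
    exact and_congr_left fun h => by rw [hF ω h]

theorem measurable_of_rectangular_fibres {A B m0 : MeasurableSpace Ω} (hA : A ≤ m0) (hB : B ≤ m0)
    {R : Ω → ℕ} (hR : ∀ l, ∃ a b, MeasurableSet[A] a ∧ MeasurableSet[B] b ∧ R ⁻¹' {l} = a ∩ b) :
    Measurable[m0] R :=
  measurable_to_countable' fun l => by
    obtain ⟨a, b, ha, hb, e⟩ := hR l
    rw [e]
    exact (hA _ ha).inter (hB _ hb)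

/-- The rectangle substitutes inequality for two σ-algebras, in terms of expected values of `G`. -/
def RectSubstitutes (P : Measure Ω) (A B : MeasurableSpace Ω) (Y : Ω → ℝ) (G : ℝ → ℝ) : Prop :=
  ∀ a b, MeasurableSet[A] a → MeasurableSet[B] b → P (a ∩ b) ≠ 0 →
    ∫ ω in a ∩ b, G (P[Y|A ⊔ B] ω) ∂P + P.real (a ∩ b) * G (∫ ω, Y ω ∂(cond P (a ∩ b))) ≤
      ∫ ω in a ∩ b, G ((cond P a)[Y|B] ω) ∂P + ∫ ω in a ∩ b, G ((cond P b)[Y|A] ω) ∂P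

theorem RectSubstitutes.symm {A B : MeasurableSpace Ω} (h : RectSubstitutes P A B Y G) :
    RectSubstitutes P B A Y G := by
  intro b a hb ha hab
  rw [inter_comm b a] at hab ⊢
  rw [sup_comm B A, add_comm (∫ ω in a ∩ b, G ((cond P b)[Y|A] ω) ∂P)]
  exact h a b ha hb hab

/-- On a fibre `a ∩ b`, conditioning on `R` and `B` is conditioning on the event `a` and on `B`, and
likewise for `A`. The rectangle inequalities are then summed over the fibres. -/
theorem RectSubstitutes.of_fibres [IsProbabilityMeasure P] {A B : MeasurableSpace Ω}
    (hs : RectSubstitutes P A B Y G) (hc : ContinuousOn G (Icc 0 1)) (hA : A ≤ m0) (hB : B ≤ m0)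
    (hYm : AEStronglyMeasurable[m0] Y P) (hY : ∀ᵐ ω ∂P, Y ω ∈ Icc (0 : ℝ) 1) {R : Ω → ℕ}
    (hR : ∀ l, ∃ a b, MeasurableSet[A] a ∧ MeasurableSet[B] b ∧ R ⁻¹' {l} = a ∩ b) :
    ∫ ω, G (P[Y|A ⊔ B] ω) ∂P + ∫ ω, G (P[Y|⊥ ⊔ MeasurableSpace.comap R ⊤] ω) ∂P ≤
      ∫ ω, G (P[Y|B ⊔ MeasurableSpace.comap R ⊤] ω) ∂P +
        ∫ ω, G (P[Y|A ⊔ MeasurableSpace.comap R ⊤] ω) ∂P := by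
  have hRm : Measurable[m0] R := measurable_of_rectangular_fibres hA hB hR
  have hYi := integrable_of_ae_mem_Icc hYm hY
  have hle : ∀ m : MeasurableSpace Ω, m ≤ m0 → m ⊔ MeasurableSpace.comap R ⊤ ≤ m0 := fun m hm =>
    sup_le hm hRm.comap_le
  have hi : ∀ m : MeasurableSpace Ω, m ≤ m0 → Integrable[m0] (fun ω => G (P[Y|m] ω)) P :=
    fun m hm => integrable_comp_condExp hc hm hYm hY
  have i1 := hi _ (sup_le hA hB)
  have i2 := hi _ (hle ⊥ bot_le)
  have i3 := hi _ (hle B hB)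
  have i4 := hi _ (hle A hA)
  rw [← integral_add i1 i2, ← integral_add i3 i4]
  refine integral_le_integral_of_fibre hRm (i1.add i2) (i3.add i4) fun l => ?_
  rw [integral_add i1.integrableOn i2.integrableOn, integral_add i3.integrableOn i4.integrableOn]
  obtain ⟨a, b, ha, hb, e⟩ := hR l
  have hRl : ∀ m : MeasurableSpace Ω, MeasurableSet[m ⊔ MeasurableSpace.comap R ⊤] (R ⁻¹' {l}) :=
    fun m => (le_sup_right : _ ≤ m ⊔ _) _ ⟨{l}, trivial, rfl⟩
  have hF0 : MeasurableSet[m0] (a ∩ b) := (hA _ ha).inter (hB _ hb)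
  rcases eq_or_ne (P (R ⁻¹' {l})) 0 with h0 | h0
  · simp [Measure.restrict_eq_zero.2 h0]
  have tr : ∀ m : MeasurableSpace Ω, ∀ U, MeasurableSet[m ⊔ MeasurableSpace.comap R ⊤] U →
      ∃ V, MeasurableSet[m] V ∧ U ∩ R ⁻¹' {l} = V ∩ R ⁻¹' {l} := fun m U hU =>
    exists_inter_eq_of_sup_comap (γ := fun _ => l) measurable_const (fun ω h => h) hU
  have k2 := condExp_ae_eq_condExp_cond (m := ⊥) (A := R ⁻¹' {l}) (B := univ) (P := P) (Y := Y)
    le_sup_left (hle ⊥ bot_le) MeasurableSet.univ (by rw [inter_univ]; exact hRl ⊥)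
    (by rw [inter_univ]; exact tr ⊥) hYi
  have k3 := condExp_ae_eq_condExp_cond (m := B) (A := a) (B := b) (P := P) (Y := Y)
    le_sup_left (hle B hB) hb (by rw [← e]; exact hRl B) (by rw [← e]; exact tr B) hYi
  have k4 := condExp_ae_eq_condExp_cond (m := A) (A := b) (B := a) (P := P) (Y := Y)
    le_sup_left (hle A hA) ha (by rw [inter_comm, ← e]; exact hRl A)
    (by rw [inter_comm, ← e]; exact tr A) hYi
  have := cond_isProbabilityMeasure (μ := P) h0
  rw [condExp_bot, inter_univ, e] at k2
  rw [e] at h0 ⊢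
  have e2 : ∫ ω in a ∩ b, G (P[Y|⊥ ⊔ MeasurableSpace.comap R ⊤] ω) ∂P =
      P.real (a ∩ b) * G (∫ ω, Y ω ∂(cond P (a ∩ b))) := by
    rw [setIntegral_congr_ae hF0 (g := fun _ => G (∫ ω, Y ω ∂(cond P (a ∩ b))))
      (k2.mono fun ω h hω => by rw [h hω])]
    simp
  have e3 : ∫ ω in a ∩ b, G (P[Y|B ⊔ MeasurableSpace.comap R ⊤] ω) ∂P =
      ∫ ω in a ∩ b, G ((cond P a)[Y|B] ω) ∂P :=
    setIntegral_congr_ae hF0 (k3.mono fun ω h hω => by rw [h hω])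
  have e4 : ∫ ω in a ∩ b, G (P[Y|A ⊔ MeasurableSpace.comap R ⊤] ω) ∂P =
      ∫ ω in a ∩ b, G ((cond P b)[Y|A] ω) ∂P :=
    setIntegral_congr_ae hF0 (k4.mono fun ω h hω => by rw [h hω.symm])
  rw [e2, e3, e4]
  exact hs a b ha hb h0

/-- Rectangle substitutes extend from rectangles to every transcript approximable by rectangles. -/
theorem RectSubstitutes.of_rectApprox [IsProbabilityMeasure P] {A B T : MeasurableSpace Ω}
    (hs : RectSubstitutes P A B Y G) (hc : ContinuousOn G (Icc 0 1)) (hA : A ≤ m0) (hB : B ≤ m0)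
    (hT : T ≤ m0) (hYm : AEStronglyMeasurable[m0] Y P) (hY : ∀ᵐ ω ∂P, Y ω ∈ Icc (0 : ℝ) 1)
    (hRA : RectApprox P A B T) :
    ∫ ω, G (P[Y|A ⊔ B] ω) ∂P + ∫ ω, G (P[Y|T] ω) ∂P ≤
      ∫ ω, G (P[Y|B ⊔ T] ω) ∂P + ∫ ω, G (P[Y|A ⊔ T] ω) ∂P := by
  refine le_of_forall_pos_le_add fun ξ hξ => ?_
  -- Each of the three terms that involve `T` moves by at most `2 * (ξ / 12 + ξ / 24) = ξ / 4`: one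
  -- move from `T` to a countable statistic `c`, one from `c` to the rectangles `R`.
  obtain ⟨L, hL0, hL⟩ := exists_modulus_sq hc (ξ := ξ / 12) (by positivity)
  obtain ⟨cA, hcA, heA⟩ := exists_condMSE_comap_le (ξ := ξ / (24 * L)) hA hT hYm hY (by positivity)
  obtain ⟨cB, hcB, heB⟩ := exists_condMSE_comap_le (ξ := ξ / (24 * L)) hB hT hYm hY (by positivity)
  obtain ⟨c₀, hc₀, he₀⟩ := exists_condMSE_comap_le (A := ⊥) (ξ := ξ / (24 * L)) bot_le hT hYm hY
    (by positivity)
  have hη : ENNReal.ofReal (ξ / (144 * L)) ≠ 0 := by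
    rw [ENNReal.ofReal_ne_zero_iff]; positivity
  -- One statistic refines those chosen for all three terms, so that a single rectangular partition
  -- serves them at once.
  obtain ⟨c, R, hcm, ⟨u, hu⟩, hR, hcR⟩ := hRA _
    (measurable_natPair (measurable_natPair hcA hcB) hc₀) _ hη
  have hRm : Measurable[m0] R := measurable_of_rectangular_fibres hA hB hR
  have hcm0 : Measurable[m0] c := hcm.mono hT le_rfl
  have hle : MeasurableSpace.comap (fun ω => Nat.pair (Nat.pair (cA ω) (cB ω)) (c₀ ω)) ⊤ ≤
      MeasurableSpace.comap c ⊤ := by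
    rintro _ ⟨s, -, rfl⟩
    exact ⟨u ⁻¹' s, trivial, by ext ω; simp [← hu]⟩
  have hPR : P.real {ω | c ω ≠ R ω} ≤ ξ / (144 * L) :=
    ENNReal.toReal_le_of_le_ofReal (by positivity) hcR
  have key : ∀ (m : MeasurableSpace Ω) (d : Ω → ℕ), m ≤ m0 →
      MeasurableSpace.comap d ⊤ ≤ MeasurableSpace.comap c ⊤ →
      condMSE P Y (m ⊔ MeasurableSpace.comap d ⊤) ≤ condMSE P Y (m ⊔ T) + ξ / (24 * L) →
      |∫ ω, G (P[Y|m ⊔ MeasurableSpace.comap R ⊤] ω) ∂P - ∫ ω, G (P[Y|m ⊔ T] ω) ∂P| ≤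
        ξ / 4 := by
    intro m d hm hdc hd
    have hmc : m ⊔ MeasurableSpace.comap c ⊤ ≤ m ⊔ T := sup_le_sup_left hcm.comap_le _
    have hmT : m ⊔ T ≤ m0 := sup_le hm hT
    have hmR : m ⊔ MeasurableSpace.comap R ⊤ ≤ m0 := sup_le hm hRm.comap_le
    have h1 := (condMSE_anti (sup_le_sup_left hdc m) (hmc.trans hmT) hYm hY).trans hd
    rw [condMSE_eq_add hmc hmT hYm hY] at h1
    have h2 := integral_sq_condExp_sub_le hm hcm0 hRm hYm hY
    have ae : ∀ m' : MeasurableSpace Ω, AEStronglyMeasurable[m0] (P[Y|m']) P := fun m' => by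
      by_cases h : m' ≤ m0
      · exact aestronglyMeasurable_condExp h
      · rw [condExp_of_not_le h]; exact aestronglyMeasurable_zero
    have h3 := abs_integral_comp_sub_le (P := P) hc hL
      (ae (m ⊔ MeasurableSpace.comap c ⊤)) (condExp_mem_Icc (hmc.trans hmT) hYm hY)
      (ae (m ⊔ T)) (condExp_mem_Icc hmT hYm hY)
    have h4 := abs_integral_comp_sub_le (P := P) hc hL
      (ae (m ⊔ MeasurableSpace.comap c ⊤)) (condExp_mem_Icc (hmc.trans hmT) hYm hY)
      (ae (m ⊔ MeasurableSpace.comap R ⊤)) (condExp_mem_Icc hmR hYm hY)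
    have h5 := mul_le_mul_of_nonneg_left (add_le_add_iff_left (condMSE P Y (m ⊔ T)) |>.1 h1) hL0.le
    have h6 := mul_le_mul_of_nonneg_left (h2.trans (mul_le_mul_of_nonneg_left hPR
      (by norm_num : (0 : ℝ) ≤ 6))) hL0.le
    have h7 : L * (ξ / (24 * L)) = ξ / 24 := by field_simp
    have h8 : L * (6 * (ξ / (144 * L))) = ξ / 24 := by field_simp; norm_num
    rw [h7] at h5
    rw [h8] at h6
    rw [abs_le] at h3 h4 ⊢
    constructor <;> linarith
  have k1 := key A cA hA (((comap_pair_left_le _ _).trans (comap_pair_left_le _ _)).trans hle) heA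
  have k2 := key B cB hB (((comap_pair_right_le _ _).trans (comap_pair_left_le _ _)).trans hle) heB
  have k3 := key ⊥ c₀ bot_le ((comap_pair_right_le _ _).trans hle) he₀
  have k4 := hs.of_fibres hc hA hB hYm hY hR
  rw [bot_sup_eq] at k3
  simp only [bot_sup_eq] at k3 k4
  rw [abs_le] at k1 k2 k3
  linarith

end Substitutes

/-! ### Agreement implies accuracy -/

section Accuracy

variable {Ω : Type*} {A B T m0 : MeasurableSpace Ω} {P : Measure[m0] Ω} {G : ℝ → ℝ} {Y : Ω → ℝ}

theorem integral_rpow_le [IsProbabilityMeasure P] {r : ℝ} (hr0 : 0 < r) (hr1 : r ≤ 1)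
    {f : Ω → ℝ} (hf : Integrable[m0] f P) (hf0 : ∀ ω, 0 ≤ f ω)
    (hfr : Integrable[m0] (fun ω => f ω ^ r) P) : ∫ ω, f ω ^ r ∂P ≤ (∫ ω, f ω ∂P) ^ r :=
  (Real.concaveOn_rpow hr0.le hr1).le_map_integral
    (Real.continuous_rpow_const hr0.le).continuousOn isClosed_Ici (ae_of_all _ hf0) hf hfr

/-- If a statistic `g` agrees with an `m`-measurable `γ` on most of `H`, then learning `g` changes
the expectation given `m` little on the rest of `H`. -/
theorem setIntegral_abs_condExp_sub_le [IsProbabilityMeasure P] {m : MeasurableSpace Ω}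
    (hm : m ≤ m0) (hYm : AEStronglyMeasurable[m0] Y P) (hY : ∀ᵐ ω ∂P, Y ω ∈ Icc (0 : ℝ) 1)
    {g γ : Ω → ℕ} (hg : Measurable[m0] g) (hγ : Measurable[m] γ) {H : Set Ω}
    (hH : MeasurableSet[m] H) :
    ∫ ω in H ∩ {ω | g ω = γ ω}, |P[Y|m ⊔ MeasurableSpace.comap g ⊤] ω - P[Y|m] ω| ∂P ≤
      P.real (H ∩ {ω | g ω ≠ γ ω}) := by
  set m' := m ⊔ MeasurableSpace.comap g ⊤ with hm'def
  have hmm' : m ≤ m' := le_sup_left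
  have hm' : m' ≤ m0 := sup_le hm hg.comap_le
  set F := H ∩ {ω | g ω = γ ω} with hFdef
  set F' := H ∩ {ω | g ω ≠ γ ω} with hF'def
  have hgm' : Measurable[m'] g := (comap_measurable (m := ⊤) g).mono le_sup_right le_rfl
  have hF : MeasurableSet[m'] F :=
    (hmm' _ hH).inter (measurableSet_eq_fun hgm' (hγ.mono hmm' le_rfl))
  have hF0 := hm' _ hF
  have hF'0 : MeasurableSet[m0] F' :=
    hm' _ ((hmm' _ hH).inter (measurableSet_eq_fun hgm' (hγ.mono hmm' le_rfl)).compl)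
  have hYi := integrable_of_ae_mem_Icc hYm hY
  -- On `F` the statistic equals `γ`, so there the expectation given `m'` coincides with an
  -- `m`-measurable `z`.
  have hz := condExp_ae_eq_condExp_cond (A := F) (B := univ) (P := P) hmm' hm' MeasurableSet.univ
    (by rwa [inter_univ]) (by
      rw [inter_univ]
      exact fun U hU => exists_inter_eq_of_sup_comap hγ (fun ω hω => hω.2) hU) hYi
  rw [inter_univ] at hz
  set z := (cond P F)[Y|m]
  have hzm : StronglyMeasurable[m] z := stronglyMeasurable_condExp
  set b := P[Y|m] with hb
  have hbm : StronglyMeasurable[m] b := stronglyMeasurable_condExp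
  have hb01 : ∀ᵐ ω ∂P, b ω ∈ Icc (0 : ℝ) 1 := condExp_mem_Icc hm hYm hY
  set Z := P[Y|m'] with hZ
  -- On `F` this is the sign of `Z - b`, yet it is `m`-measurable on all of `H`. Thus the integral
  -- of `s * (Y - b)` over `H` vanishes, and the part over `F`, which is the left side, is balanced
  -- by the part over `F'`.
  let s : Ω → ℝ := fun ω => if b ω ≤ z ω then 1 else -1
  have hs : StronglyMeasurable[m] s :=
    StronglyMeasurable.ite (measurableSet_le hbm.measurable hzm.measurable)
      stronglyMeasurable_const stronglyMeasurable_const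
  have hs1 : ∀ ω, |s ω| = 1 := fun ω => by simp only [s]; split_ifs <;> simp
  have hs1' : ∀ᵐ ω ∂P, ‖s ω‖ ≤ 1 := ae_of_all _ fun ω => (hs1 ω).le
  have hsF : StronglyMeasurable[m'] (F.indicator s) := (hs.mono hmm').indicator hF
  have hind : ∀ S : Set Ω, ∀ᵐ ω ∂P, ‖S.indicator s ω‖ ≤ 1 := fun S => ae_of_all _ fun ω =>
    (norm_indicator_le_norm_self s ω).trans (hs1 ω).le
  have hsi : ∀ S : Set Ω, MeasurableSet[m0] S → ∀ f : Ω → ℝ, Integrable[m0] f P →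
      Integrable[m0] (fun ω => S.indicator s ω * f ω) P := fun S hS f hf =>
    hf.bdd_mul (((hs.mono hm).indicator hS).aestronglyMeasurable) (hind S)
  have hbi : Integrable[m0] b P := integrable_condExp
  have hZi : Integrable[m0] Z P := integrable_condExp
  have e1 : ∫ ω in F, |Z ω - b ω| ∂P = ∫ ω, (F.indicator s ω * Z ω - F.indicator s ω * b ω) ∂P := by
    rw [← integral_indicator hF0]
    refine integral_congr_ae ?_
    filter_upwards [hz] with ω h
    by_cases hω : ω ∈ F
    · simp only [indicator_of_mem hω, s]
      rw [h hω]
      split_ifs with h'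
      · rw [abs_of_nonneg (sub_nonneg.2 h')]; ring
      · rw [abs_of_neg (sub_neg.2 (not_le.1 h'))]; ring
    · simp [indicator_of_notMem hω]
  have e2 : ∫ ω, F.indicator s ω * Z ω ∂P = ∫ ω, F.indicator s ω * Y ω ∂P :=
    integral_mul_condExp hm' hsF hYi (hind F)
  have e3 : ∫ ω, H.indicator s ω * b ω ∂P = ∫ ω, H.indicator s ω * Y ω ∂P :=
    integral_mul_condExp hm (hs.indicator hH) hYi (hind H)
  have hdec : ∀ ω, H.indicator s ω = F.indicator s ω + F'.indicator s ω := fun ω => by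
    by_cases h1 : ω ∈ H <;> by_cases h2 : g ω = γ ω <;> simp [F, F', indicator, h1, h2]
  have e4 : ∀ f : Ω → ℝ, Integrable[m0] f P → ∫ ω, H.indicator s ω * f ω ∂P =
      ∫ ω, F.indicator s ω * f ω ∂P + ∫ ω, F'.indicator s ω * f ω ∂P := fun f hf => by
    rw [← integral_add (hsi F hF0 f hf) (hsi F' hF'0 f hf)]
    simp_rw [hdec, add_mul]
  rw [e4 b hbi, e4 Y hYi] at e3
  rw [e1, integral_sub (hsi F hF0 Z hZi) (hsi F hF0 b hbi), e2]
  have e5 : ∫ ω, F'.indicator s ω * b ω ∂P - ∫ ω, F'.indicator s ω * Y ω ∂P ≤ P.real F' := by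
    rw [← integral_sub (hsi F' hF'0 b hbi) (hsi F' hF'0 Y hYi)]
    calc _ ≤ ∫ ω, F'.indicator (fun _ => (1 : ℝ)) ω ∂P := by
          refine integral_mono_ae ((hsi F' hF'0 b hbi).sub (hsi F' hF'0 Y hYi))
            ((integrable_const 1).indicator hF'0) ?_
          filter_upwards [hY, hb01] with ω h1 h2
          by_cases hω : ω ∈ F'
          · simp only [indicator_of_mem hω]
            have := hs1 ω
            rw [← mul_sub]
            refine (le_abs_self _).trans ?_
            rw [abs_mul, this, one_mul, abs_le]
            constructor <;> linarith [h1.1, h1.2, h2.1, h2.2]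
          · simp [indicator_of_notMem hω]
      _ = _ := by rw [integral_indicator hF'0]; simp
  linarith

theorem integrable_comp_condExp_sub [IsFiniteMeasure P] (hc : ContinuousOn G (Icc 0 1))
    {m n : MeasurableSpace Ω} (hm : m ≤ m0) (hn : n ≤ m0)
    (hYm : AEStronglyMeasurable[m0] Y P) (hY : ∀ᵐ ω ∂P, Y ω ∈ Icc (0 : ℝ) 1) :
    Integrable[m0] (fun ω => G (P[Y|n] ω) - G (P[Y|m] ω)) P :=
  (integrable_comp_condExp hc hn hYm hY).sub (integrable_comp_condExp hc hm hYm hY)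

/-- The loss of Bob on an event `H` on which he can almost tell the statistic `g`. -/
theorem setIntegral_loss_le [IsProbabilityMeasure P] (hG : ConvexOn ℝ (Icc 0 1) G)
    (hc : ContinuousOn G (Icc 0 1)) {r K M : ℝ} (hr0 : 0 < r) (hr1 : r ≤ 1) (hK0 : 0 ≤ K)
    (hK : ∀ x ∈ Icc (0 : ℝ) 1, ∀ y ∈ Icc (0 : ℝ) 1, |G x - G y| ≤ K * |x - y| ^ r)
    (hM : ∀ x ∈ Icc (0 : ℝ) 1, |G x| ≤ M)
    {m n : MeasurableSpace Ω} (hn : n ≤ m0)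
    (hYm : AEStronglyMeasurable[m0] Y P) (hY : ∀ᵐ ω ∂P, Y ω ∈ Icc (0 : ℝ) 1)
    {g γ : Ω → ℕ} (hgn : m ⊔ MeasurableSpace.comap g ⊤ ≤ n) (hγ : Measurable[m] γ)
    {H : Set Ω} (hH : MeasurableSet[m] H) {Λ : ℝ}
    (hΛ : ∫ ω, G (P[Y|n] ω) ∂P - ∫ ω, G (P[Y|m ⊔ MeasurableSpace.comap g ⊤] ω) ∂P ≤ Λ) :
    ∫ ω in H, (G (P[Y|n] ω) - G (P[Y|m] ω)) ∂P ≤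
      Λ + K * P.real (H ∩ {ω | g ω ≠ γ ω}) ^ r + 2 * M * P.real (H ∩ {ω | g ω ≠ γ ω}) := by
  set m' := m ⊔ MeasurableSpace.comap g ⊤ with hm'def
  have hmm' : m ≤ m' := le_sup_left
  have hm' : m' ≤ m0 := hgn.trans hn
  have hm : m ≤ m0 := hmm'.trans hm'
  set F := H ∩ {ω | g ω = γ ω} with hFdef
  set F' := H ∩ {ω | g ω ≠ γ ω} with hF'def
  have hgm' : Measurable[m'] g := (comap_measurable (m := ⊤) g).mono le_sup_right le_rfl
  have hF : MeasurableSet[m'] F :=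
    (hmm' _ hH).inter (measurableSet_eq_fun hgm' (hγ.mono hmm' le_rfl))
  have hF0 := hm' _ hF
  have hF'0 : MeasurableSet[m0] F' :=
    hm' _ ((hmm' _ hH).inter (measurableSet_eq_fun hgm' (hγ.mono hmm' le_rfl)).compl)
  have hYi := integrable_of_ae_mem_Icc hYm hY
  have in_ := integrable_comp_condExp hc hn hYm hY
  have im := integrable_comp_condExp hc hm hYm hY
  have im' := integrable_comp_condExp hc hm' hYm hY
  have hn01 := condExp_mem_Icc hn hYm hY
  have hm01 := condExp_mem_Icc hm hYm hY
  have hm'01 := condExp_mem_Icc hm' hYm hY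
  have hHF : H = F ∪ F' := by
    ext ω; by_cases h : g ω = γ ω <;> simp [F, F', h]
  have hdisj : Disjoint F F' := Set.disjoint_left.2 fun ω h1 h2 => h2.2 h1.2
  have i1 := integrable_comp_condExp_sub (P := P) hc hm hn hYm hY
  have s0 : ∫ ω in H, (G (P[Y|n] ω) - G (P[Y|m] ω)) ∂P =
      ∫ ω in F, (G (P[Y|n] ω) - G (P[Y|m] ω)) ∂P + ∫ ω in F', (G (P[Y|n] ω) - G (P[Y|m] ω)) ∂P := by
    rw [hHF]
    exact setIntegral_union hdisj hF'0 i1.integrableOn i1.integrableOn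
  have s1 : ∫ ω in F', (G (P[Y|n] ω) - G (P[Y|m] ω)) ∂P ≤ 2 * M * P.real F' := by
    calc _ ≤ ∫ _ in F', 2 * M ∂P := by
          refine integral_mono_ae i1.integrableOn (integrable_const _) (ae_restrict_of_ae ?_)
          filter_upwards [hn01, hm01] with ω h1 h2
          linarith [(abs_le.1 (hM _ h1)).2, (abs_le.1 (hM _ h2)).1]
      _ = _ := by simp [mul_comm]
  -- By Jensen the loss from `n` to `m'` is nonnegative on the complement of `F`, so the total loss
  -- bounds that on `F`.
  have s2 : ∫ ω in F, (G (P[Y|n] ω) - G (P[Y|m'] ω)) ∂P ≤ Λ := by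
    have j := setIntegral_comp_condExp_le hG hc hm' (aestronglyMeasurable_condExp (Y := Y) hn)
      hn01 hF.compl
    have tw := condExp_condExp_of_le (f := Y) (μ := P) hgn hn
    rw [setIntegral_congr_ae (g := fun ω => G (P[Y|m'] ω)) hF0.compl
      (tw.mono fun ω h _ => by rw [h])] at j
    rw [integral_sub in_.integrableOn im'.integrableOn]
    have d1 := integral_add_compl hF0 in_
    have d2 := integral_add_compl hF0 im'
    linarith
  -- Hölder continuity of `G`, then Jensen for the concave power `r`, reduce this to the `L¹`
  -- estimate.
  have s3 : ∫ ω in F, (G (P[Y|m'] ω) - G (P[Y|m] ω)) ∂P ≤ K * P.real F' ^ r := by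
    let f : Ω → ℝ := F.indicator fun ω => |P[Y|m'] ω - P[Y|m] ω|
    have hf0 : ∀ ω, 0 ≤ f ω := fun ω => indicator_nonneg (fun _ _ => abs_nonneg _) ω
    have hfi : Integrable[m0] f P :=
      (integrable_condExp.sub integrable_condExp).abs.indicator hF0
    have hfr : Integrable[m0] (fun ω => f ω ^ r) P := by
      refine Integrable.of_bound
        ((Real.continuous_rpow_const hr0.le).comp_aestronglyMeasurable hfi.1) 1 ?_
      filter_upwards [hm01, hm'01] with ω h1 h2
      rw [Real.norm_eq_abs, abs_of_nonneg (Real.rpow_nonneg (hf0 ω) r)]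
      refine Real.rpow_le_one (hf0 ω) ?_ hr0.le
      refine (indicator_le_self' (fun _ _ => abs_nonneg _) ω).trans ?_
      rw [abs_le]
      constructor <;> linarith [h1.1, h1.2, h2.1, h2.2]
    have hf1 : ∫ ω, f ω ∂P ≤ P.real F' := by
      rw [integral_indicator hF0]
      exact setIntegral_abs_condExp_sub_le hm hYm hY (hgm'.mono hm' le_rfl) hγ hH
    calc ∫ ω in F, (G (P[Y|m'] ω) - G (P[Y|m] ω)) ∂P
        ≤ ∫ ω in F, K * f ω ^ r ∂P := by
          refine setIntegral_mono_on_ae (im'.sub im).integrableOn (hfr.const_mul K).integrableOn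
            hF0 ?_
          filter_upwards [hm01, hm'01] with ω h1 h2 hω
          simp only [f, indicator_of_mem hω]
          exact (le_abs_self _).trans (hK _ h2 _ h1)
      _ ≤ ∫ ω, K * f ω ^ r ∂P := setIntegral_le_integral (hfr.const_mul K)
          (ae_of_all _ fun ω => mul_nonneg hK0 (Real.rpow_nonneg (hf0 ω) r))
      _ = K * ∫ ω, f ω ^ r ∂P := integral_const_mul _ _
      _ ≤ K * P.real F' ^ r := by
          gcongr
          exact (integral_rpow_le hr0 hr1 hfi hf0 hfr).trans
            (Real.rpow_le_rpow (integral_nonneg hf0) hf1 hr0.le)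
  have s4 : ∫ ω in F, (G (P[Y|n] ω) - G (P[Y|m] ω)) ∂P =
      ∫ ω in F, (G (P[Y|n] ω) - G (P[Y|m'] ω)) ∂P +
        ∫ ω in F, (G (P[Y|m'] ω) - G (P[Y|m] ω)) ∂P := by
    rw [← integral_add (integrable_comp_condExp_sub hc hm' hn hYm hY).integrableOn
      (integrable_comp_condExp_sub hc hm hm' hYm hY).integrableOn]
    simp
  linarith

/-- Rounding a conditional expectation to blocks over which `G` is nearly affine loses little. -/
theorem integral_comp_sub_le_of_blocks [IsProbabilityMeasure P] (hG : ConvexOn ℝ (Icc 0 1) G)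
    (hc : ContinuousOn G (Icc 0 1)) {m n : MeasurableSpace Ω} (hmn : m ≤ n) (hn : n ≤ m0)
    (hYm : AEStronglyMeasurable[m0] Y P) (hY : ∀ᵐ ω ∂P, Y ω ∈ Icc (0 : ℝ) 1)
    {g : Ω → ℕ} (hg : Measurable[m] g) {lo hi : ℕ → ℝ} {D : ℝ}
    (hlo : ∀ l, lo l ∈ Icc (0 : ℝ) 1) (hhi : ∀ l, hi l ∈ Icc (0 : ℝ) 1)
    (hD : ∀ l, jensenBregman G (lo l) (hi l) ≤ D)
    (hblock : ∀ᵐ ω ∂P, P[Y|n] ω ∈ Icc (lo (g ω)) (hi (g ω))) :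
    ∫ ω, G (P[Y|n] ω) ∂P ≤ ∫ ω, G (P[Y|m] ω) ∂P + 2 * D := by
  have hm := hmn.trans hn
  have hg0 : Measurable[m0] g := hg.mono hm le_rfl
  have hYi := integrable_of_ae_mem_Icc hYm hY
  have i1 := integrable_comp_condExp hc hn hYm hY
  have i2 := integrable_comp_condExp hc hm hYm hY
  have hconst : ∀ f : ℕ → ℝ, (∀ l, f l ∈ Icc (0 : ℝ) 1) →
      StronglyMeasurable[m] (fun ω => f (g ω)) ∧ Integrable[m0] (fun ω => f (g ω)) P := by
    intro f hf
    have h1 : StronglyMeasurable[m] (fun ω => f (g ω)) :=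
      ((measurable_from_top (f := f)).comp hg).stronglyMeasurable
    exact ⟨h1, integrable_of_ae_mem_Icc (h1.mono hm).aestronglyMeasurable
      (ae_of_all _ fun ω => hf _)⟩
  obtain ⟨hlos, hloi⟩ := hconst lo hlo
  obtain ⟨hhis, hhii⟩ := hconst hi hhi
  have tw := condExp_condExp_of_le (f := Y) (μ := P) hmn hn
  -- The block is known given `m`, so averaging over `m` does not leave it.
  have hblock' : ∀ᵐ ω ∂P, P[Y|m] ω ∈ Icc (lo (g ω)) (hi (g ω)) := by
    have h1 := condExp_mono (m := m) hloi integrable_condExp (hblock.mono fun ω h => h.1)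
    have h2 := condExp_mono (m := m) integrable_condExp hhii (hblock.mono fun ω h => h.2)
    rw [condExp_of_stronglyMeasurable hm hlos hloi] at h1
    rw [condExp_of_stronglyMeasurable hm hhis hhii] at h2
    filter_upwards [h1, h2, tw] with ω a b e
    rw [e] at a b
    exact ⟨a, b⟩
  have hfib := integral_le_integral_of_fibre (P := P) hg0 i1 (i2.add (integrable_const (2 * D)))
    fun l => ?_
  · rw [integral_add' i2 (integrable_const _)] at hfib
    simpa using hfib
  obtain ⟨α, β, hαβ⟩ := exists_chord hG (hlo l) (hhi l)
  have hFm : MeasurableSet[m] (g ⁻¹' {l}) := hg (measurableSet_singleton l)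
  have hF0 := hm _ hFm
  have l1 : ∀ k : MeasurableSpace Ω, Integrable[m0] (fun ω => α + β * P[Y|k] ω) P := fun k =>
    (integrable_const α).add (integrable_condExp.const_mul β)
  have c1 : ∫ ω in g ⁻¹' {l}, G (P[Y|n] ω) ∂P ≤ ∫ ω in g ⁻¹' {l}, (α + β * P[Y|n] ω) ∂P := by
    refine setIntegral_mono_on_ae i1.integrableOn (l1 n).integrableOn hF0 ?_
    filter_upwards [hblock] with ω h hω
    have : g ω = l := hω
    rw [this] at h
    exact (hαβ _ h).1
  -- The chord is affine and the block is an event of `m`, so both conditional expectations give the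
  -- same integral.
  have c2 : ∫ ω in g ⁻¹' {l}, (α + β * P[Y|n] ω) ∂P = ∫ ω in g ⁻¹' {l}, (α + β * P[Y|m] ω) ∂P := by
    rw [integral_add (integrable_const α) (integrable_condExp.const_mul β).integrableOn,
      integral_add (integrable_const α) (integrable_condExp.const_mul β).integrableOn,
      integral_const_mul, integral_const_mul, setIntegral_condExp hn hYi (hmn _ hFm),
      setIntegral_condExp hm hYi hFm]
  have c3 : ∫ ω in g ⁻¹' {l}, (α + β * P[Y|m] ω) ∂P ≤
      ∫ ω in g ⁻¹' {l}, (G (P[Y|m] ω) + 2 * D) ∂P := by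
    refine setIntegral_mono_on_ae (l1 m).integrableOn
      (i2.add (integrable_const (2 * D))).integrableOn hF0 ?_
    filter_upwards [hblock'] with ω h hω
    have : g ω = l := hω
    rw [this] at h
    linarith [(hαβ _ h).2, hD l]
  exact c1.trans (c2.le.trans c3)

/-- Agreement implies accuracy for the second party, with the scale `δ` of the buckets free. -/
theorem integral_loss_le_of_scale [IsProbabilityMeasure P] (hG : ConvexOn ℝ (Icc 0 1) G)
    {r K M c : ℝ} (hr0 : 0 < r) (hr1 : r ≤ 1) (hK0 : 0 ≤ K)
    (hK : ∀ x ∈ Icc (0 : ℝ) 1, ∀ y ∈ Icc (0 : ℝ) 1, |G x - G y| ≤ K * |x - y| ^ r)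
    (hM : ∀ x ∈ Icc (0 : ℝ) 1, |G x| ≤ M) (hcpos : 0 < c) (htri : ApproxTriangle G c)
    (hA : A ≤ m0) (hB : B ≤ m0) (hT : T ≤ A ⊔ B)
    (hYm : AEStronglyMeasurable[m0] Y P) (hY : ∀ᵐ ω ∂P, Y ω ∈ Icc (0 : ℝ) 1)
    (hs : RectSubstitutes P A B Y G) (hRA : RectApprox P A B T) {ε δ : ℝ} (hδ : 0 < δ)
    (hagree : ∫ ω, jensenBregman G (P[Y|A ⊔ T] ω) (P[Y|B ⊔ T] ω) ∂P ≤ ε) :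
    ∫ ω, G (P[Y|A ⊔ B] ω) ∂P - ∫ ω, G (P[Y|B ⊔ T] ω) ∂P ≤
      6 * ((δ + 2 * δ / c) / c) + (3 * K + 6 * M) * (ε / δ) ^ r := by
  have hc := ConvexOn.continuousOn_of_rpow hr0 hK
  have hM0 : 0 ≤ M := (abs_nonneg _).trans (hM 0 (by simp))
  obtain ⟨κ, x, hκ, hx01, hκx, hxmono, hfar, hnear⟩ := exists_buckets hG hc hcpos htri hδ
  set D := (δ + 2 * δ / c) / c with hDdef
  have hAB : A ⊔ B ≤ m0 := sup_le hA hB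
  have hT0 : T ≤ m0 := hT.trans hAB
  have hAT : A ⊔ T ≤ m0 := sup_le hA hT0
  have hBT : B ⊔ T ≤ m0 := sup_le hB hT0
  have ha01 := condExp_mem_Icc hAT hYm hY
  have hb01 := condExp_mem_Icc hBT hYm hY
  have hκa : Measurable[A ⊔ T] fun ω => κ (P[Y|A ⊔ T] ω) :=
    hκ.comp stronglyMeasurable_condExp.measurable
  have hκb : Measurable[B ⊔ T] fun ω => κ (P[Y|B ⊔ T] ω) :=
    hκ.comp stronglyMeasurable_condExp.measurable
  have hJm : AEStronglyMeasurable[m0]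
      (fun ω => (P[Y|A ⊔ T] ω + P[Y|B ⊔ T] ω) / 2) P :=
    (((stronglyMeasurable_condExp.mono hAT).measurable.add
      (stronglyMeasurable_condExp.mono hBT).measurable).div_const 2).aestronglyMeasurable
  have hJ01 : ∀ᵐ ω ∂P, (P[Y|A ⊔ T] ω + P[Y|B ⊔ T] ω) / 2 ∈ Icc (0 : ℝ) 1 := by
    filter_upwards [ha01, hb01] with ω h1 h2 using midpoint_mem_Icc h1 h2
  have hJi : Integrable[m0]
      (fun ω => jensenBregman G (P[Y|A ⊔ T] ω) (P[Y|B ⊔ T] ω)) P :=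
    (((integrable_comp_condExp hc hAT hYm hY).add
      (integrable_comp_condExp hc hBT hYm hY)).div_const 2).sub
      (integrable_comp_of_continuousOn hc hJm hJ01)
  set S : Set Ω := {ω | δ ≤ jensenBregman G (P[Y|A ⊔ T] ω) (P[Y|B ⊔ T] ω)} with hSdef
  have hpε : P.real S ≤ ε / δ := by
    have h := mul_meas_ge_le_integral_of_nonneg (by
      filter_upwards [ha01, hb01] with ω h1 h2 using jensenBregman_nonneg hG h1 h2) hJi δ
    rw [le_div_iff₀ hδ, mul_comm]
    exact h.trans hagree
  have hp1 : P.real S ≤ 1 := measureReal_le_one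
  have hεr : P.real S ^ r ≤ (ε / δ) ^ r := Real.rpow_le_rpow measureReal_nonneg hpε hr0.le
  -- As `p ≤ 1` and `r ≤ 1`, the term linear in `p` is absorbed into `p ^ r`.
  have hpr : P.real S ≤ P.real S ^ r := by
    simpa using Real.rpow_le_rpow_of_exponent_ge' measureReal_nonneg hp1 hr0.le hr1
  have hj : ∀ j < 3, ∫ ω in {ω | (κ (P[Y|B ⊔ T] ω) + j) % 3 = 1},
      (G (P[Y|A ⊔ B] ω) - G (P[Y|B ⊔ T] ω)) ∂P ≤ 2 * D + (K + 2 * M) * (ε / δ) ^ r := by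
    intro j hj
    -- Blocks of three buckets, shifted by `j`: `g` is Alice's block, `γ` is Bob's guess of it, and
    -- on `H` his expectation is in the middle bucket.
    let g : Ω → ℕ := fun ω => (κ (P[Y|A ⊔ T] ω) + j) / 3
    let γ : Ω → ℕ := fun ω => (κ (P[Y|B ⊔ T] ω) + j) / 3
    set H : Set Ω := {ω | (κ (P[Y|B ⊔ T] ω) + j) % 3 = 1} with hHdef
    have hg : Measurable[A ⊔ T] g := (measurable_from_top (f := fun k : ℕ => (k + j) / 3)).comp hκa
    have hγ : Measurable[B ⊔ T] γ := (measurable_from_top (f := fun k : ℕ => (k + j) / 3)).comp hκb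
    have hH : MeasurableSet[B ⊔ T] H := hκb (t := {k : ℕ | (k + j) % 3 = 1}) trivial
    have hTj : T ⊔ MeasurableSpace.comap g ⊤ ≤ A ⊔ T := sup_le le_sup_right hg.comap_le
    have hTj0 := hTj.trans hAT
    -- The block number is a further message from Alice, so the extended transcript is still
    -- approximable by rectangles; by `eA` it leaves her own information unchanged.
    have hRAj := hRA.extend_left hA hT0 le_sup_left hTj
    have hsub := hs.of_rectApprox hc hA hB hTj0 hYm hY hRAj
    have eA : A ⊔ (T ⊔ MeasurableSpace.comap g ⊤) = A ⊔ T :=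
      le_antisymm (sup_le le_sup_left hTj) (sup_le_sup_left le_sup_left A)
    rw [eA, ← sup_assoc] at hsub
    have hblock := integral_comp_sub_le_of_blocks (P := P) (g := g) (D := D)
      -- Truncated subtraction only matters for `l = 0`: that block then runs from `x 0` to `x 3`,
      -- still three buckets.
      (lo := fun l => x (3 * l - j)) (hi := fun l => x (3 * l - j + 3)) hG hc hTj hAT hYm hY
      ((comap_measurable (m := ⊤) g).mono le_sup_right le_rfl)
      (fun l => hx01 _) (fun l => hx01 _) (fun l => hnear _) (by
        filter_upwards [ha01] with ω h
        have h1 := hκx _ h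
        refine ⟨(hxmono ?_).trans h1.1, h1.2.trans (hxmono ?_)⟩ <;> simp only [g] <;> omega)
    have hΛ : ∫ ω, G (P[Y|A ⊔ B] ω) ∂P -
        ∫ ω, G (P[Y|(B ⊔ T) ⊔ MeasurableSpace.comap g ⊤] ω) ∂P ≤ 2 * D := by linarith
    have hle : (B ⊔ T) ⊔ MeasurableSpace.comap g ⊤ ≤ A ⊔ B :=
      sup_le (sup_le le_sup_right hT) (hg.comap_le.trans (sup_le le_sup_left hT))
    refine (setIntegral_loss_le (P := P) hG hc hr0 hr1 hK0 hK hM hAB hYm hY hle hγ hH hΛ).trans ?_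
    -- A bucket in a different block is at least two away from the middle bucket, whence divergence
    -- at least `δ`.
    have hp : P.real (H ∩ {ω | g ω ≠ γ ω}) ≤ P.real S := by
      refine ENNReal.toReal_mono (measure_ne_top P _) (measure_mono_ae ?_)
      filter_upwards [ha01, hb01] with ω h1 h2 hω
      have hω1 : (κ (P[Y|B ⊔ T] ω) + j) % 3 = 1 := hω.1
      have hω2 : (κ (P[Y|A ⊔ T] ω) + j) / 3 ≠ (κ (P[Y|B ⊔ T] ω) + j) / 3 := hω.2
      have : κ (P[Y|A ⊔ T] ω) + 2 ≤ κ (P[Y|B ⊔ T] ω) ∨ κ (P[Y|B ⊔ T] ω) + 2 ≤ κ (P[Y|A ⊔ T] ω) := by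
        omega
      rcases this with h | h
      · exact hfar _ h1 _ h2 h
      · have := hfar _ h2 _ h1 h
        rw [jensenBregman_comm] at this
        exact this
    have hq := hp.trans (hpr.trans hεr)
    have hq' := (Real.rpow_le_rpow measureReal_nonneg hp hr0.le).trans hεr
    nlinarith [mul_le_mul_of_nonneg_left hq hM0, mul_le_mul_of_nonneg_left hq' hK0]
  have in_ := integrable_comp_condExp hc hAB hYm hY
  have im := integrable_comp_condExp hc hBT hYm hY
  have hi := integrable_comp_condExp_sub (P := P) hc hBT hAB hYm hY
  have hm3 : ∀ j, MeasurableSet[m0] {ω | (κ (P[Y|B ⊔ T] ω) + j) % 3 = 1} := fun j =>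
    hBT _ (hκb (t := {k : ℕ | (k + j) % 3 = 1}) trivial)
  -- Each bucket is the middle one for exactly one of the three shifts.
  have hsum : ∫ ω, (G (P[Y|A ⊔ B] ω) - G (P[Y|B ⊔ T] ω)) ∂P =
      ∑ j ∈ Finset.range 3, ∫ ω in {ω | (κ (P[Y|B ⊔ T] ω) + j) % 3 = 1},
        (G (P[Y|A ⊔ B] ω) - G (P[Y|B ⊔ T] ω)) ∂P := by
    rw [← integral_biUnion_finset (Finset.range 3) (fun j _ => hm3 j) ?_
      fun j _ => hi.integrableOn]
    · rw [show ⋃ j ∈ Finset.range 3, {ω | (κ (P[Y|B ⊔ T] ω) + j) % 3 = 1} = univ from ?_,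
        setIntegral_univ]
      refine eq_univ_of_forall fun ω => mem_iUnion₂.2 ?_
      refine ⟨(4 - κ (P[Y|B ⊔ T] ω) % 3) % 3, Finset.mem_range.2 (Nat.mod_lt _ (by norm_num)), ?_⟩
      show (κ (P[Y|B ⊔ T] ω) + (4 - κ (P[Y|B ⊔ T] ω) % 3) % 3) % 3 = 1
      omega
    · intro i hi' j hj' hij
      refine Set.disjoint_left.2 fun ω h1 h2 => hij ?_
      have h1' : (κ (P[Y|B ⊔ T] ω) + i) % 3 = 1 := h1
      have h2' : (κ (P[Y|B ⊔ T] ω) + j) % 3 = 1 := h2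
      have := Finset.mem_range.1 hi'
      have := Finset.mem_range.1 hj'
      omega
  rw [← integral_sub in_ im, hsum]
  refine (Finset.sum_le_sum fun j hj' => hj j (Finset.mem_range.1 hj')).trans (le_of_eq ?_)
  simp only [Finset.sum_const, Finset.card_range, nsmul_eq_mul]
  push_cast
  ring

/-- Agreement implies accuracy for the second party. -/
theorem integral_loss_le [IsProbabilityMeasure P] (hG : ConvexOn ℝ (Icc 0 1) G)
    {r K M c : ℝ} (hr0 : 0 < r) (hr1 : r ≤ 1) (hK0 : 0 ≤ K)
    (hK : ∀ x ∈ Icc (0 : ℝ) 1, ∀ y ∈ Icc (0 : ℝ) 1, |G x - G y| ≤ K * |x - y| ^ r)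
    (hM : ∀ x ∈ Icc (0 : ℝ) 1, |G x| ≤ M) (hcpos : 0 < c) (htri : ApproxTriangle G c)
    (hA : A ≤ m0) (hB : B ≤ m0) (hT : T ≤ A ⊔ B)
    (hYm : AEStronglyMeasurable[m0] Y P) (hY : ∀ᵐ ω ∂P, Y ω ∈ Icc (0 : ℝ) 1)
    (hs : RectSubstitutes P A B Y G) (hRA : RectApprox P A B T) {ε : ℝ} (hε : 0 ≤ ε)
    (hagree : ∫ ω, jensenBregman G (P[Y|A ⊔ T] ω) (P[Y|B ⊔ T] ω) ∂P ≤ ε) :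
    ∫ ω, G (P[Y|A ⊔ B] ω) ∂P - ∫ ω, G (P[Y|B ⊔ T] ω) ∂P ≤
      (6 * ((1 + 2 / c) / c) + (3 * K + 6 * M)) * ε ^ (r / (r + 1)) := by
  -- Replacing `ε` by `e > ε` keeps the scale `e ^ (r / (r + 1))` positive when `ε = 0`. With this
  -- scale `δ`, also `(e / δ) ^ r = δ`.
  have key : ∀ e : ℝ, ε < e → ∫ ω, G (P[Y|A ⊔ B] ω) ∂P - ∫ ω, G (P[Y|B ⊔ T] ω) ∂P ≤
      (6 * ((1 + 2 / c) / c) + (3 * K + 6 * M)) * e ^ (r / (r + 1)) := by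
    intro e he
    have he0 : 0 < e := hε.trans_lt he
    have hδ : 0 < e ^ (r / (r + 1)) := Real.rpow_pos_of_pos he0 _
    refine (integral_loss_le_of_scale hG hr0 hr1 hK0 hK hM hcpos htri hA hB hT hYm hY hs hRA hδ
      (hagree.trans he.le)).trans (le_of_eq ?_)
    have e1 : (e / e ^ (r / (r + 1))) ^ r = e ^ (r / (r + 1)) := by
      have : e / e ^ (r / (r + 1)) = e ^ (1 / (r + 1)) := by
        rw [div_eq_iff hδ.ne', ← Real.rpow_add he0, ← add_div, add_comm 1 r,
          div_self (by positivity), Real.rpow_one]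
      rw [this, ← Real.rpow_mul he0.le]
      congr 1
      ring
    rw [e1]
    ring
  have hcont : Continuous fun e : ℝ =>
      (6 * ((1 + 2 / c) / c) + (3 * K + 6 * M)) * e ^ (r / (r + 1)) := by
    have : 0 ≤ r / (r + 1) := by positivity
    fun_prop (disch := assumption)
  refine ge_of_tendsto ((hcont.tendsto ε).mono_left (nhdsWithin_le_nhds (s := Ioi ε))) ?_
  filter_upwards [self_mem_nhdsWithin] with e he using key e he

/-- Without any information, the loss is at most twice the Jensen-Bregman divergence of the
endpoints. -/
theorem integral_loss_le_jensenBregman [IsProbabilityMeasure P] (hG : ConvexOn ℝ (Icc 0 1) G)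
    (hc : ContinuousOn G (Icc 0 1)) {m n : MeasurableSpace Ω} (hmn : m ≤ n) (hn : n ≤ m0)
    (hYm : AEStronglyMeasurable[m0] Y P) (hY : ∀ᵐ ω ∂P, Y ω ∈ Icc (0 : ℝ) 1) :
    ∫ ω, G (P[Y|n] ω) ∂P - ∫ ω, G (P[Y|m] ω) ∂P ≤ 2 * jensenBregman G 0 1 := by
  have h := integral_comp_sub_le_of_blocks (P := P) (g := fun _ => 0) (lo := fun _ => 0)
    (hi := fun _ => 1) hG hc hmn hn hYm hY measurable_const (by simp) (by simp) (fun _ => le_rfl)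
    (condExp_mem_Icc hn hYm hY)
  linarith

end Accuracy

/-! ### Transcripts are approximable by rectangles -/

theorem measurable_prodMk_sup {Ω X Z : Type*} [MeasurableSpace X] [MeasurableSpace Z]
    {m₁ m₂ : MeasurableSpace Ω} {f : Ω → X} {g : Ω → Z} (hf : Measurable[m₁] f)
    (hg : Measurable[m₂] g) : Measurable[m₁ ⊔ m₂] fun ω => (f ω, g ω) := by
  have hf' : Measurable[m₁ ⊔ m₂] f := hf.mono le_sup_left le_rfl
  have hg' : Measurable[m₁ ⊔ m₂] g := hg.mono le_sup_right le_rfl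
  exact hf'.prodMk hg'

namespace Protocol

variable {S T M : Type*} [MeasurableSpace S] [MeasurableSpace T] [MeasurableSpace M]
  (π : Protocol S T M)

theorem EndedBy.mono {π : Protocol S T M} {s : S} {t : T} {k n : ℕ} (h : π.EndedBy s t k)
    (hkn : k ≤ n) : π.EndedBy s t n :=
  h.imp fun _ h' => ⟨h'.1.trans hkn, h'.2⟩

theorem transcript_apply (s : S) (t : T) {n : ℕ} (i : Fin n) :
    π.transcript s t n i = π.transcript s t (i + 1) (Fin.last i) := by
  induction n with
  | zero => exact i.elim0
  | succ n ih =>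
    refine Fin.lastCases ?_ (fun j => ?_) i
    · rfl
    · rw [transcript, Fin.snoc_castSucc]
      exact ih j

theorem finalTranscript_eq_inr_iff (s : S) (t : T) (n : ℕ) :
    π.finalTranscript s t n = Sum.inr () ↔ π.EndedBy s t n := by
  unfold finalTranscript
  split_ifs with h <;> simp [h]

/-- Reads messages off final transcript entries, with a default for missing messages. -/
def readMessages (d : M) {n : ℕ} (u : Fin n → M ⊕ Unit) : Fin n → M :=
  fun i => Sum.elim id (fun _ => d) (u i)

theorem measurable_readMessages (d : M) (n : ℕ) :
    Measurable (readMessages d : (Fin n → M ⊕ Unit) → Fin n → M) :=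
  measurable_pi_lambda _ fun i =>
    (measurable_id.sumElim measurable_const).comp (measurable_pi_apply i)

theorem readMessages_finalTranscript (d : M) (s : S) (t : T) (n : ℕ)
    (h : ∀ i < n, ¬π.EndedBy s t i) :
    readMessages d (fun i : Fin n => π.finalTranscript s t i) = π.transcript s t n := by
  ext i
  rw [transcript_apply]
  simp [readMessages, finalTranscript, h i i.2]

/-- Whether the protocol has ended can be read off the earlier entries: either an end mark is among
them, or they are the full list of messages and can be tested for halting. -/
theorem endedBy_iff (d : M) (s : S) (t : T) (n : ℕ) :
    π.EndedBy s t n ↔ (∃ i : Fin n, π.finalTranscript s t i = Sum.inr ()) ∨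
      readMessages d (fun i : Fin n => π.finalTranscript s t i) ∈ π.halt n := by
  simp_rw [finalTranscript_eq_inr_iff]
  by_cases h : ∃ i : Fin n, π.EndedBy s t i
  · obtain ⟨i, hi⟩ := h
    exact ⟨fun _ => Or.inl ⟨i, hi⟩, fun _ => hi.mono i.2.le⟩
  · have h' : ∀ i < n, ¬π.EndedBy s t i := fun i hi hE => h ⟨⟨i, hi⟩, hE⟩
    rw [π.readMessages_finalTranscript d s t n h', or_iff_right h]
    refine ⟨fun ⟨k, hk, hkt⟩ => ?_, fun hn => ⟨n, le_rfl, hn⟩⟩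
    rcases hk.eq_or_lt with rfl | hk
    · exact hkt
    · exact absurd ⟨k, le_rfl, hkt⟩ (h' k hk)

/-- The next entry of the final transcript, from the earlier entries and the sender's message. -/
noncomputable def nextEntry (d : M) {X : Type*} {n : ℕ} (f : X × (Fin n → M) → M)
    (p : X × (Fin n → M ⊕ Unit)) : M ⊕ Unit :=
  open Classical in
  if (∃ i, p.2 i = Sum.inr ()) ∨ readMessages d p.2 ∈ π.halt n then Sum.inr ()
  else Sum.inl (f (p.1, readMessages d p.2))

theorem measurable_nextEntry (d : M) {X : Type*} [MeasurableSpace X] {n : ℕ}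
    {f : X × (Fin n → M) → M} (hf : Measurable f) : Measurable (π.nextEntry d f) := by
  classical
  have hr : Measurable fun p : X × (Fin n → M ⊕ Unit) => readMessages d p.2 :=
    (measurable_readMessages d n).comp measurable_snd
  refine Measurable.ite (MeasurableSet.union ?_ (hr (π.measurableSet_halt n))) measurable_const
    (measurable_inl.comp (hf.comp (measurable_fst.prodMk hr)))
  have : {p : X × (Fin n → M ⊕ Unit) | ∃ i, p.2 i = Sum.inr ()} =
      ⋃ i, (fun p : X × (Fin n → M ⊕ Unit) => p.2 i) ⁻¹' range Sum.inr := by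
    ext p
    simp only [mem_ofPred_eq, mem_iUnion, mem_preimage, mem_range]
    exact ⟨fun ⟨i, h⟩ => ⟨i, (), h.symm⟩, fun ⟨i, _, h⟩ => ⟨i, h.symm⟩⟩
  change MeasurableSet {p : X × (Fin n → M ⊕ Unit) | ∃ i, p.2 i = Sum.inr ()}
  rw [this]
  exact MeasurableSet.iUnion fun i =>
    ((measurable_pi_apply i).comp measurable_snd) measurableSet_range_inr

theorem finalTranscript_eq_nextEntry (d : M) (s : S) (t : T) (n : ℕ) :
    π.finalTranscript s t n = if π.aliceTurn n
      then π.nextEntry d (π.alice n) (s, fun i : Fin n => π.finalTranscript s t i)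
      else π.nextEntry d (π.bob n) (t, fun i : Fin n => π.finalTranscript s t i) := by
  have hE := π.endedBy_iff d s t n
  by_cases h : π.EndedBy s t n
  · rw [(π.finalTranscript_eq_inr_iff s t n).2 h]
    simp only [nextEntry, if_pos (hE.1 h), ite_self]
  · have h' : ∀ i < n, ¬π.EndedBy s t i := fun i hi hE => h (hE.mono hi.le)
    simp only [nextEntry, if_neg (fun hc => h (hE.2 hc)),
      π.readMessages_finalTranscript d s t n h']
    rw [finalTranscript, if_neg h, transcript, Fin.snoc_last]
    split_ifs <;> rfl

end Protocol

namespace InfoStructure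

variable {Ω S T M : Type*} {m : MeasurableSpace Ω} [m0 : MeasurableSpace Ω] [mS : MeasurableSpace S]
  [mT : MeasurableSpace T] [mM : MeasurableSpace M] (I : InfoStructure Ω S T) (π : Protocol S T M)

/-- The σ-algebra of the first `n` entries of the final transcript. -/
noncomputable abbrev transcriptSigma (n : ℕ) : MeasurableSpace Ω :=
  MeasurableSpace.comap (fun ω (i : Fin n) => I.finalTranscript π ω i) inferInstance

theorem measurable_entries (n : ℕ) : Measurable[I.transcriptSigma π n]
    fun ω (i : Fin n) => I.finalTranscript π ω i :=
  comap_measurable _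

theorem measurable_entry {n i : ℕ} (h : i < n) :
    Measurable[I.transcriptSigma π n] fun ω => I.finalTranscript π ω i :=
  (measurable_pi_apply (⟨i, h⟩ : Fin n)).comp (I.measurable_entries π n)

theorem transcriptSigma_mono : Monotone (I.transcriptSigma π) := fun _ k h =>
  Measurable.comap_le (@measurable_pi_lambda _ _ _ (I.transcriptSigma π k) _ _ fun i =>
    I.measurable_entry π (i.2.trans_le h))

theorem nonempty_message (I : InfoStructure Ω S T) (π : Protocol S T M) : Nonempty M := by
  have := I.isProbabilityMeasure
  obtain ⟨ω⟩ := nonempty_of_isProbabilityMeasure I.P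
  exact ⟨π.alice 0 (I.σ ω, Fin.elim0)⟩

/-- The next entry is a function of the sender's signal and the earlier entries, which is the form
in which `RectApprox.extend_left` and `RectApprox.extend_right` take a message. -/
theorem transcriptSigma_succ_le (n : ℕ) :
    I.transcriptSigma π (n + 1) ≤ (if π.aliceTurn n then mS.comap I.σ else mT.comap I.τ) ⊔
      I.transcriptSigma π n := by
  obtain ⟨d⟩ := I.nonempty_message π
  have hu := I.measurable_entries π n
  have hj := fun j : Fin n => I.measurable_entry π j.2
  have e : (fun ω => I.finalTranscript π ω (Fin.last n : Fin (n + 1))) = fun ω =>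
      if π.aliceTurn n
        then π.nextEntry d (π.alice n) (I.σ ω, fun i : Fin n => I.finalTranscript π ω i)
        else π.nextEntry d (π.bob n) (I.τ ω, fun i : Fin n => I.finalTranscript π ω i) :=
    funext fun ω => π.finalTranscript_eq_nextEntry d (I.σ ω) (I.τ ω) n
  split_ifs with h
  · refine Measurable.comap_le (@measurable_pi_lambda _ _ _ (mS.comap I.σ ⊔ I.transcriptSigma π n) _ _
      fun i => ?_)
    refine Fin.lastCases ?_ (fun j => (hj j).mono le_sup_right le_rfl) i
    simp only [e, h]
    exact (π.measurable_nextEntry d (π.measurable_alice n)).comp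
      (measurable_prodMk_sup (comap_measurable I.σ) hu)
  · refine Measurable.comap_le (@measurable_pi_lambda _ _ _ (mT.comap I.τ ⊔ I.transcriptSigma π n) _ _
      fun i => ?_)
    refine Fin.lastCases ?_ (fun j => (hj j).mono le_sup_right le_rfl) i
    simp only [e, h]
    exact (π.measurable_nextEntry d (π.measurable_bob n)).comp
      (measurable_prodMk_sup (comap_measurable I.τ) hu)

theorem comap_finalTranscript_eq_iSup :
    MeasurableSpace.comap (I.finalTranscript π) inferInstance = ⨆ n, I.transcriptSigma π n := by
  refine le_antisymm (Measurable.comap_le ?_) (iSup_le fun n => Measurable.comap_le ?_)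
  · exact @measurable_pi_lambda _ _ _ (⨆ n, I.transcriptSigma π n) _ _ fun i =>
      (I.measurable_entry π i.lt_succ_self).mono (le_iSup (I.transcriptSigma π) (i + 1)) le_rfl
  · exact @measurable_pi_lambda _ _ _ (MeasurableSpace.comap (I.finalTranscript π) inferInstance)
      _ _ fun i => (measurable_pi_apply (i : ℕ)).comp (comap_measurable (I.finalTranscript π))

theorem transcriptSigma_zero_le : I.transcriptSigma π 0 ≤ ⊥ := by
  refine Measurable.comap_le ?_
  have : (fun ω (i : Fin 0) => I.finalTranscript π ω i) = fun _ i => i.elim0 :=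
    funext fun ω => Subsingleton.elim _ _
  rw [this]
  exact @measurable_const _ _ _ ⊥ _

theorem transcriptSigma_le (n : ℕ) :
    I.transcriptSigma π n ≤ mS.comap I.σ ⊔ mT.comap I.τ := by
  induction n with
  | zero => exact (I.transcriptSigma_zero_le π).trans bot_le
  | succ n ih =>
    refine (I.transcriptSigma_succ_le π n).trans (sup_le ?_ ih)
    split_ifs
    exacts [le_sup_left, le_sup_right]

theorem comap_finalTranscript_le :
    MeasurableSpace.comap (I.finalTranscript π) inferInstance ≤ mS.comap I.σ ⊔ mT.comap I.τ := by
  rw [comap_finalTranscript_eq_iSup]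
  exact iSup_le (I.transcriptSigma_le π)

theorem rectApprox_finalTranscript :
    RectApprox I.P (mS.comap I.σ) (mT.comap I.τ)
      (MeasurableSpace.comap (I.finalTranscript π) inferInstance) := by
  have := I.isProbabilityMeasure
  have hσ := I.measurable_σ.comap_le
  have hτ := I.measurable_τ.comap_le
  have hle : ∀ n, I.transcriptSigma π n ≤ m0 := fun n =>
    (I.transcriptSigma_le π n).trans (sup_le hσ hτ)
  rw [comap_finalTranscript_eq_iSup]
  refine RectApprox.iSup (I.transcriptSigma_mono π) hle fun n => ?_
  induction n with
  | zero =>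
    rw [le_bot_iff.1 (I.transcriptSigma_zero_le π)]
    exact rectApprox_bot
  | succ n ih =>
    have h := I.transcriptSigma_succ_le π n
    have hs := I.transcriptSigma_mono π n.le_succ
    split_ifs at h
    · exact ih.extend_left hσ (hle n) hs h
    · exact ih.extend_right hτ (hle n) hs h

/-! ### From expected errors to expected values of `G` -/

variable {G : ℝ → ℝ}

theorem expectedError_eq (hG : ConvexOn ℝ (Icc 0 1) G) (hd : DifferentiableOn ℝ G (Ioo 0 1))
    (hc : ContinuousOn G (Icc 0 1)) {A : Set S} {B : Set T} (hP : I.P (I.rect A B) ≠ 0)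
    {X : Ω → ℝ} (hm : m ≤ m0)
    (hX : X =ᵐ[cond I.P (I.rect A B)] (cond I.P (I.rect A B))[I.Y|m]) :
    I.expectedError G A B X = ENNReal.ofReal (∫ ω, G (I.Y ω) ∂(cond I.P (I.rect A B)) -
        ∫ ω, G (X ω) ∂(cond I.P (I.rect A B))) ∧
      ∫ ω, G (X ω) ∂(cond I.P (I.rect A B)) ≤ ∫ ω, G (I.Y ω) ∂(cond I.P (I.rect A B)) := by
  have := I.isProbabilityMeasure
  have := cond_isProbabilityMeasure hP
  have hYm : AEStronglyMeasurable[m0] I.Y (cond I.P (I.rect A B)) :=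
    I.measurable_Y.aestronglyMeasurable
  have hY : ∀ᵐ ω ∂(cond I.P (I.rect A B)), I.Y ω ∈ Icc (0 : ℝ) 1 := ae_of_all _ I.Y_mem
  have e : ∫ ω, G (X ω) ∂(cond I.P (I.rect A B)) =
      ∫ ω, G ((cond I.P (I.rect A B))[I.Y|m] ω) ∂(cond I.P (I.rect A B)) :=
    integral_congr_ae (hX.mono fun ω h => by simp only [h])
  rw [e]
  constructor
  · rw [← lintegral_bregmanDiv_condExp hG hd hc hm hYm hY]
    exact lintegral_congr_ae (hX.mono fun ω h => by simp only [h])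
  · simpa using setIntegral_comp_condExp_le hG hc hm hYm hY MeasurableSet.univ

theorem truth_eq : I.truth = I.P[I.Y|mS.comap I.σ ⊔ mT.comap I.τ] := by
  rw [← MeasurableSpace.comap_prodMk]
  rfl

theorem aliceExpectation_eq : I.aliceExpectation π =
    I.P[I.Y|mS.comap I.σ ⊔ MeasurableSpace.comap (I.finalTranscript π) inferInstance] := by
  rw [← MeasurableSpace.comap_prodMk]
  rfl

theorem bobExpectation_eq : I.bobExpectation π =
    I.P[I.Y|mT.comap I.τ ⊔ MeasurableSpace.comap (I.finalTranscript π) inferInstance] := by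
  rw [← MeasurableSpace.comap_prodMk]
  rfl

/-- Each expected error is the mean of `G(Y)` minus that of `G` of the estimate. The means of `G(Y)`
cancel, and multiplying by the probability of the rectangle turns conditional means into integrals
over it. -/
theorem RectangleSubstitutes.rectSubstitutes {I : InfoStructure Ω S T}
    (h : I.RectangleSubstitutes G) (hG : ConvexOn ℝ (Icc 0 1) G)
    (hd : DifferentiableOn ℝ G (Ioo 0 1)) (hc : ContinuousOn G (Icc 0 1)) :
    RectSubstitutes I.P (mS.comap I.σ) (mT.comap I.τ) I.Y G := by
  have := I.isProbabilityMeasure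
  have hσ := I.measurable_σ.comap_le
  have hτ := I.measurable_τ.comap_le
  have hYi : Integrable[m0] I.Y I.P :=
    integrable_of_ae_mem_Icc I.measurable_Y.aestronglyMeasurable (ae_of_all _ I.Y_mem)
  rintro _ _ ⟨A, hA, rfl⟩ ⟨B, hB, rfl⟩ hP
  have hP' : I.P (I.rect A B) ≠ 0 := hP
  have haσ : MeasurableSet[mS.comap I.σ] (I.σ ⁻¹' A) := ⟨A, hA, rfl⟩
  have hbτ : MeasurableSet[mT.comap I.τ] (I.τ ⁻¹' B) := ⟨B, hB, rfl⟩
  have hR : MeasurableSet[mS.comap I.σ ⊔ mT.comap I.τ] (I.σ ⁻¹' A ∩ I.τ ⁻¹' B) :=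
    MeasurableSet.inter (le_sup_left (a := mS.comap I.σ) _ haσ)
      (le_sup_right (b := mT.comap I.τ) _ hbτ)
  have := cond_isProbabilityMeasure hP
  obtain ⟨e1, l1⟩ := I.expectedError_eq hG hd hc hP' (X := I.condBob A) hτ
    (condExp_cond_inter hτ (hσ _ haσ) hbτ hYi)
  obtain ⟨e2, l2⟩ := I.expectedError_eq hG hd hc hP' (X := I.condAlice B) hσ (by
    have := condExp_cond_inter hσ (hτ _ hbτ) haσ hYi
    rw [inter_comm] at this
    exact this)
  obtain ⟨e3, l3⟩ := I.expectedError_eq hG hd hc hP' (X := fun _ => I.condRect A B)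
    (m := ⊥) bot_le (by
      have : IsProbabilityMeasure (cond I.P (I.rect A B)) := cond_isProbabilityMeasure hP'
      rw [condExp_bot]
      rfl)
  obtain ⟨e4, l4⟩ := I.expectedError_eq hG hd hc hP' (X := I.truth) (sup_le hσ hτ) (by
    have := condExp_cond_inter (P := I.P) (sup_le hσ hτ) MeasurableSet.univ hR hYi
    rw [cond_univ, univ_inter] at this
    rw [truth_eq]
    exact this)
  have key := h A B hA hB hP'
  rw [e1, e2, e3, e4, ← ENNReal.ofReal_add (sub_nonneg.2 l1) (sub_nonneg.2 l2),
    ← ENNReal.ofReal_add (sub_nonneg.2 l3) (sub_nonneg.2 l4),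
    ENNReal.ofReal_le_ofReal_iff (add_nonneg (sub_nonneg.2 l3) (sub_nonneg.2 l4))] at key
  have hpos : 0 < I.P.real (I.rect A B) := ENNReal.toReal_pos hP' (measure_ne_top _ _)
  have : IsProbabilityMeasure (cond I.P (I.rect A B)) := cond_isProbabilityMeasure hP'
  have e5 : ∫ _, G (I.condRect A B) ∂(cond I.P (I.rect A B)) = G (I.condRect A B) := by simp
  rw [e5] at key
  have key2 : ∫ ω, G (I.truth ω) ∂(cond I.P (I.rect A B)) + G (I.condRect A B) ≤
      ∫ ω, G (I.condBob A ω) ∂(cond I.P (I.rect A B)) +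
        ∫ ω, G (I.condAlice B ω) ∂(cond I.P (I.rect A B)) := by linarith
  rw [integral_cond, integral_cond, integral_cond] at key2
  have key3 := mul_le_mul_of_nonneg_left key2 hpos.le
  rw [mul_add, mul_add, mul_inv_cancel_left₀ hpos.ne', mul_inv_cancel_left₀ hpos.ne',
    mul_inv_cancel_left₀ hpos.ne', truth_eq] at key3
  exact key3

/-- By the tower property the estimate is also the conditional expectation of the truth, so its
divergence is a difference of expected values of `G`. -/
theorem accurate_of_loss_le (hG : ConvexOn ℝ (Icc 0 1) G) (hd : DifferentiableOn ℝ G (Ioo 0 1))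
    (hc : ContinuousOn G (Icc 0 1))
    (hm : m ≤ mS.comap I.σ ⊔ mT.comap I.τ) {δ : ℝ}
    (h : ∫ ω, G (I.P[I.Y|mS.comap I.σ ⊔ mT.comap I.τ] ω) ∂I.P - ∫ ω, G (I.P[I.Y|m] ω) ∂I.P ≤ δ) :
    I.Accurate G (I.P[I.Y|m]) δ := by
  have := I.isProbabilityMeasure
  have hst : mS.comap I.σ ⊔ mT.comap I.τ ≤ m0 :=
    sup_le I.measurable_σ.comap_le I.measurable_τ.comap_le
  have hYm : AEStronglyMeasurable[m0] I.Y I.P := I.measurable_Y.aestronglyMeasurable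
  have ht := condExp_mem_Icc hst hYm (ae_of_all _ I.Y_mem)
  have tw := condExp_condExp_of_le (f := I.Y) (μ := I.P) hm hst
  have e := lintegral_bregmanDiv_condExp (P := I.P) hG hd hc (hm.trans hst)
    (aestronglyMeasurable_condExp hst) ht
  have e1 : ∫⁻ ω, bregmanDiv G (I.truth ω) (I.P[I.Y|m] ω) ∂I.P = _ :=
    (lintegral_congr_ae (tw.mono fun ω h => by simp only [h, truth_eq])).trans e
  have e2 : ∫ ω, G (I.P[I.P[I.Y|mS.comap I.σ ⊔ mT.comap I.τ]|m] ω) ∂I.P =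
      ∫ ω, G (I.P[I.Y|m] ω) ∂I.P := integral_congr_ae (tw.mono fun ω h => by simp only [h])
  rw [Accurate, e1, e2]
  exact ENNReal.ofReal_le_ofReal h

end InfoStructure

/-! ### The main theorem -/

open InfoStructure in
theorem accurate_of_two_mul_jensenBregman_le {G : ℝ → ℝ} (hG : ConvexOn ℝ (Icc 0 1) G)
    (hd : DifferentiableOn ℝ G (Ioo 0 1)) (hc : ContinuousOn G (Icc 0 1)) {δ : ℝ}
    (hδ : 2 * jensenBregman G 0 1 ≤ δ)
    {Ω S T M : Type*} [MeasurableSpace Ω] [MeasurableSpace S] [MeasurableSpace T]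
    [MeasurableSpace M] (I : InfoStructure Ω S T) (π : Protocol S T M) :
    I.Accurate G (I.aliceExpectation π) δ ∧ I.Accurate G (I.bobExpectation π) δ := by
  have := I.isProbabilityMeasure
  have hst := sup_le I.measurable_σ.comap_le I.measurable_τ.comap_le
  have hT := I.comap_finalTranscript_le π
  rw [aliceExpectation_eq, bobExpectation_eq]
  refine ⟨I.accurate_of_loss_le hG hd hc (sup_le le_sup_left hT) ?_,
    I.accurate_of_loss_le hG hd hc (sup_le le_sup_right hT) ?_⟩
  · exact (integral_loss_le_jensenBregman hG hc (sup_le le_sup_left hT) hst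
      I.measurable_Y.aestronglyMeasurable (ae_of_all _ I.Y_mem)).trans hδ
  · exact (integral_loss_le_jensenBregman hG hc (sup_le le_sup_right hT) hst
      I.measurable_Y.aestronglyMeasurable (ae_of_all _ I.Y_mem)).trans hδ

open InfoStructure in
/-- Agreement implies accuracy, with an exponent that does not depend on the constant in the
approximate triangle inequality. -/
theorem accurate_of_causesAgreement {G : ℝ → ℝ} (hG : ConvexOn ℝ (Icc 0 1) G)
    (hd : DifferentiableOn ℝ G (Ioo 0 1)) {r K M₀ c : ℝ} (hr0 : 0 < r) (hr1 : r ≤ 1) (hK0 : 0 ≤ K)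
    (hK : ∀ x ∈ Icc (0 : ℝ) 1, ∀ y ∈ Icc (0 : ℝ) 1, |G x - G y| ≤ K * |x - y| ^ r)
    (hM : ∀ x ∈ Icc (0 : ℝ) 1, |G x| ≤ M₀) (hcpos : 0 < c) (htri : ApproxTriangle G c)
    {Ω S T M : Type*} [MeasurableSpace Ω] [MeasurableSpace S] [MeasurableSpace T]
    [MeasurableSpace M] (I : InfoStructure Ω S T) (π : Protocol S T M) {ε δ : ℝ} (hε : 0 ≤ ε)
    (hs : I.RectangleSubstitutes G) (ha : I.CausesAgreement G π ε)
    (hδ : (6 * ((1 + 2 / c) / c) + (3 * K + 6 * M₀)) * ε ^ (r / (r + 1)) ≤ δ) :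
    I.Accurate G (I.aliceExpectation π) δ ∧ I.Accurate G (I.bobExpectation π) δ := by
  have := I.isProbabilityMeasure
  have hc := ConvexOn.continuousOn_of_rpow hr0 hK
  have hσ := I.measurable_σ.comap_le
  have hτ := I.measurable_τ.comap_le
  have hT := I.comap_finalTranscript_le π
  have hRS := hs.rectSubstitutes hG hd hc
  have hRA := I.rectApprox_finalTranscript π
  have hagree := ha.2
  rw [aliceExpectation_eq, bobExpectation_eq] at *
  refine ⟨I.accurate_of_loss_le hG hd hc (sup_le le_sup_left hT) ?_,
    I.accurate_of_loss_le hG hd hc (sup_le le_sup_right hT) ?_⟩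
  -- Alice's bound is Bob's with the roles exchanged; every ingredient is symmetric.
  · have hagree := (integral_congr_ae (ae_of_all I.P fun ω =>
      jensenBregman_comm (G := G) (I.P[I.Y|_ ⊔ _] ω) (I.P[I.Y|_ ⊔ _] ω))).symm.trans_le hagree
    have h := integral_loss_le hG hr0 hr1 hK0 hK hM hcpos htri hτ hσ (hT.trans_eq (sup_comm _ _))
      I.measurable_Y.aestronglyMeasurable (ae_of_all _ I.Y_mem) hRS.symm hRA.symm hε hagree
    rw [sup_comm (MeasurableSpace.comap I.τ _)] at h
    exact h.trans hδ
  · exact (integral_loss_le hG hr0 hr1 hK0 hK hM hcpos htri hσ hτ hT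
      I.measurable_Y.aestronglyMeasurable (ae_of_all _ I.Y_mem) hRS hRA hε hagree).trans hδ

/-- Taking the third point equal to an endpoint gives `c * JB_G(0, 1) ≤ JB_G(0, 1)`. -/
theorem ApproxTriangle.jensenBregman_nonpos {G : ℝ → ℝ} {c : ℝ} (h : ApproxTriangle G c)
    (hc : 1 < c) : jensenBregman G 0 1 ≤ 0 := by
  have := h 0 (by simp) 1 (by simp) 0 (by simp)
  rw [jensenBregman_self, zero_add] at this
  nlinarith

theorem rpow_le_of_le_one {r c ε : ℝ} (hr : 0 < r) (hc0 : 0 < c) (hc1 : c ≤ 1) (hε0 : 0 ≤ ε)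
    (hε1 : ε ≤ 1) : ε ^ (r / (r + 1)) ≤ ε ^ (r / (r + 1 - Real.logb 2 c)) := by
  have hl : Real.logb 2 c ≤ 0 := Real.logb_nonpos (by norm_num) hc0.le hc1
  refine Real.rpow_le_rpow_of_exponent_ge' hε0 hε1 (div_nonneg hr.le (by linarith)) ?_
  gcongr
  linarith

theorem exists_accurate {G : ℝ → ℝ} {r : ℝ} (hG : ConvexOn ℝ (Icc 0 1) G)
    (hd : DifferentiableOn ℝ G (Ioo 0 1)) (hr : 0 < r)
    (h0 : ∃ K : ℝ, ∀ᶠ x in 𝓝[>] (0 : ℝ), G 0 - G x ≤ K * x ^ r)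
    (h1 : ∃ K : ℝ, ∀ᶠ x in 𝓝[>] (0 : ℝ), G 1 - G (1 - x) ≤ K * x ^ r) :
    ∃ C : ℝ, ∀ c : ℝ, 0 < c → ApproxTriangle G c →
      ∀ (Ω S T M : Type*) [MeasurableSpace Ω] [MeasurableSpace S] [MeasurableSpace T]
        [MeasurableSpace M] (I : InfoStructure Ω S T) (π : Protocol S T M) (ε : ℝ),
        0 ≤ ε → I.RectangleSubstitutes G → I.CausesAgreement G π ε →
        I.Accurate G (I.aliceExpectation π) (C * ε ^ (r / (r + 1 - Real.logb 2 c))) ∧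
        I.Accurate G (I.bobExpectation π) (C * ε ^ (r / (r + 1 - Real.logb 2 c))) := by
  obtain ⟨K, hK0, hK⟩ := hG.exists_abs_sub_le_rpow hr h0 h1
  obtain ⟨M₀, hM⟩ := hG.exists_abs_le
  have hM0 : 0 ≤ M₀ := (abs_nonneg _).trans (hM 0 (by simp))
  have hcont := ConvexOn.continuousOn_of_rpow hr hK
  -- The constant must not depend on `c`, so one admissible `c₀` is fixed to build it. The given `c`
  -- then enters only through the exponent.
  by_cases h : ∃ c₀, 0 < c₀ ∧ ApproxTriangle G c₀
  swap
  · exact ⟨0, fun c hc ht => (h ⟨c, hc, ht⟩).elim⟩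
  obtain ⟨c₀, hc₀, ht₀⟩ := h
  set C₁ := 6 * ((1 + 2 / c₀) / c₀) + (3 * K + 6 * M₀) with hC₁
  have hC₁0 : 0 ≤ C₁ := by positivity
  refine ⟨max C₁ (2 * jensenBregman G 0 1), fun c hc ht Ω S T M _ _ _ _ I π ε hε hs ha => ?_⟩
  have hC0 : 0 ≤ max C₁ (2 * jensenBregman G 0 1) := le_max_of_le_left hC₁0
  have hq := Real.rpow_nonneg hε (r / (r + 1 - Real.logb 2 c))
  by_cases hJ : jensenBregman G 0 1 ≤ 0
  · exact accurate_of_two_mul_jensenBregman_le hG hd hcont (by nlinarith) I π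
  have hr1 : r ≤ 1 := not_lt.1 fun hr1 => hJ (jensenBregman_zero_one_nonpos hG hr1 hK)
  have hc1 : c ≤ 1 := not_lt.1 fun hc1 => hJ (ht.jensenBregman_nonpos hc1)
  -- For `ε ≤ 1` the proved exponent `r / (r + 1)` is at least the required one, as `log₂ c ≤ 0`.
  -- For `ε ≥ 1` the required power is at least `1` and the trivial bound suffices.
  rcases le_total ε 1 with hε1 | hε1
  · refine accurate_of_causesAgreement hG hd hr hr1 hK0 hK hM hc₀ ht₀ I π hε hs ha ?_
    exact mul_le_mul (le_max_left _ _) (rpow_le_of_le_one hr hc hc1 hε hε1)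
      (Real.rpow_nonneg hε _) hC0
  · refine accurate_of_two_mul_jensenBregman_le hG hd hcont ((le_max_right C₁ _).trans ?_) I π
    have hl : Real.logb 2 c ≤ 0 := Real.logb_nonpos (by norm_num) hc.le hc1
    exact le_mul_of_one_le_right hC0
      (Real.one_le_rpow hε1 (div_nonneg hr.le (by linarith)))

/-- Here `JB_G(a, b) = (a - b)² / 4`, and the sum of the two squares on the right is smallest at the
midpoint. With `r = 1` this `c` gives the exponent `1 / 3`. -/
theorem approxTriangle_sq : ApproxTriangle (fun x => x ^ 2) (1 / 2) := fun a _ b _ x _ => by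
  simp only [jensenBregman]
  nlinarith [sq_nonneg (a + b - 2 * x)]

theorem exists_accurate_sq :
    ∃ C : ℝ, ∀ (Ω S T M : Type*) [MeasurableSpace Ω] [MeasurableSpace S] [MeasurableSpace T]
        [MeasurableSpace M] (I : InfoStructure Ω S T) (π : Protocol S T M) (ε : ℝ),
        0 ≤ ε → I.RectangleSubstitutes (fun x => x ^ 2) →
        I.CausesAgreement (fun x => x ^ 2) π ε →
        I.Accurate (fun x => x ^ 2) (I.aliceExpectation π) (C * ε ^ (1 / 3 : ℝ)) ∧
        I.Accurate (fun x => x ^ 2) (I.bobExpectation π) (C * ε ^ (1 / 3 : ℝ)) := by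
  have hpos : ∀ᶠ x : ℝ in 𝓝[>] (0 : ℝ), 0 < x := self_mem_nhdsWithin
  obtain ⟨C, hC⟩ := exists_accurate (G := fun x => x ^ 2) (r := 1)
    ((even_two.convexOn_pow (𝕜 := ℝ)).subset (subset_univ _) (convex_Icc 0 1))
    (by fun_prop) one_pos
    ⟨0, hpos.mono fun x hx => by simp only [Real.rpow_one]; nlinarith⟩
    ⟨2, hpos.mono fun x hx => by simp only [Real.rpow_one]; nlinarith⟩
  have e : (1 : ℝ) / (1 + 1 - Real.logb 2 (1 / 2)) = 1 / 3 := by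
    rw [one_div 2, Real.logb_inv, Real.logb_self_eq_one (by norm_num)]
    norm_num
  refine ⟨C, ?_⟩
  have := hC (1 / 2) (by norm_num) approxTriangle_sq
  rwa [e] at this

theorem corollary4p5 :
    (∀ (G : ℝ → ℝ) (r : ℝ),
      ConvexOn ℝ (Icc 0 1) G → DifferentiableOn ℝ G (Ioo 0 1) → 0 < r →
      (∃ K : ℝ, ∀ᶠ x in 𝓝[>] (0 : ℝ), G 0 - G x ≤ K * x ^ r) →
      (∃ K : ℝ, ∀ᶠ x in 𝓝[>] (0 : ℝ), G 1 - G (1 - x) ≤ K * x ^ r) →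
      ∃ C : ℝ, ∀ c : ℝ, 0 < c → ApproxTriangle G c →
        ∀ (Ω S T M : Type*) [MeasurableSpace Ω] [MeasurableSpace S] [MeasurableSpace T]
          [MeasurableSpace M] (I : InfoStructure Ω S T) (π : Protocol S T M) (ε : ℝ),
          0 ≤ ε → I.RectangleSubstitutes G → I.CausesAgreement G π ε →
          I.Accurate G (I.aliceExpectation π) (C * ε ^ (r / (r + 1 - Real.logb 2 c))) ∧
          I.Accurate G (I.bobExpectation π) (C * ε ^ (r / (r + 1 - Real.logb 2 c)))) ∧
    (∃ C : ℝ, ∀ (Ω S T M : Type*) [MeasurableSpace Ω] [MeasurableSpace S] [MeasurableSpace T]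
        [MeasurableSpace M] (I : InfoStructure Ω S T) (π : Protocol S T M) (ε : ℝ),
        0 ≤ ε → I.RectangleSubstitutes (fun x => x ^ 2) →
        I.CausesAgreement (fun x => x ^ 2) π ε →
        I.Accurate (fun x => x ^ 2) (I.aliceExpectation π) (C * ε ^ (1 / 3 : ℝ)) ∧
        I.Accurate (fun x => x ^ 2) (I.bobExpectation π) (C * ε ^ (1 / 3 : ℝ))) := by
  exact ⟨fun _ _ hG hd hr h0 h1 => exists_accurate hG hd hr h0 h1, exists_accurate_sq⟩
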